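/- **Setting.** Let $\mathcal P_1(\mathbb R^d)$ be the Borel probability measures on $\mathbb R^d$ with finite first moment, with the Wasserstein distance $W_1$. Let $U\subseteq\mathbb R^d$ be a linear subspace and $\mathcal M(\mathbb R^d\times[0,1];U)$ the finite $U$-valued Borel measures with the narrow topology (duality with bounded continuous functions $\mathbb R^d\times[0,1]\to U$). $C([0,1];\mathcal P_1(\mathbb R^d))$ carries uniform convergence in $W_1$. Assume: 1. $m_0,m_1\in\mathcal P_1(\mathbb R^d)$, and $m_1$ has a Lebesgue density, also denoted $m_1$, in $L^2(\mathbb R^d)$. 2. $L:\mathbb R^d\times\mathcal P_1(\mathbb R^d)\to[0,+\infty]$ either is finite everywhere and jointly uniformly continuous, or does not depend on its second variable, is such that $\{L=+\infty\}$ is open, and is continuous on $\{L<+\infty\}$. 3. $\psi:U\to[0,+\infty)$ is convex and lower semicontinuous, $\psi(0)=0$, and there are $C>0$ and a function $\phi:[0,\infty)\to[0,\infty)$ with $\phi(|u|)-1\le\psi(u)\le C(1+\phi(|u|))$ for all $u\in U$, where $\phi$ is strictly convex, continuously differentiable, superlinear at $+\infty$, with $\phi(0)=\phi'(0)=0$ and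 $\phi(2r)\le K(1+\phi(r))$ for all $r\ge0$ and some $K>0$. (For example $\psi(u)=\frac1p|u|^p$ with $p>1$.) 4. $\mathbf F:\mathbb R^d\times\mathcal P_1(\mathbb R^d)\to\mathbb R^d$ is jointly uniformly continuous, and for some $C_F,C_F'\ge0$, $|\mathbf F(y,\mu)|\le C_F+C_F'\big(|y|+\int|z|\,d\mu(z)\big)$ for all $y,\mu$. 5. $k:\mathbb R^d\to[0,\infty)$ is bounded, continuous and even, $\int|x|k(x)\,dx<\infty$ and $\int k=1$; $k_\delta(y)=\delta^{-d}k(y/\delta)$ and $k_\delta*\mu(y)=\int k_\delta(y-x)\,d\mu(x)$. Let $\mathcal C(m_0)$ be the set of pairs $(\mu,\boldsymbol\nu)$ with $\mu\in AC([0,1];\mathcal P_1(\mathbb R^d))$, $\boldsymbol\nu\in\mathcal M(\mathbb R^d\times[0,1];U)$, $\mu_0=m_0$ and $\partial_t\mu_t+\nabla\cdot(\mathbf F(\cdot,\mu_t)\mu_t+\boldsymbol\nu_t)=0$ in the sense that for all $\varphi\in C_c^\infty(\mathbb R^d\times(0,1))$ $$\int_0^1\!\!\int\big(\partial_t\varphi(y,t)+\nabla\varphi(y,t)\cdot\mathbf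 F(y,\mu_t)\big)\,d\mu_t(y)\,dt+\int\nabla\varphi\cdot d\boldsymbol\nu=0.$$ Let $\mathcal G(\mu,\boldsymbol\nu)=\Psi(\boldsymbol\nu|\mu)+\int_0^1\!\int L(y,\mu_t)\,d\mu_t(y)\,dt$, where $\Psi(\boldsymbol\nu|\mu)=\int_0^1\!\int\psi(\mathbf u(y,t))\,d\mu_t(y)\,dt$ if $d\boldsymbol\nu(y,t)=\mathbf u(y,t)\,d\mu_t(y)\,dt$ for some $\mathbf u$, and $\Psi(\boldsymbol\nu|\mu)=+\infty$ otherwise. For $\varepsilon,\delta>0$ and $m\in\mathcal P_1(\mathbb R^d)$ let $$\mathcal F_\varepsilon(m)=\begin{cases}\frac1\varepsilon\int|m(y)-m_1(y)|^2dy&\text{if } m \text{ has a Lebesgue density } m(y) \text{ in } L^2(\mathbb R^d),\\+\infty&\text{otherwise,}\end{cases}\qquad \mathcal F_{\varepsilon,\delta}(m)=\frac1\varepsilon\int|k_\delta*m(y)-k_\delta*m_1(y)|^2dy.$$ Problem (MFC$_\varepsilon$) is to minimize $\mathcal E_\varepsilon(\mu,\boldsymbol\nu)=\mathcal G(\mu,\boldsymbol\nu)+\mathcal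 F_\varepsilon(\mu_1)$ over $\mathcal C(m_0)$, and (MFC$_{\varepsilon,\delta}$) is to minimize $\mathcal E_{\varepsilon,\delta}(\mu,\boldsymbol\nu)=\mathcal G(\mu,\boldsymbol\nu)+\mathcal F_{\varepsilon,\delta}(\mu_1)$ over $\mathcal C(m_0)$. A problem is feasible if its objective is finite at some element of $\mathcal C(m_0)$. **Theorem (convergence as $\delta\to0$).** Fix $\varepsilon>0$ and suppose that (MFC$_\varepsilon$) is feasible. Let $\delta_n>0$ with $\delta_n\to0$, and let $(\mu_n,\boldsymbol\nu_n)$ be a minimizer of (MFC$_{\varepsilon,\delta_n}$) for each $n$. Then there is $(\mu,\boldsymbol\nu)$ such that, along a subsequence, $$(\mu_n,\boldsymbol\nu_n)\to(\mu,\boldsymbol\nu)\quad\text{in } C([0,1];\mathcal P_1(\mathbb R^d))\times\mathcal M(\mathbb R^d\times[0,1];U),$$ and $(\mu,\boldsymbol\nu)$ is a minimizer of (MFC$_\varepsilon$). -/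

import Mathlib

open MeasureTheory Filter Topology Set
open scoped ENNReal ContDiff unitInterval

noncomputable section

namespace MeanFieldControl

/-- The Euclidean space `ℝ^d`. -/
abbrev Space (d : ℕ) := EuclideanSpace ℝ (Fin d)

/-- Borel probability measures on `ℝ^d` with finite first moment. -/
def P₁ (d : ℕ) : Type :=
  {μ : ProbabilityMeasure (Space d) // ∫⁻ x, ‖x‖ₑ ∂(μ : Measure (Space d)) ≠ ⊤}

/-- The underlying measure of an element of `P₁ d`. -/
def P₁.meas {d : ℕ} (μ : P₁ d) : Measure (Space d) := (μ.1 : Measure (Space d))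

/-- The `1`-Wasserstein distance: infimum of the transport cost over all couplings. -/
def W₁ {d : ℕ} (μ ν : P₁ d) : ℝ≥0∞ :=
  ⨅ (γ : Measure (Space d × Space d))
    (_ : γ.map Prod.fst = μ.meas ∧ γ.map Prod.snd = ν.meas), ∫⁻ z, ‖z.1 - z.2‖ₑ ∂γ

/-- Absolutely continuous curves in `(P₁, W₁)`: the distance `W₁ (μ s) (μ t)` is controlled by the
integral over `[s, t]` of an integrable function. -/
def IsACCurve {d : ℕ} (μ : I → P₁ d) : Prop :=
  ∃ g : I → ℝ≥0∞, Measurable g ∧ ∫⁻ r, g r ≠ ⊤ ∧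
    ∀ s t : I, s ≤ t → W₁ (μ s) (μ t) ≤ ∫⁻ r in Icc s t, g r

/-- The measure `dμ_t ⊗ dt` on `ℝ^d × [0,1]`. -/
def spaceTime {d : ℕ} (μ : I → P₁ d) : Measure (Space d × I) :=
  (volume : Measure I).bind fun t => (μ t).meas.map fun y => (y, t)

/-- Finite Borel measures on `ℝ^d × [0,1]` with values in the subspace `U`. -/
abbrev Flux {d : ℕ} (U : Submodule ℝ (Space d)) := VectorMeasure (Space d × I) U

/-- The Euclidean pairing of a vector of `ℝ^d` with a vector of the subspace `U`. -/
def pairing {d : ℕ} (U : Submodule ℝ (Space d)) : Space d →L[ℝ] U →L[ℝ] ℝ :=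
  (innerSL ℝ (E := Space d)).bilinearComp (ContinuousLinearMap.id ℝ (Space d)) U.subtypeL

/-- Convergence of curves in `C([0,1]; P₁)`: uniform convergence for `W₁`. -/
def CurveTendsto {d : ℕ} (μs : ℕ → I → P₁ d) (μ : I → P₁ d) : Prop :=
  Tendsto (fun n => ⨆ t : I, W₁ (μs n t) (μ t)) atTop (𝓝 0)

/-- Narrow convergence of `U`-valued measures: convergence in the duality with bounded continuous
functions with values in `U`. -/
def NarrowTendsto {d : ℕ} {U : Submodule ℝ (Space d)} (νs : ℕ → Flux U) (ν : Flux U) : Prop :=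
  ∀ f : BoundedContinuousFunction (Space d × I) U,
    Tendsto (fun n => ∫ᵛ x, (f x : Space d) ∂[pairing U; νs n]) atTop
      (𝓝 (∫ᵛ x, (f x : Space d) ∂[pairing U; ν]))

/-- The data of a mean field control problem: initial and target measures, control subspace,
state and measure cost, control cost, and measure dependent vector field. -/
structure Data (d : ℕ) where
  m₀ : P₁ d
  m₁ : P₁ d
  U : Submodule ℝ (Space d)
  L : Space d → P₁ d → ℝ≥0∞
  ψ : U → ℝ
  F : Space d → P₁ d → Space d

/-- The Lebesgue density of a measure. -/
def density {d : ℕ} (m : P₁ d) (x : Space d) : ℝ := (m.meas.rnDeriv volume x).toReal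

/-- The measure is absolutely continuous with respect to Lebesgue measure, with density in `L²`. -/
def HasL2Density {d : ℕ} (m : P₁ d) : Prop :=
  m.meas ≪ volume ∧ MemLp (density m) 2 volume

/-- Joint uniform continuity on `ℝ^d × P₁` of a function with values in a metric space. -/
def JointlyUniformlyContinuous {d : ℕ} {Y : Type*} [PseudoMetricSpace Y]
    (G : Space d → P₁ d → Y) : Prop :=
  ∀ η : ℝ, 0 < η → ∃ r : ℝ, 0 < r ∧ ∀ (y z : Space d) (μ ν : P₁ d),
    dist y z < r → W₁ μ ν < ENNReal.ofReal r → dist (G y μ) (G z ν) < η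

/-- `φ : [0,∞) → [0,∞)` is a moderating function. -/
structure IsModerating (φ : ℝ → ℝ) : Prop where
  nonneg : ∀ r, 0 ≤ r → 0 ≤ φ r
  strictConvex : StrictConvexOn ℝ (Ici 0) φ
  contDiff : ContDiffOn ℝ 1 φ (Ici 0)
  map_zero : φ 0 = 0
  deriv_zero : HasDerivWithinAt φ 0 (Ici 0) 0
  superlinear : Tendsto (fun r => φ r / r) atTop atTop
  doubling : ∃ K : ℝ, 0 < K ∧ ∀ r, 0 ≤ r → φ (2 * r) ≤ K * (1 + φ r)

/-- The hypotheses on the control cost. -/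
structure IsControlCost {d : ℕ} {U : Submodule ℝ (Space d)} (ψ : U → ℝ) : Prop where
  nonneg : ∀ u, 0 ≤ ψ u
  convex : ConvexOn ℝ univ ψ
  lsc : LowerSemicontinuous ψ
  map_zero : ψ 0 = 0
  moderated : ∃ φ : ℝ → ℝ, IsModerating φ ∧ ∃ C : ℝ, 0 < C ∧
    ∀ u : U, φ ‖u‖ - 1 ≤ ψ u ∧ ψ u ≤ C * (1 + φ ‖u‖)

/-- The hypotheses on the state and measure cost: either it is finite and jointly uniformly
continuous, or it does not depend on the measure, is infinite on an open set and continuous on the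
complement of that set. -/
def IsStateCost {d : ℕ} (L : Space d → P₁ d → ℝ≥0∞) : Prop :=
  ((∀ y μ, L y μ ≠ ⊤) ∧ JointlyUniformlyContinuous fun y μ => (L y μ).toReal) ∨
  ∃ l : Space d → ℝ≥0∞, (∀ y μ, L y μ = l y) ∧ IsOpen {y | l y = ⊤} ∧
    ContinuousOn l {y | l y < ⊤}

/-- The standing hypotheses on the data. -/
structure Data.IsAdmissible {d : ℕ} (D : Data d) : Prop where
  target : HasL2Density D.m₁
  stateCost : IsStateCost D.L
  controlCost : IsControlCost D.ψ
  field_cont : JointlyUniformlyContinuous D.F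
  field_growth : ∃ C C' : ℝ, 0 ≤ C ∧ 0 ≤ C' ∧ ∀ (y : Space d) (μ : P₁ d),
    ‖D.F y μ‖ ≤ C + C' * (‖y‖ + ∫ z, ‖z‖ ∂μ.meas)

/-- The control cost `Ψ(ν|μ)`. There is at most one `u`, up to equality almost everywhere, with
`dν = u dμ_t dt`, so the infimum is the value of the cost at this `u` if it exists, and `∞`
otherwise. -/
def Data.Psi {d : ℕ} (D : Data d) (μ : I → P₁ d) (ν : Flux D.U) : ℝ≥0∞ :=
  ⨅ (u : Space d × I → D.U)
    (_ : Measurable u ∧ Integrable u (spaceTime μ) ∧ ν = (spaceTime μ).withDensityᵥ u),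
    ∫⁻ t : I, ∫⁻ y, ENNReal.ofReal (D.ψ (u (y, t))) ∂(μ t).meas

/-- The running cost. -/
def Data.G {d : ℕ} (D : Data d) (μ : I → P₁ d) (ν : Flux D.U) : ℝ≥0∞ :=
  D.Psi μ ν + ∫⁻ t : I, ∫⁻ y, D.L y (μ t) ∂(μ t).meas

/-- `∂_t μ_t + ∇ · (F(·, μ_t) μ_t + ν_t) = 0` in the sense of distributions on `ℝ^d × (0,1)`. -/
def Data.ContinuityEquation {d : ℕ} (D : Data d) (μ : I → P₁ d) (ν : Flux D.U) : Prop :=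
  ∀ φ : Space d × ℝ → ℝ, ContDiff ℝ ∞ φ → HasCompactSupport φ →
    tsupport φ ⊆ univ ×ˢ Ioo (0 : ℝ) 1 →
    (∫ t : I, ∫ y, (deriv (fun s => φ (y, s)) (t : ℝ) +
        inner ℝ (gradient (fun z => φ (z, (t : ℝ))) y) (D.F y (μ t))) ∂(μ t).meas) +
      ∫ᵛ x, gradient (fun z => φ (z, (x.2 : ℝ))) x.1 ∂[pairing D.U; ν] = 0

/-- The constraint set `C(m₀)`. -/
def Data.constraint {d : ℕ} (D : Data d) : Set ((I → P₁ d) × Flux D.U) :=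
  {p | IsACCurve p.1 ∧ D.ContinuityEquation p.1 p.2 ∧ p.1 0 = D.m₀}

open Classical in
/-- The soft `L²` terminal penalty. -/
def Data.terminal {d : ℕ} (D : Data d) (ε : ℝ) (m : P₁ d) : ℝ≥0∞ :=
  if HasL2Density m then
    ENNReal.ofReal (1 / ε) * ∫⁻ y, ‖density m y - density D.m₁ y‖ₑ ^ 2
  else ⊤

/-- The rescaled kernel `k_δ(y) = k(y/δ)/δ^d`. -/
def rescale {d : ℕ} (k : Space d → ℝ) (δ : ℝ) (y : Space d) : ℝ := k (δ⁻¹ • y) / δ ^ d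

/-- The convolution of a kernel with a measure. -/
def convolve {d : ℕ} (k : Space d → ℝ) (m : P₁ d) (y : Space d) : ℝ := ∫ x, k (y - x) ∂m.meas

/-- The mollified terminal penalty. -/
def Data.terminalMollified {d : ℕ} (D : Data d) (k : Space d → ℝ) (ε δ : ℝ) (m : P₁ d) : ℝ≥0∞ :=
  ENNReal.ofReal (1 / ε) *
    ∫⁻ y, ‖convolve (rescale k δ) m y - convolve (rescale k δ) D.m₁ y‖ₑ ^ 2

/-- The objective of the problem with the soft `L²` terminal penalty. -/
def Data.energy {d : ℕ} (D : Data d) (ε : ℝ) (p : (I → P₁ d) × Flux D.U) : ℝ≥0∞ :=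
  D.G p.1 p.2 + D.terminal ε (p.1 1)

/-- The objective of the mollified problem. -/
def Data.energyMollified {d : ℕ} (D : Data d) (k : Space d → ℝ) (ε δ : ℝ)
    (p : (I → P₁ d) × Flux D.U) : ℝ≥0∞ :=
  D.G p.1 p.2 + D.terminalMollified k ε δ (p.1 1)

/-- `p` minimizes the objective `J` over the constraint set. -/
def Data.IsSolution {d : ℕ} (D : Data d) (J : (I → P₁ d) × Flux D.U → ℝ≥0∞)
    (p : (I → P₁ d) × Flux D.U) : Prop :=
  p ∈ D.constraint ∧ IsMinOn J D.constraint p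

/-- The objective `J` is finite at some point of the constraint set. -/
def Data.IsFeasible {d : ℕ} (D : Data d) (J : (I → P₁ d) × Flux D.U → ℝ≥0∞) : Prop :=
  ∃ p ∈ D.constraint, J p < ⊤

/-- The hypotheses on the kernel: bounded, continuous, nonnegative, even, with finite first
moment. -/
structure IsKernel {d : ℕ} (k : Space d → ℝ) : Prop where
  continuous : Continuous k
  bounded : ∃ C : ℝ, ∀ x, |k x| ≤ C
  nonneg : ∀ x, 0 ≤ k x
  even : ∀ x, k (-x) = k x
  moment : Integrable fun x => ‖x‖ * k x

end MeanFieldControl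

end

/-! The argument is the direct method, in the spirit of Γ-convergence. Convolution with the
probability density k_δ contracts the L² norm, so the mollified penalty lies below the L² penalty
(`IsKernel.terminalMollified_le_terminal`). Hence E_{ε,δ_n}(μ_n,ν_n) ≤ E_ε(q) for every competitor
q: each competitor is its own recovery sequence, and feasibility bounds the control costs. It
remains to extract a limit (μ,ν) in the constraint set with E_ε(μ,ν) ≤ liminf E_{ε,δ_n}(μ_n,ν_n).

Curves. Superlinearity of φ makes the controls uniformly integrable against dμ_n dt. Testing the
continuity equation with a smooth substitute for (|y|-R)₊ and using Grönwall gives tails of the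
first moments that are small uniformly in n and t; bounding W₁ by the integrated speed gives
equicontinuity. Uniform tails mean compactness in W₁, so Arzelà–Ascoli applies
(`IsControlledFamily.exists_tendsto_subseq`). Since W₁ is an infimum over couplings, the triangle
inequality and the upper bounds on W₁ rest on Kantorovich–Rubinstein duality, proved by
discretization and separation of convex sets in finite dimension.

Fluxes. The laws of (y,t,u_n(y,t)) are tight. Their narrow limit is a Young measure, whose
barycenter v is the limiting control. Uniform integrability lets integrands linear in u pass to the
limit, which gives narrow convergence of the fluxes and the limiting equation, and Jensen's
inequality gives lower semicontinuity of the control cost (`exists_tendsto_subseq_of_uniform`).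

Terminal penalty. If the liminf is finite, the mollified differences are bounded in L² along a
subsequence and have a weak limit h. Moving the mollifier onto test functions identifies h with μ_1
- m_1, so μ_1 has an L² density, and weak lower semicontinuity of the norm concludes
(`terminal_le_liminf`). -/

namespace MeanFieldControl

/-! ### Kantorovich–Rubinstein duality -/

/-- Kantorovich duality on a finite set, for a cost satisfying the triangle inequality. -/
theorem exists_coupling_of_forall_lipschitz {S : Type*} [Fintype S] (p q : S → ℝ)
    (hp : p ∈ stdSimplex ℝ S) (hq : q ∈ stdSimplex ℝ S) (c : S → S → ℝ)
    (hc0 : ∀ i, c i i = 0) (hc : ∀ i j k, c i k ≤ c i j + c j k) (K : ℝ)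
    (h : ∀ f : S → ℝ, (∀ i j, f i - f j ≤ c i j) → ∑ i, f i * p i - ∑ i, f i * q i ≤ K) :
    ∃ γ : S → S → ℝ, (∀ i j, 0 ≤ γ i j) ∧ (∀ i, ∑ j, γ i j = p i) ∧ (∀ j, ∑ i, γ i j = q j) ∧
      ∑ i, ∑ j, γ i j * c i j ≤ K := by
  classical
  -- Only the first marginal is built into Γ. Cost and second marginal are the coordinates of the
  -- linear map `T`, and the claim is that the compact convex set `T '' Γ` meets `Iic K ×ˢ {q}`.
  set Γ : Set (S → S → ℝ) := {γ | (∀ i j, 0 ≤ γ i j) ∧ ∀ i, ∑ j, γ i j = p i} with hΓ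
  have hΓc : Convex ℝ Γ := by
    rintro x ⟨hx0, hx⟩ y ⟨hy0, hy⟩ a b ha hb hab
    refine ⟨fun i j => ?_, fun i => ?_⟩
    · have := hx0 i j; have := hy0 i j
      simp only [Pi.add_apply, Pi.smul_apply, smul_eq_mul]; positivity
    · simp only [Pi.add_apply, Pi.smul_apply, smul_eq_mul, Finset.sum_add_distrib,
        ← Finset.mul_sum, hx, hy]
      rw [← add_mul, hab, one_mul]
  have hΓcpt : IsCompact Γ := by
    have hsub : Γ ⊆ Icc (fun _ _ => 0) (fun i _ => p i) := by
      rintro x ⟨hx0, hx⟩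
      refine ⟨fun i j => hx0 i j, fun i j => ?_⟩
      show x i j ≤ p i
      rw [← hx i]
      exact Finset.single_le_sum (f := fun j => x i j) (fun j _ => hx0 i j) (Finset.mem_univ j)
    refine isCompact_Icc.of_isClosed_subset ?_ hsub
    have : Γ = (⋂ i, ⋂ j, {γ : S → S → ℝ | 0 ≤ γ i j}) ∩ ⋂ i, {γ | ∑ j, γ i j = p i} := by
      ext; simp [hΓ]
    rw [this]
    refine IsClosed.inter (isClosed_iInter fun i => isClosed_iInter fun j =>
      isClosed_le continuous_const (by fun_prop)) (isClosed_iInter fun i =>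
      isClosed_eq (by fun_prop) continuous_const)
  let T : (S → S → ℝ) →ₗ[ℝ] ℝ × (S → ℝ) :=
    { toFun := fun γ => (∑ i, ∑ j, γ i j * c i j, fun j => ∑ i, γ i j)
      map_add' := fun x y => by
        ext <;> simp [add_mul, Finset.sum_add_distrib]
      map_smul' := fun r x => by
        ext <;> simp [Finset.mul_sum, mul_assoc] }
  have hT : Continuous T := T.continuous_of_finiteDimensional
  set B : Set (ℝ × (S → ℝ)) := Iic K ×ˢ {q} with hB
  by_cases hdisj : Disjoint (T '' Γ) B
  · exfalso
    obtain ⟨f, u, v, hA, huv, hfB⟩ := geometric_hahn_banach_compact_closed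
      (hΓc.linear_image T) (hΓcpt.image hT) ((convex_Iic K).prod (convex_singleton q))
      (isClosed_Iic.prod isClosed_singleton) hdisj
    set l : ℝ := f (1, 0) with hl
    set g : S → ℝ := fun j => f (0, Pi.single j 1) with hg
    have hf : ∀ a x, f (a, x) = l * a + ∑ j, g j * x j := by
      intro a x
      have h1 : (a, x) = a • ((1 : ℝ), (0 : S → ℝ)) + ∑ j, x j • ((0 : ℝ), Pi.single j (1 : ℝ)) := by
        ext k
        · simp [Prod.fst_sum]
        · simp [Prod.snd_sum, Finset.sum_apply, Pi.single_apply]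
      rw [h1, map_add, map_smul, map_sum]
      simp only [map_smul, smul_eq_mul, hl, hg]
      rw [mul_comm]; congr 1
      exact Finset.sum_congr rfl fun j _ => mul_comm _ _
    -- The separating functional is bounded below on `B`, which contains arbitrarily negative costs.
    have hl0 : l ≤ 0 := by
      by_contra hpos
      push Not at hpos
      have h1 := fun a (ha : a ≤ K) => hfB (a, q) ⟨ha, rfl⟩
      have h2 := h1 (min K ((v - ∑ j, g j * q j) / l)) (min_le_left _ _)
      rw [hf] at h2
      have h3 : l * min K ((v - ∑ j, g j * q j) / l) ≤ l * ((v - ∑ j, g j * q j) / l) := by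
        gcongr; exact min_le_right _ _
      rw [mul_div_cancel₀ _ hpos.ne'] at h3
      linarith
    have hKq := hfB (K, q) ⟨le_refl K, rfl⟩
    rw [hf] at hKq
    have key : ∀ γ ∈ Γ, l * (∑ i, ∑ j, γ i j * c i j) + ∑ j, g j * ∑ i, γ i j
        < l * K + ∑ j, g j * q j := by
      intro γ hγ
      have := hA _ ⟨γ, hγ, rfl⟩
      rw [show T γ = (∑ i, ∑ j, γ i j * c i j, fun j => ∑ i, γ i j) from rfl, hf] at this
      linarith
    -- If l = 0, the product plan, whose second marginal is q, contradicts the strict separation.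
    have hlneg : l < 0 := by
      refine lt_of_le_of_ne hl0 fun h0 => ?_
      have := key (fun i j => p i * q j) ⟨fun i j => mul_nonneg (hp.1 i) (hq.1 j), fun i => by
        rw [← Finset.mul_sum, hq.2, mul_one]⟩
      simp only [h0, zero_mul, zero_add, ← Finset.sum_mul, hp.2, one_mul, lt_irrefl] at this
    have hne : Nonempty S := by
      by_contra hemp
      rw [not_nonempty_iff] at hemp
      have := hp.2
      simp at this
    have hmax : ∀ i, ∃ k, ∀ j, g j + l * c i j ≤ g k + l * c i k := fun i =>
      Finite.exists_max fun j => g j + l * c i j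
    choose k hk using hmax
    -- The c-transform of g: it dominates g because c vanishes on the diagonal, and the triangle
    -- inequality for c makes F / l an admissible dual function.
    set F : S → ℝ := fun i => g (k i) + l * c i (k i) with hF
    have hFg : ∀ j, g j ≤ F j := fun j => by
      have := hk j j; simpa [hc0] using this
    have hFl : ∀ i j, F i - F j ≤ -l * c j i := by
      intro i j
      have h1 := hk j (k i)
      have h2 := hc j i (k i)
      simp only [hF]
      nlinarith
    -- The plan that sends all the mass at i to the maximizer `k i` realizes ∑ F p.
    have h1 := key (fun i j => if j = k i then p i else 0)
      ⟨fun i j => by dsimp only; split_ifs <;> simp [hp.1 i], fun i => by simp⟩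
    have h2 : l * (∑ i, ∑ j, (if j = k i then p i else 0) * c i j)
        + ∑ j, g j * ∑ i, (if j = k i then p i else 0) = ∑ i, F i * p i := by
      simp only [ite_mul, zero_mul, Finset.sum_ite_eq', Finset.mem_univ, if_true]
      simp_rw [Finset.mul_sum]
      rw [Finset.sum_comm, ← Finset.sum_add_distrib]
      refine Finset.sum_congr rfl fun i _ => ?_
      simp [hF]; ring
    rw [h2] at h1
    have h3 : ∑ j, g j * q j ≤ ∑ j, F j * q j :=
      Finset.sum_le_sum fun j _ => mul_le_mul_of_nonneg_right (hFg j) (hq.1 j)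
    have h4 := h (fun i => F i / l) (fun i j => by
      rw [← sub_div, div_le_iff_of_neg hlneg]
      have := hFl j i
      linarith)
    simp only [div_mul_eq_mul_div, ← Finset.sum_div, ← sub_div] at h4
    rw [div_le_iff_of_neg hlneg] at h4
    linarith
  · rw [Set.not_disjoint_iff] at hdisj
    obtain ⟨_, ⟨γ, hγ, rfl⟩, h1, h2⟩ := hdisj
    refine ⟨γ, hγ.1, hγ.2, fun j => congrFun (show (fun j => ∑ i, γ i j) = q from h2) j, h1⟩

variable {d : ℕ}

instance (μ : P₁ d) : IsProbabilityMeasure μ.meas := μ.1.2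

theorem P₁.lintegral_enorm_lt_top (μ : P₁ d) : ∫⁻ x, ‖x‖ₑ ∂μ.meas < ⊤ := μ.2.lt_top

theorem P₁.integrable_id (μ : P₁ d) : Integrable (fun x : Space d => x) μ.meas :=
  ⟨aestronglyMeasurable_id, μ.lintegral_enorm_lt_top⟩

theorem P₁.integrable_norm (μ : P₁ d) : Integrable (fun x : Space d => ‖x‖) μ.meas :=
  μ.integrable_id.norm

theorem P₁.integrable_of_growth {E : Type*} [NormedAddCommGroup E] (μ : P₁ d) {f : Space d → E}
    (hf : AEStronglyMeasurable f μ.meas) {a b : ℝ} (h : ∀ x, ‖f x‖ ≤ a + b * ‖x‖) :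
    Integrable f μ.meas :=
  ((integrable_const a).add (μ.integrable_norm.const_mul b)).mono' hf (Eventually.of_forall h)

theorem P₁.integrable_of_lipschitz {E : Type*} [NormedAddCommGroup E] (μ : P₁ d)
    {f : Space d → E} {K : NNReal} (hf : LipschitzWith K f) : Integrable f μ.meas := by
  refine μ.integrable_of_growth (a := ‖f 0‖) (b := K) hf.continuous.aestronglyMeasurable
    fun x => ?_
  have h1 := hf.norm_sub_le x 0
  have h2 := norm_le_insert' (f x) (f 0)
  simp only [sub_zero] at h1
  linarith

theorem ofReal_integral_sub_le_W₁ (μ ν : P₁ d) {f : Space d → ℝ} {K : NNReal}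
    (hf : LipschitzWith K f) :
    ENNReal.ofReal (∫ x, f x ∂μ.meas - ∫ x, f x ∂ν.meas) ≤ K * W₁ μ ν := by
  rcases eq_or_ne K 0 with rfl | hK
  · have : ∀ x, f x = f 0 := fun x => by
      have := hf.norm_sub_le x 0
      simpa [sub_eq_zero] using this
    simp [this]
  rw [W₁, ENNReal.mul_iInf_of_ne (by simpa using hK) ENNReal.coe_ne_top]
  refine le_iInf fun γ => ?_
  rw [ENNReal.mul_iInf_of_ne (by simpa using hK) ENNReal.coe_ne_top]
  refine le_iInf fun ⟨h1, h2⟩ => ?_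
  have i1 : Integrable (fun z : Space d × Space d => f z.1) γ := by
    have := μ.integrable_of_lipschitz hf
    rw [← h1] at this
    exact this.comp_measurable measurable_fst
  have i2 : Integrable (fun z : Space d × Space d => f z.2) γ := by
    have := ν.integrable_of_lipschitz hf
    rw [← h2] at this
    exact this.comp_measurable measurable_snd
  rw [← h1, ← h2, integral_map measurable_fst.aemeasurable hf.continuous.aestronglyMeasurable,
    integral_map measurable_snd.aemeasurable hf.continuous.aestronglyMeasurable,
    ← integral_sub i1 i2]
  calc ENNReal.ofReal (∫ z, (f z.1 - f z.2) ∂γ) ≤ ‖∫ z, (f z.1 - f z.2) ∂γ‖ₑ := by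
        rw [← ofReal_norm]; exact ENNReal.ofReal_le_ofReal (le_abs_self _)
    _ ≤ ∫⁻ z, ‖f z.1 - f z.2‖ₑ ∂γ := enorm_integral_le_lintegral_enorm _
    _ ≤ ∫⁻ z, K * ‖z.1 - z.2‖ₑ ∂γ := by
        refine lintegral_mono fun z => ?_
        simpa [edist_eq_enorm_sub] using hf z.1 z.2
    _ = K * ∫⁻ z, ‖z.1 - z.2‖ₑ ∂γ := lintegral_const_mul _ (by fun_prop)

theorem W₁_comm (μ ν : P₁ d) : W₁ μ ν = W₁ ν μ := by
  suffices h : ∀ μ ν : P₁ d, W₁ μ ν ≤ W₁ ν μ from le_antisymm (h _ _) (h _ _)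
  intro μ ν
  refine le_iInf fun γ => le_iInf fun ⟨h1, h2⟩ => ?_
  refine (iInf₂_le (γ.map Prod.swap) ⟨?h1, ?h2⟩).trans_eq ?h3
  case h1 => rw [Measure.map_map measurable_fst measurable_swap]; exact h2
  case h2 => rw [Measure.map_map measurable_snd measurable_swap]; exact h1
  case h3 =>
    rw [lintegral_map (by fun_prop) measurable_swap]
    simp [enorm_sub_rev]

theorem W₁_lt_top (μ ν : P₁ d) : W₁ μ ν < ⊤ := by
  refine (iInf₂_le (μ.meas.prod ν.meas) ⟨by simp, by simp⟩).trans_lt ?_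
  calc ∫⁻ z, ‖z.1 - z.2‖ₑ ∂(μ.meas.prod ν.meas)
      ≤ ∫⁻ z, (‖z.1‖ₑ + ‖z.2‖ₑ) ∂(μ.meas.prod ν.meas) := lintegral_mono fun z => enorm_sub_le
    _ = ∫⁻ x, ‖x‖ₑ ∂μ.meas + ∫⁻ x, ‖x‖ₑ ∂ν.meas := by
        rw [lintegral_add_left (by fun_prop)]
        congr 1
        · rw [← lintegral_map (f := fun x : Space d => ‖x‖ₑ) (by fun_prop) measurable_fst]; simp
        · rw [← lintegral_map (f := fun x : Space d => ‖x‖ₑ) (by fun_prop) measurable_snd]; simp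
    _ < ⊤ := ENNReal.add_lt_top.2 ⟨μ.lintegral_enorm_lt_top, ν.lintegral_enorm_lt_top⟩

/-- The law of total probability over the fibres of a simple function; it computes the marginals of
the lifted plan. -/
theorem sum_measure_mul_cond {α β : Type*} [MeasurableSpace α] (T : SimpleFunc α β)
    (μ : Measure α) [IsFiniteMeasure μ] (B : Set α) :
    ∑ s : T.range, μ (T ⁻¹' {s.1}) * ProbabilityTheory.cond μ (T ⁻¹' {s.1}) B = μ B := by
  have h1 : ∀ s : T.range, μ (T ⁻¹' {s.1}) * ProbabilityTheory.cond μ (T ⁻¹' {s.1}) B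
      = μ.restrict B (T ⁻¹' {s.1}) := by
    intro s
    rw [ProbabilityTheory.cond_apply (T.measurableSet_fiber _),
      Measure.restrict_apply (T.measurableSet_fiber _), ← mul_assoc]
    rcases eq_or_ne (μ (T ⁻¹' {s.1})) 0 with h | h
    · simp [h, measure_mono_null inter_subset_left h]
    · rw [ENNReal.mul_inv_cancel h (measure_ne_top _ _), one_mul]
  simp_rw [h1]
  rw [Finset.sum_coe_sort T.range fun y => μ.restrict B (T ⁻¹' {y}),
    SimpleFunc.sum_range_measure_preimage_singleton, Measure.restrict_apply_univ]

/-- On a null set the conditional measure is zero, but then c is zero too. The plan below therefore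
needs no case distinction for null fibres. -/
theorem mul_cond_univ {α : Type*} [MeasurableSpace α] {μ : Measure α} [IsFiniteMeasure μ]
    {A : Set α} {c : ℝ≥0∞} (h : c ≤ μ A) : c * ProbabilityTheory.cond μ A univ = c := by
  rcases eq_or_ne (μ A) 0 with h0 | h0
  · simp [show c = 0 by simpa [h0] using h]
  · have := ProbabilityTheory.cond_isProbabilityMeasure (μ := μ) h0
    simp

theorem sum_range_mul_measureReal {α β : Type*} [MeasurableSpace α] (T : SimpleFunc α β)
    (μ : Measure α) [IsFiniteMeasure μ] (f : β → ℝ) :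
    ∑ s : T.range, f s.1 * μ.real (T ⁻¹' {s.1}) = ∫ x, f (T x) ∂μ := by
  classical
  have h : ∀ x, f (T x) = ∑ s : T.range, (T ⁻¹' {s.1}).indicator (fun _ => f s.1) x := by
    intro x
    rw [Finset.sum_eq_single_of_mem ⟨T x, T.mem_range_self x⟩ (Finset.mem_univ _)]
    · simp
    · intro s _ hs
      refine indicator_of_notMem (fun hx => hs (Subtype.ext ?_)) _
      exact (show T x = s.1 from hx).symm
  simp_rw [h]
  rw [integral_finsetSum _ fun s _ => (integrable_const _).indicator (T.measurableSet_fiber _)]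
  refine Finset.sum_congr rfl fun s _ => ?_
  rw [integral_indicator_const _ (T.measurableSet_fiber _), smul_eq_mul, mul_comm]

/-- A plan between the laws of a simple function lifts to a plan between the measures. -/
theorem exists_lift_coupling {α β : Type*} [MeasurableSpace α] (T : SimpleFunc α β)
    (μ ν : Measure α) [IsFiniteMeasure μ] [IsFiniteMeasure ν] (γ : T.range → T.range → ℝ≥0∞)
    (h1 : ∀ i, ∑ j, γ i j = μ (T ⁻¹' {i.1})) (h2 : ∀ j, ∑ i, γ i j = ν (T ⁻¹' {j.1})) :
    ∃ Γ : Measure (α × α), Γ.map Prod.fst = μ ∧ Γ.map Prod.snd = ν ∧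
      ∀ c : β → β → ℝ≥0∞,
        ∫⁻ z, c (T z.1) (T z.2) ∂Γ ≤ ∑ i, ∑ j, γ i j * c i.1 j.1 := by
  have l1 : ∀ i j, γ i j ≤ μ (T ⁻¹' {i.1}) := fun i j => by
    rw [← h1 i]; exact Finset.single_le_sum (f := fun j => γ i j) (by simp) (Finset.mem_univ j)
  have l2 : ∀ i j, γ i j ≤ ν (T ⁻¹' {j.1}) := fun i j => by
    rw [← h2 j]; exact Finset.single_le_sum (f := fun i => γ i j) (by simp) (Finset.mem_univ i)
  -- Within each pair of fibres the mass γ i j is spread as the product of the conditional measures.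
  refine ⟨∑ i : T.range, ∑ j : T.range, γ i j •
    (ProbabilityTheory.cond μ (T ⁻¹' {i.1})).prod (ProbabilityTheory.cond ν (T ⁻¹' {j.1})),
    ?_, ?_, ?_⟩
  · ext B hB
    rw [Measure.map_apply measurable_fst hB, ← sum_measure_mul_cond T μ B]
    simp only [Measure.coe_finsetSum, Finset.sum_apply, Measure.smul_apply, smul_eq_mul,
      ← prod_univ, Measure.prod_prod]
    refine Finset.sum_congr rfl fun i _ => ?_
    rw [← h1 i, Finset.sum_mul]
    refine Finset.sum_congr rfl fun j _ => ?_
    rw [mul_left_comm, mul_cond_univ (l2 i j), mul_comm]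
  · ext B hB
    rw [Measure.map_apply measurable_snd hB, ← sum_measure_mul_cond T ν B]
    simp only [Measure.coe_finsetSum, Finset.sum_apply, Measure.smul_apply, smul_eq_mul,
      ← univ_prod, Measure.prod_prod]
    rw [Finset.sum_comm]
    refine Finset.sum_congr rfl fun j _ => ?_
    rw [← h2 j, Finset.sum_mul]
    refine Finset.sum_congr rfl fun i _ => ?_
    rw [← mul_assoc, mul_cond_univ (l1 i j)]
  · intro c
    simp only [lintegral_finsetSum_measure, lintegral_smul_measure, smul_eq_mul]
    refine Finset.sum_le_sum fun i _ => Finset.sum_le_sum fun j _ => ?_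
    gcongr
    have hae : ∀ᵐ z ∂(ProbabilityTheory.cond μ (T ⁻¹' {i.1})).prod
        (ProbabilityTheory.cond ν (T ⁻¹' {j.1})), c (T z.1) (T z.2) = c i.1 j.1 := by
      have a1 := Measure.quasiMeasurePreserving_fst
        (μ := ProbabilityTheory.cond μ (T ⁻¹' {i.1})) (ν := ProbabilityTheory.cond ν (T ⁻¹' {j.1}))
        |>.ae (ProbabilityTheory.ae_cond_mem (T.measurableSet_fiber i.1))
      have a2 := Measure.quasiMeasurePreserving_snd
        (μ := ProbabilityTheory.cond μ (T ⁻¹' {i.1})) (ν := ProbabilityTheory.cond ν (T ⁻¹' {j.1}))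
        |>.ae (ProbabilityTheory.ae_cond_mem (T.measurableSet_fiber j.1))
      filter_upwards [a1, a2] with z hz1 hz2
      rw [hz1, hz2]
    rw [lintegral_congr_ae hae, lintegral_const]
    refine mul_le_of_le_one_right' ?_
    rw [← univ_prod_univ, Measure.prod_prod]
    exact mul_le_one' prob_le_one prob_le_one

theorem exists_simpleFunc_lintegral_enorm_sub_lt (μ ν : P₁ d) {η : ℝ≥0∞} (hη : 0 < η) :
    ∃ T : SimpleFunc (Space d) (Space d),
      ∫⁻ x, ‖T x - x‖ₑ ∂μ.meas + ∫⁻ x, ‖T x - x‖ₑ ∂ν.meas < η := by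
  have hint : Integrable (fun x : Space d => x) (μ.meas + ν.meas) :=
    μ.integrable_id.add_measure ν.integrable_id
  obtain ⟨n, hn⟩ := ((SimpleFunc.tendsto_approxOn_range_L1_enorm measurable_id hint).eventually
    (gt_mem_nhds hη)).exists
  rw [lintegral_add_measure] at hn
  exact ⟨_, hn⟩

theorem lintegral_enorm_sub_le_of_coupling {μ ν : Measure (Space d)}
    {Γ : Measure (Space d × Space d)} (h1 : Γ.map Prod.fst = μ) (h2 : Γ.map Prod.snd = ν)
    {T : Space d → Space d} (hT : Measurable T) :
    ∫⁻ z, ‖z.1 - z.2‖ₑ ∂Γ ≤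
      ∫⁻ z, ‖T z.1 - T z.2‖ₑ ∂Γ + (∫⁻ x, ‖T x - x‖ₑ ∂μ + ∫⁻ x, ‖T x - x‖ₑ ∂ν) := by
  have hm : Measurable fun x => ‖T x - x‖ₑ := (hT.sub measurable_id).enorm
  rw [← h1, ← h2, lintegral_map hm measurable_fst, lintegral_map hm measurable_snd,
    ← lintegral_add_left (f := fun z : Space d × Space d => ‖T z.1 - z.1‖ₑ)
      (hm.comp measurable_fst),
    ← lintegral_add_right _ (g := fun z : Space d × Space d => ‖T z.1 - z.1‖ₑ + ‖T z.2 - z.2‖ₑ)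
      ((hm.comp measurable_fst).add (hm.comp measurable_snd))]
  refine lintegral_mono fun z => ?_
  have : z.1 - z.2 = (T z.1 - T z.2) - ((T z.1 - z.1) - (T z.2 - z.2)) := by abel
  rw [this]
  exact enorm_sub_le.trans (add_le_add le_rfl enorm_sub_le)

/-- **Kantorovich–Rubinstein duality.** -/
theorem W₁_le_of_forall_lipschitz (μ ν : P₁ d) {c : ℝ}
    (h : ∀ f : Space d → ℝ, LipschitzWith 1 f → ∫ x, f x ∂μ.meas - ∫ x, f x ∂ν.meas ≤ c) :
    W₁ μ ν ≤ ENNReal.ofReal c := by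
  have hc0 : 0 ≤ c := by simpa using h (fun _ => 0) (LipschitzWith.const 0 |>.weaken (by simp))
  refine ENNReal.le_of_forall_pos_le_add fun η hη _ => ?_
  have hη' : (0 : ℝ≥0∞) < η / 2 := by simpa using hη.ne'
  -- Rounding by T costs less than η/2 for both measures together. This is paid twice: in the dual
  -- bound c + η/2 of the discrete problem, and when the lifted plan is compared with the true cost.
  obtain ⟨T, hn⟩ := exists_simpleFunc_lintegral_enorm_sub_lt μ ν hη'
  have hTμ : Integrable (fun x => ‖T x - x‖) μ.meas :=
    ((T.integrable_of_isFiniteMeasure).sub μ.integrable_id).norm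
  have hTν : Integrable (fun x => ‖T x - x‖) ν.meas :=
    ((T.integrable_of_isFiniteMeasure).sub ν.integrable_id).norm
  have hsum : ∫ x, ‖T x - x‖ ∂μ.meas + ∫ x, ‖T x - x‖ ∂ν.meas ≤ η / 2 := by
    rw [← ENNReal.ofReal_le_ofReal_iff (by positivity), ENNReal.ofReal_add
      (integral_nonneg fun _ => norm_nonneg _) (integral_nonneg fun _ => norm_nonneg _),
      ofReal_integral_eq_lintegral_ofReal hTμ (Eventually.of_forall fun _ => norm_nonneg _),
      ofReal_integral_eq_lintegral_ofReal hTν (Eventually.of_forall fun _ => norm_nonneg _)]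
    simp only [ofReal_norm]
    refine hn.le.trans_eq ?_
    rw [ENNReal.ofReal_div_of_pos (by norm_num)]
    simp
  have hmem : ∀ (m : P₁ d), (fun s : T.range => m.meas.real (T ⁻¹' {s.1})) ∈ stdSimplex ℝ T.range :=
    fun m => ⟨fun s => measureReal_nonneg, by
      simpa using sum_range_mul_measureReal T m.meas (fun _ => 1)⟩
  obtain ⟨γ, hγ0, hγ1, hγ2, hγc⟩ := exists_coupling_of_forall_lipschitz
    (fun s : T.range => μ.meas.real (T ⁻¹' {s.1})) (fun s : T.range => ν.meas.real (T ⁻¹' {s.1}))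
    (hmem μ) (hmem ν) (fun i j => ‖i.1 - j.1‖) (by simp)
    (fun i j k => by simpa [dist_eq_norm] using dist_triangle i.1 j.1 k.1) (c + η / 2) (by
      intro f hf
      classical
      -- A discrete dual function is 1-Lipschitz on the finite range of T and extends to the whole
      -- space with the same constant.
      have hlip : LipschitzOnWith 1 (fun x => if hx : x ∈ T.range then f ⟨x, hx⟩ else 0)
          (T.range : Set (Space d)) := by
        refine LipschitzOnWith.of_le_add fun x hx y hy => ?_
        simp only [Finset.mem_coe] at hx hy
        have := hf ⟨x, hx⟩ ⟨y, hy⟩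
        simp only [hx, hy, dif_pos, dist_eq_norm]
        linarith
      obtain ⟨g, hg, hfg⟩ := hlip.extend_real
      have hfg' : ∀ s : T.range, f s = g s.1 := fun s => by
        rw [← hfg s.2]; simp
      have e1 : ∀ m : P₁ d, Integrable (fun x => g (T x)) m.meas := fun m =>
        (T.map g).integrable_of_isFiniteMeasure
      simp_rw [hfg']
      rw [sum_range_mul_measureReal, sum_range_mul_measureReal]
      have hle : ∀ x, |g (T x) - g x| ≤ ‖T x - x‖ := fun x => by
        simpa using hg.norm_sub_le (T x) x
      have b1 : ∫ x, g (T x) ∂μ.meas ≤ ∫ x, g x ∂μ.meas + ∫ x, ‖T x - x‖ ∂μ.meas := by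
        rw [← integral_add (μ.integrable_of_lipschitz hg) hTμ]
        refine integral_mono (e1 μ) ((μ.integrable_of_lipschitz hg).add hTμ) fun x => ?_
        have := (abs_le.1 (hle x)).2
        linarith
      have b2 : ∫ x, g x ∂ν.meas ≤ ∫ x, g (T x) ∂ν.meas + ∫ x, ‖T x - x‖ ∂ν.meas := by
        rw [← integral_add (e1 ν) hTν]
        refine integral_mono (ν.integrable_of_lipschitz hg) ((e1 ν).add hTν) fun x => ?_
        have := (abs_le.1 (hle x)).1
        linarith
      have := h g hg
      linarith)
  have hreal : ∀ (m : P₁ d) (s : T.range),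
      m.meas (T ⁻¹' {s.1}) = ENNReal.ofReal (m.meas.real (T ⁻¹' {s.1})) := fun m s => by
    rw [ofReal_measureReal]
  obtain ⟨Γ, hΓ1, hΓ2, hΓc⟩ := exists_lift_coupling T μ.meas ν.meas
    (fun i j => ENNReal.ofReal (γ i j))
    (fun i => by rw [← ENNReal.ofReal_sum_of_nonneg fun j _ => hγ0 i j, hγ1, hreal])
    (fun j => by rw [← ENNReal.ofReal_sum_of_nonneg fun i _ => hγ0 i j, hγ2, hreal])
  refine (iInf₂_le Γ ⟨hΓ1, hΓ2⟩).trans ?_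
  refine (lintegral_enorm_sub_le_of_coupling hΓ1 hΓ2 T.measurable).trans ?_
  have hle : ∫⁻ z, ‖T z.1 - T z.2‖ₑ ∂Γ ≤ ENNReal.ofReal (c + η / 2) := by
    refine (hΓc fun x y => ‖x - y‖ₑ).trans (le_trans (le_of_eq ?_) (ENNReal.ofReal_le_ofReal hγc))
    rw [ENNReal.ofReal_sum_of_nonneg fun i _ => Finset.sum_nonneg fun j _ =>
      mul_nonneg (hγ0 i j) (norm_nonneg _)]
    refine Finset.sum_congr rfl fun i _ => ?_
    rw [ENNReal.ofReal_sum_of_nonneg fun j _ => mul_nonneg (hγ0 i j) (norm_nonneg _)]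
    refine Finset.sum_congr rfl fun j _ => ?_
    rw [ENNReal.ofReal_mul (hγ0 i j), ofReal_norm]
  refine (add_le_add hle hn.le).trans_eq ?_
  have hη2 : (0 : ℝ) ≤ η / 2 := by positivity
  rw [ENNReal.ofReal_add hc0 hη2, ENNReal.ofReal_div_of_pos (by norm_num), add_assoc]
  congr 1
  rw [ENNReal.ofReal_coe_nnreal, ENNReal.ofReal_ofNat, ENNReal.add_halves]

/-! ### Smooth compactly supported test functions for W₁ -/

/-- A smooth cutoff function, equal to one on the unit ball. -/
noncomputable def bump (d : ℕ) : ContDiffBump (0 : Space d) := ⟨1, 2, one_pos, one_lt_two⟩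

/-- The smooth cutoff function at scale `R`. -/
noncomputable def cutoff (R : ℝ) (x : Space d) : ℝ := bump d (R⁻¹ • x)

theorem contDiff_cutoff (R : ℝ) : ContDiff ℝ ∞ (cutoff (d := d) R) :=
  (bump d).contDiff.comp (contDiff_const_smul _)

theorem cutoff_nonneg (R : ℝ) (x : Space d) : 0 ≤ cutoff R x := (bump d).nonneg

theorem cutoff_le_one (R : ℝ) (x : Space d) : cutoff R x ≤ 1 := (bump d).le_one

theorem cutoff_eq_one {R : ℝ} (hR : 0 < R) {x : Space d} (hx : ‖x‖ ≤ R) : cutoff R x = 1 := by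
  refine (bump d).one_of_mem_closedBall ?_
  rw [mem_closedBall_zero_iff, norm_smul, norm_inv, Real.norm_of_nonneg hR.le,
    inv_mul_le_iff₀ hR]
  simpa [bump] using hx

theorem cutoff_eq_zero {R : ℝ} (hR : 0 < R) {x : Space d} (hx : 2 * R ≤ ‖x‖) :
    cutoff R x = 0 := by
  refine (bump d).zero_of_le_dist ?_
  rw [dist_zero_right, norm_smul, norm_inv, Real.norm_of_nonneg hR.le, le_inv_mul_iff₀ hR]
  simpa [bump, mul_comm] using hx

theorem exists_fderiv_cutoff_bound (d : ℕ) : ∃ C : ℝ, 0 ≤ C ∧ ∀ R : ℝ, 0 < R →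
    ∀ x : Space d, ‖fderiv ℝ (cutoff R) x‖ ≤ C / R := by
  obtain ⟨C, hC⟩ := ((bump d).hasCompactSupport.fderiv ℝ).exists_bound_of_continuous
    ((bump d).contDiff.continuous_fderiv (n := 1) (by simp))
  refine ⟨C, (norm_nonneg _).trans (hC 0), fun R hR x => ?_⟩
  have h1 : HasFDerivAt (cutoff R) ((fderiv ℝ (bump d) (R⁻¹ • x)).comp
      (R⁻¹ • ContinuousLinearMap.id ℝ (Space d))) x :=
    (((bump d).contDiff (n := 1)).differentiable (by simp) _).hasFDerivAt.comp x
      ((R⁻¹ • ContinuousLinearMap.id ℝ (Space d)).hasFDerivAt)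
  rw [h1.fderiv, ContinuousLinearMap.comp_smul, ContinuousLinearMap.comp_id, norm_smul, norm_inv,
    Real.norm_of_nonneg hR.le, div_eq_inv_mul]
  gcongr
  exact hC _

theorem tendsto_cutoff (x : Space d) : ∀ᶠ R : ℝ in atTop, ∀ᶠ y in 𝓝 x, cutoff R y = 1 := by
  filter_upwards [eventually_gt_atTop (‖x‖ + 1)] with R hR
  filter_upwards [Metric.ball_mem_nhds x one_pos] with y hy
  refine cutoff_eq_one (by linarith [norm_nonneg x]) ?_
  have := norm_le_insert' y x
  rw [mem_ball_iff_norm] at hy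
  linarith

/-- Truncation of a smooth function of linear growth. -/
theorem exists_truncation (d : ℕ) : ∃ C : ℝ, 1 ≤ C ∧ ∀ (f : Space d → ℝ) (a b : ℝ),
    ContDiff ℝ ∞ f → 0 ≤ a → (∀ x, |f x| ≤ a + b * ‖x‖) → (∀ x, ‖fderiv ℝ f x‖ ≤ b) →
    ∀ R : ℝ, 1 ≤ R → ContDiff ℝ ∞ (fun x => cutoff R x * f x) ∧
      HasCompactSupport (fun x => cutoff R x * f x) ∧
      (∀ x, |cutoff R x * f x| ≤ |f x|) ∧
      ∀ x, ‖fderiv ℝ (fun x => cutoff R x * f x) x‖ ≤ C * (a / R + b) := by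
  obtain ⟨C, hC0, hC⟩ := exists_fderiv_cutoff_bound d
  refine ⟨1 + 2 * C, by linarith, fun f a b hf ha hfab hfb R hR => ?_⟩
  have hR0 : 0 < R := by linarith
  have hb : 0 ≤ b := (norm_nonneg _).trans (hfb 0)
  refine ⟨(contDiff_cutoff R).mul hf, ?_, fun x => ?_, fun x => ?_⟩
  · refine HasCompactSupport.of_support_subset_isCompact
      (isCompact_closedBall (0 : Space d) (2 * R)) fun x hx => ?_
    rw [mem_closedBall_zero_iff]
    by_contra hlt
    exact hx (by simp [cutoff_eq_zero hR0 (not_le.1 hlt).le])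
  · rw [abs_mul, abs_of_nonneg (cutoff_nonneg R x)]
    exact mul_le_of_le_one_left (abs_nonneg _) (cutoff_le_one R x)
  · have hd := ((contDiff_cutoff (d := d) R).differentiable (by simp) x).hasFDerivAt.mul
      ((hf.differentiable (by simp) x).hasFDerivAt)
    have hd' := hd.fderiv
    rw [show (fun x => cutoff R x * f x) = cutoff R * f from rfl, hd']
    have h1 : ‖cutoff R x • fderiv ℝ f x‖ ≤ b := by
      rw [norm_smul, Real.norm_of_nonneg (cutoff_nonneg R x)]
      exact (mul_le_of_le_one_left (norm_nonneg _) (cutoff_le_one R x)).trans (hfb x)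
    -- The derivative of the cutoff is of order 1/R and vanishes where |x| > 2R, so it compensates
    -- the linear growth of f. The bound stays finite as R → ∞.
    have h2 : ‖f x • fderiv ℝ (cutoff R) x‖ ≤ C * (a / R + 2 * b) := by
      rcases le_or_gt ‖x‖ (2 * R) with hx | hx
      · rw [norm_smul]
        calc ‖f x‖ * ‖fderiv ℝ (cutoff R) x‖ ≤ (a + b * (2 * R)) * (C / R) := by
              refine mul_le_mul ((hfab x).trans ?_) (hC R hR0 x) (norm_nonneg _) (by positivity)
              gcongr
          _ = C * (a / R + 2 * b) := by field_simp
      · have : fderiv ℝ (cutoff R) x = 0 := by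
          have he : cutoff R =ᶠ[𝓝 x] fun _ => (0 : ℝ) := by
            filter_upwards [(isOpen_lt continuous_const continuous_norm).mem_nhds hx] with y hy
            exact cutoff_eq_zero hR0 (le_of_lt hy)
          rw [he.fderiv_eq]; simp
        rw [this]; simp; positivity
    have h3 : 0 ≤ a / R := by positivity
    calc _ ≤ b + C * (a / R + 2 * b) := (norm_add_le _ _).trans (add_le_add h1 h2)
      _ ≤ _ := by nlinarith [mul_nonneg hC0 h3]

/-- Lipschitz functions are uniform limits of smooth functions with the same constant. -/
theorem exists_contDiff_approx {f : Space d → ℝ} (hf : LipschitzWith 1 f) {η : ℝ} (hη : 0 < η) :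
    ∃ g : Space d → ℝ, ContDiff ℝ ∞ g ∧ LipschitzWith 1 g ∧ ∀ x, |g x - f x| ≤ η := by
  let φ : ContDiffBump (0 : Space d) := ⟨η / 2, η, by positivity, by linarith⟩
  have hloc : LocallyIntegrable f (volume : Measure (Space d)) := hf.continuous.locallyIntegrable
  have hconv := φ.hasCompactSupport_normed (μ := volume).convolutionExists_left
    (ContinuousLinearMap.lsmul ℝ ℝ) φ.continuous_normed hloc
  refine ⟨convolution (φ.normed volume) f (ContinuousLinearMap.lsmul ℝ ℝ) volume, ?_, ?_, ?_⟩
  · exact φ.hasCompactSupport_normed.contDiff_convolution_left (n := ⊤) _ φ.contDiff_normed hloc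
  · refine LipschitzWith.of_le_add_mul 1 fun x y => ?_
    have h1 : Integrable (fun t => φ.normed volume t * dist x y) (volume : Measure (Space d)) :=
      φ.integrable_normed.mul_const _
    have h2 : dist x y = ∫ t, φ.normed volume t * dist x y := by
      rw [integral_mul_const, φ.integral_normed, one_mul]
    rw [NNReal.coe_one, one_mul, convolution_def, convolution_def]
    rw [h2]
    rw [← integral_add (hconv y) h1]
    refine integral_mono (hconv x) ((hconv y).add h1) fun t => ?_
    simp only [ContinuousLinearMap.lsmul_apply, smul_eq_mul, ← mul_add]
    refine mul_le_mul_of_nonneg_left ?_ (φ.nonneg_normed t)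
    have := hf.dist_le_mul (x - t) (y - t)
    rw [NNReal.coe_one, one_mul, dist_sub_right] at this
    have := le_abs_self (f (x - t) - f (y - t))
    rw [Real.dist_eq] at *
    linarith
  · intro x
    rw [← Real.dist_eq]
    refine φ.dist_normed_convolution_le hf.continuous.aestronglyMeasurable fun y hy => ?_
    exact (hf.dist_le_mul y x).trans (by simpa using (Metric.mem_ball.1 hy).le)

theorem tendsto_integral_cutoff_mul (μ : P₁ d) {f : Space d → ℝ} (hf : Integrable f μ.meas) :
    Tendsto (fun R : ℝ => ∫ x, cutoff R x * f x ∂μ.meas) atTop (𝓝 (∫ x, f x ∂μ.meas)) := by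
  refine tendsto_integral_filter_of_dominated_convergence (fun x => ‖f x‖)
    (Eventually.of_forall fun R => (contDiff_cutoff R).continuous.aestronglyMeasurable.mul
      hf.aestronglyMeasurable) (Eventually.of_forall fun R => Eventually.of_forall fun x => ?_)
    hf.norm (Eventually.of_forall fun x => ?_)
  · rw [norm_mul, Real.norm_of_nonneg (cutoff_nonneg R x)]
    exact mul_le_of_le_one_left (norm_nonneg _) (cutoff_le_one R x)
  · refine tendsto_const_nhds.congr' ?_
    filter_upwards [tendsto_cutoff x] with R hR
    rw [hR.self_of_nhds, one_mul]

/-- The Wasserstein distance is controlled by smooth compactly supported test functions. -/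
theorem exists_W₁_le_of_forall_smooth (d : ℕ) : ∃ A : ℝ, 1 ≤ A ∧ ∀ (μ ν : P₁ d) (c : ℝ),
    (∀ f : Space d → ℝ, ContDiff ℝ ∞ f → HasCompactSupport f → (∀ x, ‖fderiv ℝ f x‖ ≤ 1) →
      ∫ x, f x ∂μ.meas - ∫ x, f x ∂ν.meas ≤ c) → W₁ μ ν ≤ ENNReal.ofReal (A * c) := by
  obtain ⟨A, hA1, hA⟩ := exists_truncation d
  have hA0 : 0 < A := by linarith
  refine ⟨A, hA1, fun μ ν c h => W₁_le_of_forall_lipschitz μ ν fun f hf => ?_⟩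
  refine le_of_forall_pos_le_add fun η hη => ?_
  obtain ⟨g, hg, hgl, hgf⟩ := exists_contDiff_approx hf (half_pos hη)
  -- Normalizing at 0 gives the growth bound with a = 0. The truncation then has gradient at most A
  -- for all R ≥ 1, and division by A makes it admissible; this is the origin of the factor A.
  set g₀ : Space d → ℝ := fun x => g x - g 0 with hg₀
  have hg₀l : LipschitzWith 1 g₀ := LipschitzWith.of_dist_le_mul fun x y => by
    simpa [hg₀, dist_sub_right] using hgl.dist_le_mul x y
  have key : ∫ x, g₀ x ∂μ.meas - ∫ x, g₀ x ∂ν.meas ≤ A * c := by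
    refine le_of_tendsto ((tendsto_integral_cutoff_mul μ (μ.integrable_of_lipschitz hg₀l)).sub
      (tendsto_integral_cutoff_mul ν (ν.integrable_of_lipschitz hg₀l))) ?_
    filter_upwards [eventually_ge_atTop 1] with R hR
    obtain ⟨t1, t2, -, t4⟩ := hA g₀ 0 1 (hg.sub contDiff_const) le_rfl (fun x => by
      simpa [hg₀] using hgl.norm_sub_le x 0) (fun x => by
      simpa using norm_fderiv_le_of_lipschitz ℝ hg₀l (x₀ := x)) R hR
    have := h (fun x => A⁻¹ • (cutoff R x * g₀ x)) (t1.const_smul _) (t2.smul_left (f := fun _ => A⁻¹))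
      fun x => by
        have hd : DifferentiableAt ℝ (fun x => cutoff R x * g₀ x) x := t1.differentiable (by simp) x
        have e := (hd.hasFDerivAt.const_smul A⁻¹).fderiv
        rw [show (fun x => A⁻¹ • (cutoff R x * g₀ x)) = A⁻¹ • (fun x => cutoff R x * g₀ x) from rfl,
          e, norm_smul, norm_inv, Real.norm_of_nonneg hA0.le, inv_mul_le_iff₀ hA0]
        simpa using t4 x
    rw [integral_smul, integral_smul, ← smul_sub, smul_eq_mul, inv_mul_le_iff₀ hA0] at this
    exact this
  have hi : ∀ m : P₁ d, ∫ x, g₀ x ∂m.meas = ∫ x, g x ∂m.meas - g 0 := fun m => by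
    rw [hg₀, integral_sub (m.integrable_of_lipschitz hgl) (integrable_const _)]; simp
  rw [hi, hi] at key
  have hfg : ∀ m : P₁ d, |∫ x, g x ∂m.meas - ∫ x, f x ∂m.meas| ≤ η / 2 := fun m => by
    rw [← integral_sub (m.integrable_of_lipschitz hgl) (m.integrable_of_lipschitz hf)]
    refine (norm_integral_le_of_norm_le_const (μ := m.meas) (C := η / 2)
      (f := fun x => g x - f x) (Eventually.of_forall hgf)).trans ?_
    simp
  have h1 := abs_le.1 (hfg μ)
  have h2 := abs_le.1 (hfg ν)
  linarith [h1.1, h2.2]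

/-! ### The metric space (P₁, W₁) -/

/-- The dual formulation is visibly subadditive, which avoids gluing couplings along a common
marginal. -/
theorem W₁_triangle (μ ν ρ : P₁ d) : W₁ μ ρ ≤ W₁ μ ν + W₁ ν ρ := by
  rw [← ENNReal.ofReal_toReal (ENNReal.add_lt_top.2 ⟨W₁_lt_top μ ν, W₁_lt_top ν ρ⟩).ne]
  refine W₁_le_of_forall_lipschitz μ ρ fun f hf => ?_
  have h1 := ofReal_integral_sub_le_W₁ μ ν hf
  have h2 := ofReal_integral_sub_le_W₁ ν ρ hf
  rw [ENNReal.coe_one, one_mul, ENNReal.ofReal_le_iff_le_toReal (W₁_lt_top _ _).ne] at h1 h2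
  rw [ENNReal.toReal_add (W₁_lt_top _ _).ne (W₁_lt_top _ _).ne]
  linarith

theorem W₁_self (μ : P₁ d) : W₁ μ μ = 0 := by
  have := W₁_le_of_forall_lipschitz μ μ (c := 0) fun f _ => by simp
  simpa using this

theorem integral_eq_of_W₁_eq_zero {μ ν : P₁ d} (h : W₁ μ ν = 0) {f : Space d → ℝ} {K : NNReal}
    (hf : LipschitzWith K f) : ∫ x, f x ∂μ.meas = ∫ x, f x ∂ν.meas := by
  have h1 := ofReal_integral_sub_le_W₁ μ ν hf
  have h2 := ofReal_integral_sub_le_W₁ ν μ hf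
  rw [W₁_comm ν μ] at h2
  rw [h, mul_zero, nonpos_iff_eq_zero, ENNReal.ofReal_eq_zero] at h1 h2
  linarith

/-- Bounded Lipschitz functions determine narrow limits, so the constant sequence μ converges to ν
as well as to μ. -/
theorem eq_of_W₁_eq_zero {μ ν : P₁ d} (h : W₁ μ ν = 0) : μ = ν := by
  refine Subtype.ext (tendsto_nhds_unique
    (tendsto_const_nhds (x := μ.1) (f := (atTop : Filter ℕ))) ?_)
  rw [tendsto_iff_forall_lipschitz_integral_tendsto]
  rintro f - ⟨L, hL⟩
  exact tendsto_const_nhds.congr fun _ => (integral_eq_of_W₁_eq_zero h hL).symm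

/-- The topology of `P₁ d` is that of W₁ and not the narrow topology; `P₁.continuous_val` compares
the two. -/
noncomputable instance : MetricSpace (P₁ d) :=
  @EMetricSpace.toMetricSpace (P₁ d)
    { edist := W₁
      edist_self := W₁_self
      edist_comm := W₁_comm
      edist_triangle := W₁_triangle
      eq_of_edist_eq_zero := eq_of_W₁_eq_zero }
    fun μ ν => (W₁_lt_top μ ν).ne

theorem edist_eq_W₁ (μ ν : P₁ d) : edist μ ν = W₁ μ ν := rfl

theorem integral_sub_le_dist (μ ν : P₁ d) {f : Space d → ℝ} {K : NNReal}
    (hf : LipschitzWith K f) : ∫ x, f x ∂μ.meas - ∫ x, f x ∂ν.meas ≤ K * dist μ ν := by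
  have h := ofReal_integral_sub_le_W₁ μ ν hf
  rw [← edist_eq_W₁, edist_dist, ← ENNReal.ofReal_coe_nnreal, ← ENNReal.ofReal_mul K.coe_nonneg,
    ENNReal.ofReal_le_ofReal_iff (by positivity)] at h
  exact h

theorem lipschitzWith_integral {f : Space d → ℝ} {K : NNReal} (hf : LipschitzWith K f) :
    LipschitzWith K fun μ : P₁ d => ∫ x, f x ∂μ.meas :=
  LipschitzWith.of_le_add_mul K fun μ ν => by linarith [integral_sub_le_dist μ ν hf]

theorem dist_le_of_forall_lipschitz {μ ν : P₁ d} {c : ℝ} (hc : 0 ≤ c)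
    (h : ∀ f : Space d → ℝ, LipschitzWith 1 f → ∫ x, f x ∂μ.meas - ∫ x, f x ∂ν.meas ≤ c) :
    dist μ ν ≤ c := by
  rw [← ENNReal.ofReal_le_ofReal_iff hc, ← edist_dist, edist_eq_W₁]
  exact W₁_le_of_forall_lipschitz μ ν h

theorem P₁.continuous_val : Continuous (fun μ : P₁ d => μ.1) := by
  refine continuous_iff_continuousAt.2 fun μ => ?_
  rw [ContinuousAt, tendsto_iff_forall_lipschitz_integral_tendsto]
  rintro f - ⟨L, hL⟩
  exact (lipschitzWith_integral hL).continuous.continuousAt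

/-! ### Narrow lower semicontinuity, tails of the first moment, compactness in W₁ -/

/-- Lower semicontinuity of the integral of a lower semicontinuous function under narrow
convergence. -/
theorem lintegral_le_liminf_of_lowerSemicontinuous {Ω : Type*} [TopologicalSpace Ω]
    [MeasurableSpace Ω] [OpensMeasurableSpace Ω] [HasOuterApproxClosed Ω]
    {ρs : ℕ → ProbabilityMeasure Ω} {ρ : ProbabilityMeasure Ω} (h : Tendsto ρs atTop (𝓝 ρ))
    {f : Ω → ℝ≥0∞} (hf : LowerSemicontinuous f) :
    ∫⁻ x, f x ∂(ρ : Measure Ω) ≤ liminf (fun n => ∫⁻ x, f x ∂(ρs n : Measure Ω)) atTop := by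
  have hfm : Measurable f := hf.measurable
  have key : ∀ N : ℕ, ∫⁻ x, min (f x) N ∂(ρ : Measure Ω) ≤
      liminf (fun n => ∫⁻ x, f x ∂(ρs n : Measure Ω)) atTop := by
    intro N
    have hne : ∀ x, min (f x) N ≠ ⊤ := fun x =>
      ((min_le_right _ _).trans_lt (ENNReal.natCast_lt_top N)).ne
    have hm : Measurable fun x => (min (f x) N).toReal := (hfm.min measurable_const).ennreal_toReal
    have e : ∀ m : Measure Ω, ∫⁻ x, min (f x) N ∂m
        -- Layer cake formula. The superlevel sets are open, so the portmanteau theorem at each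
        -- level and Fatou's lemma in t give the bound; truncation at N only keeps the integrand
        -- finite.
        = ∫⁻ t in Ioi (0 : ℝ), m {x | t < (min (f x) N).toReal} := by
      intro m
      rw [← lintegral_eq_lintegral_meas_lt m (Eventually.of_forall fun x => ENNReal.toReal_nonneg)
        hm.aemeasurable]
      simp_rw [ENNReal.ofReal_toReal (hne _)]
    have hopen : ∀ t : ℝ, 0 < t → IsOpen {x | t < (min (f x) N).toReal} := by
      intro t ht
      have : {x | t < (min (f x) N).toReal}
          = {x | ENNReal.ofReal t < f x} ∩ {x | ENNReal.ofReal t < N} := by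
        ext x
        simp only [mem_ofPred_eq, mem_inter_iff, ← lt_min_iff]
        rw [ENNReal.ofReal_lt_iff_lt_toReal ht.le (hne x)]
      rw [this]
      exact (hf.isOpen_preimage _).inter isOpen_const
    rw [e]
    calc ∫⁻ t in Ioi (0 : ℝ), (ρ : Measure Ω) {x | t < (min (f x) N).toReal}
        ≤ ∫⁻ t in Ioi (0 : ℝ), liminf (fun n => (ρs n : Measure Ω)
            {x | t < (min (f x) N).toReal}) atTop :=
          setLIntegral_mono' measurableSet_Ioi fun t ht =>
            ProbabilityMeasure.le_liminf_measure_open_of_tendsto h (hopen t ht)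
      _ ≤ liminf (fun n => ∫⁻ t in Ioi (0 : ℝ), (ρs n : Measure Ω)
            {x | t < (min (f x) N).toReal}) atTop :=
          lintegral_liminf_le fun n => Antitone.measurable fun s t hst =>
            measure_mono fun x hx => lt_of_le_of_lt hst hx
      _ ≤ _ := by
          refine liminf_le_liminf (Eventually.of_forall fun n => ?_)
          rw [← e]
          exact lintegral_mono fun x => min_le_left _ _
  have hsup : ∀ x, f x = ⨆ N : ℕ, min (f x) N := fun x => by
    rw [← inf_iSup_eq, ENNReal.iSup_natCast, inf_top_eq]
  rw [lintegral_congr hsup, lintegral_iSup (fun N => hfm.min measurable_const) fun N M hNM x =>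
    min_le_min_left _ (by exact_mod_cast hNM)]
  exact iSup_le key

/-- A smooth convex substitute for `(‖y‖ - R)₊`. -/
noncomputable def excess (R : ℝ) (y : Space d) : ℝ := √(R ^ 2 + ‖y‖ ^ 2) - R

theorem excess_nonneg {R : ℝ} (y : Space d) : 0 ≤ excess R y :=
  sub_nonneg.2 (Real.le_sqrt_of_sq_le (by nlinarith [sq_nonneg ‖y‖]))

theorem norm_sub_le_excess (R : ℝ) (y : Space d) : ‖y‖ - R ≤ excess R y :=
  sub_le_sub_right (Real.le_sqrt_of_sq_le (by nlinarith [sq_nonneg R])) _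

theorem excess_le_norm {R : ℝ} (hR : 0 ≤ R) (y : Space d) : excess R y ≤ ‖y‖ := by
  rw [excess, sub_le_iff_le_add]
  exact Real.sqrt_le_iff.2 ⟨by positivity, by nlinarith [norm_nonneg y]⟩

theorem excess_le_div {R : ℝ} (hR : 0 < R) (y : Space d) : excess R y ≤ ‖y‖ ^ 2 / R := by
  rw [excess, sub_le_iff_le_add]
  refine Real.sqrt_le_iff.2 ⟨by positivity, ?_⟩
  have : (‖y‖ ^ 2 / R + R) ^ 2 = R ^ 2 + ‖y‖ ^ 2 + (‖y‖ ^ 2 / R) ^ 2 + ‖y‖ ^ 2 := by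
    field_simp; ring
  rw [this]
  nlinarith [sq_nonneg (‖y‖ ^ 2 / R), sq_nonneg ‖y‖]

theorem contDiff_excess {R : ℝ} (hR : 0 < R) : ContDiff ℝ ∞ (excess (d := d) R) :=
  ((contDiff_const.add (contDiff_norm_sq ℝ)).sqrt fun y => by positivity).sub contDiff_const

theorem norm_fderiv_excess {R : ℝ} (hR : 0 < R) (y : Space d) :
    ‖fderiv ℝ (excess R) y‖ = ‖y‖ / √(R ^ 2 + ‖y‖ ^ 2) := by
  have h0 : R ^ 2 + ‖y‖ ^ 2 ≠ 0 := by positivity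
  have h1 : HasFDerivAt (excess R) _ y :=
    ((((hasStrictFDerivAt_norm_sq y).hasFDerivAt.const_add (R ^ 2)).sqrt h0).sub_const R)
  rw [h1.fderiv, ← Nat.cast_smul_eq_nsmul ℝ, smul_smul, norm_smul, innerSL_apply_norm,
    Real.norm_of_nonneg (by positivity)]
  field_simp
  simp [mul_comm]

theorem norm_fderiv_excess_le_one {R : ℝ} (hR : 0 < R) (y : Space d) :
    ‖fderiv ℝ (excess R) y‖ ≤ 1 := by
  rw [norm_fderiv_excess hR]
  refine div_le_one_of_le₀ (Real.le_sqrt_of_sq_le ?_) (Real.sqrt_nonneg _)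
  nlinarith [sq_nonneg R]

/-- The bounded part of the velocity is tested against this gradient; the factor 1/R makes its
contribution to the tail vanish. -/
theorem norm_fderiv_excess_le_div {R : ℝ} (hR : 0 < R) (y : Space d) :
    ‖fderiv ℝ (excess R) y‖ ≤ ‖y‖ / R := by
  rw [norm_fderiv_excess hR]
  gcongr
  refine Real.le_sqrt_of_sq_le ?_
  nlinarith [sq_nonneg ‖y‖]

/-- With s = √(R² + |y|²) this reduces to (s - R)² ≥ 0. It absorbs a linearly growing drift into the
excess itself, so that Grönwall's inequality closes at a rate independent of R. -/
theorem norm_fderiv_excess_mul_norm_le {R : ℝ} (hR : 0 < R) (y : Space d) :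
    ‖fderiv ℝ (excess R) y‖ * ‖y‖ ≤ 2 * excess R y := by
  have hs : 0 < √(R ^ 2 + ‖y‖ ^ 2) := Real.sqrt_pos.2 (by positivity)
  have hsq := Real.sq_sqrt (show 0 ≤ R ^ 2 + ‖y‖ ^ 2 by positivity)
  rw [norm_fderiv_excess hR, div_mul_eq_mul_div, div_le_iff₀ hs, excess]
  nlinarith [sq_nonneg (√(R ^ 2 + ‖y‖ ^ 2) - R)]

theorem lipschitzWith_excess {R : ℝ} (hR : 0 < R) : LipschitzWith 1 (excess (d := d) R) :=
  lipschitzWith_of_nnnorm_fderiv_le ((contDiff_excess hR).differentiable (by simp)) fun y =>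
    norm_fderiv_excess_le_one hR y

theorem integrable_excess (μ : P₁ d) {R : ℝ} (hR : 0 < R) : Integrable (excess R) μ.meas :=
  μ.integrable_of_lipschitz (lipschitzWith_excess hR)

theorem tendsto_integral_excess (μ : P₁ d) :
    Tendsto (fun R : ℝ => ∫ y, excess R y ∂μ.meas) atTop (𝓝 0) := by
  rw [← integral_zero (Space d) ℝ (μ := μ.meas)]
  refine tendsto_integral_filter_of_dominated_convergence (fun y => ‖y‖) ?_ ?_ μ.integrable_norm
    (Eventually.of_forall fun y => ?_)
  · filter_upwards [eventually_gt_atTop 0] with R hR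
    exact (contDiff_excess hR).continuous.aestronglyMeasurable
  · filter_upwards [eventually_ge_atTop 0] with R hR
    refine Eventually.of_forall fun y => ?_
    rw [Real.norm_of_nonneg (excess_nonneg y)]
    exact excess_le_norm hR y
  · refine tendsto_of_tendsto_of_tendsto_of_le_of_le' tendsto_const_nhds
      (tendsto_const_nhds (x := ‖y‖ ^ 2) |>.div_atTop tendsto_id) (Eventually.of_forall fun R => excess_nonneg y) ?_
    filter_upwards [eventually_gt_atTop 0] with R hR
    exact excess_le_div hR y

/-- By the layer cake formula. The ε-thickening of {g ≥ t} lies in {g + ε ≥ t} because g is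
1-Lipschitz, which costs ε; the slack ε in the measure of each level set costs ε M in total. -/
theorem integral_le_of_levyProkhorovEDist_lt (μ ν : P₁ d) {ε M : ℝ} (hε : 0 < ε)
    (h : levyProkhorovEDist μ.meas ν.meas < ENNReal.ofReal ε) {g : Space d → ℝ}
    (hgl : LipschitzWith 1 g) (hg0 : ∀ x, 0 ≤ g x) (hg2 : ∀ x, g x ≤ M) :
    ∫ x, g x ∂μ.meas ≤ ∫ x, g x ∂ν.meas + ε + ε * M := by
  have hM : 0 ≤ M := (hg0 0).trans (hg2 0)
  let G : BoundedContinuousFunction (Space d) ℝ :=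
    BoundedContinuousFunction.ofNormedAddCommGroup g hgl.continuous M fun x => by
      rw [Real.norm_of_nonneg (hg0 x)]; exact hg2 x
  let H : BoundedContinuousFunction (Space d) ℝ :=
    BoundedContinuousFunction.ofNormedAddCommGroup (fun x => g x + ε)
      (hgl.continuous.add continuous_const) (M + ε) fun x => by
      rw [Real.norm_of_nonneg (by linarith [hg0 x])]; linarith [hg2 x]
  have hGn : ‖G‖ ≤ M := BoundedContinuousFunction.norm_ofNormedAddCommGroup_le _ hM _
  have hGH : ‖G‖ ≤ ‖H‖ := by
    refine (BoundedContinuousFunction.norm_le (norm_nonneg _)).2 fun x => ?_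
    refine le_trans ?_ (H.norm_coe_le_norm x)
    show ‖g x‖ ≤ ‖g x + ε‖
    rw [Real.norm_of_nonneg (hg0 x), Real.norm_of_nonneg (by linarith [hg0 x])]
    linarith
  have h1 := BoundedContinuousFunction.integral_le_of_levyProkhorovEDist_lt μ.meas ν.meas hε h G
    (Eventually.of_forall hg0)
  have hint : IntegrableOn (fun t => ν.meas.real {a | t ≤ H a}) (Ioc 0 ‖H‖) := by
    refine Measure.integrableOn_of_bounded (M := 1) (by simp) ?_ (Eventually.of_forall fun t => ?_)
    · have hanti : Antitone fun t => ν.meas.real {a | t ≤ H a} := fun s t hst =>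
        measureReal_mono fun x (hx : t ≤ H x) => show s ≤ H x from le_trans hst hx
      exact hanti.measurable.aestronglyMeasurable
    · rw [Real.norm_of_nonneg measureReal_nonneg]; exact measureReal_le_one
  have h2 : ∫ t in Ioc 0 ‖G‖, ν.meas.real (Metric.thickening ε {a | t ≤ G a})
      ≤ ∫ t in Ioc 0 ‖H‖, ν.meas.real {a | t ≤ H a} := by
    refine le_trans ?_ (setIntegral_mono_set hint (Eventually.of_forall fun t => measureReal_nonneg)
      (Ioc_subset_Ioc_right hGH).eventuallyLE)
    have hsub : ∀ t, Metric.thickening ε {a | t ≤ G a} ⊆ {a | t ≤ H a} := by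
      intro t x hx
      obtain ⟨z, hz, hxz⟩ := Metric.mem_thickening_iff.1 hx
      have h3 : t ≤ g z := hz
      have h4 := hgl.dist_le_mul z x
      rw [NNReal.coe_one, one_mul, dist_comm z x, Real.dist_eq] at h4
      have h5 := le_abs_self (g z - g x)
      show t ≤ g x + ε
      linarith
    exact integral_mono_of_nonneg (Eventually.of_forall fun t => measureReal_nonneg)
      (hint.mono_set (Ioc_subset_Ioc_right hGH))
      (Eventually.of_forall fun t => measureReal_mono (hsub t))
  rw [← BoundedContinuousFunction.integral_eq_integral_meas_le H ν.meas
    (Eventually.of_forall fun x => by show 0 ≤ g x + ε; linarith [hg0 x])] at h2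
  have h3 : ∫ x, H x ∂ν.meas = ∫ x, g x ∂ν.meas + ε := by
    show ∫ x, (g x + ε) ∂ν.meas = _
    rw [integral_add (ν.integrable_of_lipschitz hgl) (integrable_const _)]; simp
  have h4 : ε * ‖G‖ ≤ ε * M := by gcongr
  have : ∫ x, G x ∂μ.meas = ∫ x, g x ∂μ.meas := rfl
  linarith

/-- The Wasserstein distance is controlled by the Lévy–Prokhorov distance and the tails of the
first moments. -/
theorem dist_le_of_levyProkhorovEDist_lt (μ ν : P₁ d) {ε R : ℝ} (hε : 0 < ε) (hR : 0 < R)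
    (h : levyProkhorovEDist μ.meas ν.meas < ENNReal.ofReal ε) :
    dist μ ν ≤ ε + ε * (2 * R) + ∫ y, excess R y ∂μ.meas + ∫ y, excess R y ∂ν.meas := by
  have hE : ∀ m : P₁ d, 0 ≤ ∫ y, excess R y ∂m.meas := fun m =>
    integral_nonneg fun y => excess_nonneg y
  refine dist_le_of_forall_lipschitz (by have := hE μ; have := hE ν; positivity) fun f hf => ?_
  have hf0 : ∀ x, |f x - f 0| ≤ ‖x‖ := fun x => by simpa using hf.norm_sub_le x 0
  -- Truncation to [-R, R], shifted to take values in [0, 2R]. Since |f x - f 0| ≤ |x|, the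
  -- truncation error is at most (|x| - R)₊ and so at most the excess.
  set g : Space d → ℝ := fun x => max (min (f x - f 0) R) (-R) + R with hg
  have hg0 : ∀ x, 0 ≤ g x := fun x => by
    have := le_max_right (min (f x - f 0) R) (-R); simp only [hg]; linarith
  have hg2 : ∀ x, g x ≤ 2 * R := fun x => by
    have : max (min (f x - f 0) R) (-R) ≤ R := max_le (min_le_right _ _) (by linarith)
    simp only [hg]; linarith
  have hgl : LipschitzWith 1 g := by
    have h1 : LipschitzWith 1 fun x => f x - f 0 := LipschitzWith.of_dist_le_mul fun x y => by
      simpa [dist_sub_right] using hf.dist_le_mul x y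
    have h2 := (h1.min_const R).max_const (-R)
    exact LipschitzWith.of_dist_le_mul fun x y => by
      simpa [hg, dist_add_right] using h2.dist_le_mul x y
  have hgf : ∀ x, |f x - f 0 - (g x - R)| ≤ excess R x := by
    intro x
    have h1 := norm_sub_le_excess R x
    have h2 := excess_nonneg (R := R) x
    have h3 := abs_le.1 (hf0 x)
    simp only [hg]
    rw [abs_le]
    rcases le_total (f x - f 0) R with h4 | h4 <;> rcases le_total (-R) (f x - f 0) with h5 | h5
    · rw [min_eq_left h4, max_eq_left h5]; constructor <;> linarith
    · rw [min_eq_left h4, max_eq_right h5]; constructor <;> linarith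
    · rw [min_eq_right h4, max_eq_left (by linarith)]; constructor <;> linarith
    · rw [min_eq_right h4, max_eq_left (by linarith)]; constructor <;> linarith
  have h5 := integral_le_of_levyProkhorovEDist_lt μ ν hε h hgl hg0 hg2
  have h6 : ∀ m : P₁ d, |∫ x, f x ∂m.meas - f 0 - (∫ x, g x ∂m.meas - R)|
      ≤ ∫ y, excess R y ∂m.meas := by
    intro m
    have i1 := m.integrable_of_lipschitz hf
    have i2 := m.integrable_of_lipschitz hgl
    have : ∫ x, f x ∂m.meas - f 0 - (∫ x, g x ∂m.meas - R)
        = ∫ x, (f x - f 0 - (g x - R)) ∂m.meas := by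
      have i3 : Integrable (fun x => f x - f 0) m.meas := i1.sub (integrable_const _)
      have i4 : Integrable (fun x => g x - R) m.meas := i2.sub (integrable_const _)
      rw [integral_sub i3 i4, integral_sub i1 (integrable_const _),
        integral_sub i2 (integrable_const _)]
      simp
    rw [this]
    exact norm_integral_le_of_norm_le (f := fun x => f x - f 0 - (g x - R))
      (integrable_excess m hR) (Eventually.of_forall hgf)
  have h7 := abs_le.1 (h6 μ)
  have h8 := abs_le.1 (h6 ν)
  linarith [h7.2, h8.1]

theorem lintegral_excess_eq (μ : P₁ d) {R : ℝ} (hR : 0 < R) :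
    ∫⁻ y, ENNReal.ofReal (excess R y) ∂μ.meas = ENNReal.ofReal (∫ y, excess R y ∂μ.meas) :=
  (ofReal_integral_eq_lintegral_ofReal (integrable_excess μ hR)
    (Eventually.of_forall fun y => excess_nonneg y)).symm

theorem P₁.measure_norm_gt_le (μ : P₁ d) {R : ℝ} (hR : 0 < R) :
    μ.meas {y | 2 * R < ‖y‖} ≤ ENNReal.ofReal ((∫ y, excess R y ∂μ.meas) / R) := by
  have h1 : {y : Space d | 2 * R < ‖y‖} ⊆ {y | ENNReal.ofReal R ≤ ENNReal.ofReal (excess R y)} :=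
    fun y (hy : 2 * R < ‖y‖) => ENNReal.ofReal_le_ofReal (by linarith [norm_sub_le_excess R y])
  refine (measure_mono h1).trans ((meas_ge_le_lintegral_div ?_ ?_ ENNReal.ofReal_ne_top).trans ?_)
  · exact (contDiff_excess hR).continuous.measurable.ennreal_ofReal.aemeasurable
  · simpa using hR
  · rw [lintegral_excess_eq μ hR, ENNReal.ofReal_div_of_pos hR]

/-- Sets of probability measures with uniformly integrable first moments are compact for the
Wasserstein distance. -/
theorem isCompact_setOf_integral_excess_le {η : ℕ → ℝ} (hη : Tendsto η atTop (𝓝 0)) :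
    IsCompact {μ : P₁ d | ∀ n : ℕ, ∫ y, excess (n + 1 : ℝ) y ∂μ.meas ≤ η n} := by
  have hpos : ∀ n : ℕ, (0 : ℝ) < n + 1 := fun n => by positivity
  set S : Set (P₁ d) := {μ : P₁ d | ∀ n : ℕ, ∫ y, excess (n + 1 : ℝ) y ∂μ.meas ≤ η n} with hS
  refine IsSeqCompact.isCompact fun x hx => ?_
  have htight : IsTightMeasureSet {(μ : Measure (Space d)) | μ ∈ range fun k => (x k).1} := by
    refine isTightMeasureSet_iff_exists_isCompact_measure_compl_le.2 fun ε hε => ?_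
    have hlim : Tendsto (fun n => ENNReal.ofReal (η n)) atTop (𝓝 0) := by
      simpa using ENNReal.tendsto_ofReal hη
    obtain ⟨n, hn⟩ := (hlim.eventually (ge_mem_nhds hε)).exists
    refine ⟨Metric.closedBall 0 (2 * (n + 1)), isCompact_closedBall _ _, ?_⟩
    rintro _ ⟨_, ⟨k, rfl⟩, rfl⟩
    have h1 := (x k).measure_norm_gt_le (hpos n)
    have h2 : (Metric.closedBall (0 : Space d) (2 * (n + 1)))ᶜ = {y | 2 * ((n : ℝ) + 1) < ‖y‖} := by
      ext y; simp
    rw [h2]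
    refine h1.trans (le_trans (ENNReal.ofReal_le_ofReal ?_) hn)
    refine (div_le_self (integral_nonneg fun y => excess_nonneg y) (by linarith [n.cast_nonneg (α := ℝ)])).trans
      (hx k n)
  obtain ⟨m, -, φ, hφ, hlim⟩ := (isCompact_closure_of_isTightMeasureSet htight).isSeqCompact
    (x := fun k => (x k).1) fun k => subset_closure ⟨k, rfl⟩
  -- Tail bounds survive narrow limits by lower semicontinuity. They show that m has a finite first
  -- moment and that it stays in the set.
  have hexc : ∀ n : ℕ, ∫⁻ y, ENNReal.ofReal (excess (n + 1 : ℝ) y) ∂(m : Measure (Space d))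
      ≤ ENNReal.ofReal (η n) := by
    intro n
    refine (lintegral_le_liminf_of_lowerSemicontinuous hlim (ENNReal.continuous_ofReal.comp
      (contDiff_excess (hpos n)).continuous).lowerSemicontinuous).trans ?_
    refine liminf_le_of_frequently_le' (Eventually.of_forall fun k => ?_).frequently
    exact (lintegral_excess_eq (x (φ k)) (hpos n)).trans_le
      (ENNReal.ofReal_le_ofReal (hx (φ k) n))
  have hmom : ∫⁻ y, ‖y‖ₑ ∂(m : Measure (Space d)) ≠ ⊤ := by
    have hle : ∀ y : Space d, ‖y‖ₑ ≤ 1 + ENNReal.ofReal (excess ((0 : ℕ) + 1 : ℝ) y) := fun y => by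
      rw [← ofReal_norm, ← ENNReal.ofReal_one, ← ENNReal.ofReal_add zero_le_one (excess_nonneg y)]
      refine ENNReal.ofReal_le_ofReal ?_
      have := norm_sub_le_excess ((0 : ℕ) + 1 : ℝ) y
      push_cast at this ⊢
      linarith
    refine ((lintegral_mono hle).trans_lt ?_).ne
    rw [lintegral_add_left measurable_const]
    refine ENNReal.add_lt_top.2 ⟨by simp, (hexc 0).trans_lt ENNReal.ofReal_lt_top⟩
  set μ : P₁ d := ⟨m, hmom⟩ with hμ
  have hμS : μ ∈ S := by
    intro n
    have h1 := hexc n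
    rw [show (m : Measure (Space d)) = μ.meas from rfl, lintegral_excess_eq μ (hpos n)] at h1
    by_contra hlt
    push Not at hlt
    have h0 : 0 ≤ ∫ y, excess (n + 1 : ℝ) y ∂(x 0).meas := integral_nonneg fun y => excess_nonneg y
    exact absurd h1 (not_le.2 ((ENNReal.ofReal_lt_ofReal_iff_of_nonneg (h0.trans (hx 0 n))).2 hlt))
  refine ⟨μ, hμS, φ, hφ, ?_⟩
  rw [Metric.tendsto_atTop']
  intro δ hδ
  obtain ⟨n, hn⟩ := (hη.eventually (gt_mem_nhds (show (0 : ℝ) < δ / 4 by positivity))).exists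
  -- The Lévy–Prokhorov terms contribute less than δ/2, and the two tails less than δ/4 each.
  set ε : ℝ := δ / 2 / (2 + 2 * (n + 1)) with hε
  have hε0 : 0 < ε := by positivity
  have hLP : Tendsto (fun k => levyProkhorovEDist (x (φ k)).meas μ.meas) atTop (𝓝 0) := by
    have h1 := (LevyProkhorov.continuous_ofMeasure_probabilityMeasure
      (Ω := Space d)).continuousAt.tendsto.comp hlim
    rw [tendsto_iff_edist_tendsto_0] at h1
    exact h1
  obtain ⟨N, hN⟩ := eventually_atTop.1 (hLP.eventually
    (gt_mem_nhds (show (0 : ℝ≥0∞) < ENNReal.ofReal ε by simpa using hε0)))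
  refine ⟨N, fun k hk => ?_⟩
  have h1 := dist_le_of_levyProkhorovEDist_lt (x (φ k)) μ hε0 (hpos n) (hN k hk.le)
  have h2 := hx (φ k) n
  have h3 := hμS n
  have h4 : ε * (2 + 2 * (n + 1)) = δ / 2 := by rw [hε]; field_simp
  show dist (x (φ k)) μ < δ
  nlinarith

/-! ### Vector measures with a density -/

section VectorMeasure

variable {X E F G : Type*} [MeasurableSpace X] [NormedAddCommGroup E] [NormedSpace ℝ E]
  [NormedAddCommGroup F] [NormedSpace ℝ F] [NormedAddCommGroup G] [NormedSpace ℝ G]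

theorem variation_withDensityᵥ_le (m : Measure X) {u : X → F} (hu : Integrable u m) :
    (m.withDensityᵥ u).variation ≤ m.withDensity fun x => ‖u x‖ₑ := by
  refine VectorMeasure.variation_le_of_forall_enorm_le fun s hs => ?_
  rw [withDensityᵥ_apply hu hs, withDensity_apply _ hs]
  exact enorm_integral_le_lintegral_enorm _

theorem isFiniteMeasure_variation_withDensityᵥ (m : Measure X) {u : X → F}
    (hu : Integrable u m) : IsFiniteMeasure (m.withDensityᵥ u).variation := by
  have : IsFiniteMeasure (m.withDensity fun x => ‖u x‖ₑ) := isFiniteMeasure_withDensity hu.2.ne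
  exact isFiniteMeasure_of_le _ (variation_withDensityᵥ_le m hu)

theorem integrable_pairing_of_bounded (m : Measure X) {u : X → F}
    (hu : Integrable u m) (B : E →L[ℝ] F →L[ℝ] G) {f : X → E} (hf : AEStronglyMeasurable f m)
    {C : ℝ} (hC : ∀ x, ‖f x‖ ≤ C) : Integrable (fun x => B (f x) (u x)) m := by
  refine (hu.norm.const_mul (‖B‖ * C)).mono'
    (B.aestronglyMeasurable_comp₂ hf hu.aestronglyMeasurable) (Eventually.of_forall fun x => ?_)
  refine (B.le_opNorm₂ _ _).trans ?_
  gcongr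
  exact hC x

/-- The integral of a bounded function against a vector measure with a density. -/
theorem integral_withDensityᵥ [CompleteSpace F] [CompleteSpace G] (m : Measure X) {u : X → F}
    (hu : Integrable u m) (B : E →L[ℝ] F →L[ℝ] G) {f : X → E} (hf : StronglyMeasurable f) {C : ℝ}
    (hC : ∀ x, ‖f x‖ ≤ C) :
    ∫ᵛ x, f x ∂[B; m.withDensityᵥ u] = ∫ x, B (f x) (u x) ∂m := by
  have := isFiniteMeasure_variation_withDensityᵥ m hu
  have hsimple : ∀ g : SimpleFunc X E,
      ∫ᵛ x, g x ∂[B; m.withDensityᵥ u] = ∫ x, B (g x) (u x) ∂m := by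
    intro g
    induction g using SimpleFunc.induction with
    | @const c s hs =>
      have e1 : ⇑(SimpleFunc.piecewise s hs (SimpleFunc.const X c) (SimpleFunc.const X 0))
          = s.indicator fun _ => c := by
        ext x; simp [SimpleFunc.coe_piecewise, Set.piecewise, Set.indicator]
      rw [e1, VectorMeasure.integral_indicator hs]
      have : IsFiniteMeasure ((m.withDensityᵥ u).restrict s).variation := inferInstance
      rw [VectorMeasure.integral_const, VectorMeasure.restrict_apply _ hs MeasurableSet.univ,
        univ_inter, withDensityᵥ_apply hu hs, ← ContinuousLinearMap.integral_comp_comm _ hu.integrableOn,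
        ← integral_indicator hs]
      refine integral_congr_ae (Eventually.of_forall fun x => ?_)
      by_cases hx : x ∈ s <;> simp [hx]
    | @add g h hd hg hh =>
      obtain ⟨Cg, hCg⟩ := g.exists_forall_norm_le
      obtain ⟨Ch, hCh⟩ := h.exists_forall_norm_le
      rw [SimpleFunc.coe_add, VectorMeasure.integral_add (g.integrable_of_isFiniteMeasure)
        (h.integrable_of_isFiniteMeasure), hg, hh,
        ← integral_add (integrable_pairing_of_bounded m hu B g.aestronglyMeasurable hCg)
          (integrable_pairing_of_bounded m hu B h.aestronglyMeasurable hCh)]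
      simp
  have hC0 : 0 ≤ max C 0 := le_max_right _ _
  have l1 := VectorMeasure.tendsto_integral_of_dominated_convergence (μ := m.withDensityᵥ u)
    (B := B) (f := f) (fun _ => max C 0)
    (fun n => (hf.approxBounded (max C 0) n).aestronglyMeasurable) (integrable_const _)
    (fun n => Eventually.of_forall fun x => hf.norm_approxBounded_le hC0 n x)
    (Eventually.of_forall fun x =>
      hf.tendsto_approxBounded_of_norm_le ((hC x).trans (le_max_left _ _)))
  have l2 : Tendsto (fun n => ∫ x, B (hf.approxBounded (max C 0) n x) (u x) ∂m) atTop
      (𝓝 (∫ x, B (f x) (u x) ∂m)) := by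
    refine tendsto_integral_of_dominated_convergence (fun x => ‖B‖ * max C 0 * ‖u x‖)
      (fun n => (integrable_pairing_of_bounded m hu B (SimpleFunc.aestronglyMeasurable _)
        (hf.norm_approxBounded_le hC0 n)).aestronglyMeasurable) (hu.norm.const_mul _)
      (fun n => Eventually.of_forall fun x => ?_) (Eventually.of_forall fun x => ?_)
    · refine (B.le_opNorm₂ _ _).trans ?_
      gcongr
      exact hf.norm_approxBounded_le hC0 n x
    · exact ((ContinuousLinearMap.apply ℝ G (u x)).comp B).continuous.continuousAt.tendsto.comp
        (hf.tendsto_approxBounded_of_norm_le ((hC x).trans (le_max_left _ _)))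
  refine tendsto_nhds_unique l1 (l2.congr fun n => (hsimple _).symm)

end VectorMeasure

theorem pairing_apply {U : Submodule ℝ (Space d)} (x : Space d) (u : U) :
    pairing U x u = inner ℝ x (u : Space d) := rfl

/-! ### Continuous curves and their space-time measures -/

/-- Absolute continuity of the integral: the majorant has small integral over short intervals. -/
theorem IsACCurve.continuous {μ : I → P₁ d} (hμ : IsACCurve μ) : Continuous μ := by
  obtain ⟨g, hgm, hg, h⟩ := hμ
  refine Metric.continuous_iff.2 fun t ε hε => ?_
  obtain ⟨δ, hδ, hδg⟩ := exists_pos_setLIntegral_lt_of_measure_lt hg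
    (ENNReal.ofReal_pos.2 hε).ne'
  have hvol : ∀ s t : I, s ≤ t → volume (Icc s t) = ENNReal.ofReal (t - s : ℝ) := by
    intro s t hst
    rw [unitInterval.volume_Icc]
  have key : ∀ s t : I, s ≤ t → ENNReal.ofReal (t - s : ℝ) < δ →
      dist (μ s) (μ t) < ε := by
    intro s t hst hlt
    rw [← ENNReal.ofReal_lt_ofReal_iff hε, ← edist_dist]
    exact (h s t hst).trans_lt (hδg _ (by rwa [hvol s t hst]))
  have hlim : Tendsto (fun s : I => ENNReal.ofReal |(s - t : ℝ)|) (𝓝 t) (𝓝 0) := by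
    have : Continuous fun s : I => ENNReal.ofReal |(s - t : ℝ)| :=
      ENNReal.continuous_ofReal.comp (by fun_prop)
    simpa using this.tendsto t
  obtain ⟨η, hη, hηt⟩ := Metric.eventually_nhds_iff.1 (hlim.eventually (gt_mem_nhds hδ))
  refine ⟨η, hη, fun s hs => ?_⟩
  have h1 := hηt hs
  rcases le_total s t with hst | hst
  · refine key s t hst ?_
    rwa [abs_sub_comm, abs_of_nonneg (sub_nonneg.2 (Subtype.coe_le_coe.2 hst))] at h1
  · rw [dist_comm]
    refine key t s hst ?_
    rwa [abs_of_nonneg (sub_nonneg.2 (Subtype.coe_le_coe.2 hst))] at h1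

/-- Open sets generate the Borel sets, and t ↦ μ_t(O) is lower semicontinuous for open O by the
portmanteau theorem. -/
theorem measurable_meas {μ : I → P₁ d} (hμ : Continuous μ) : Measurable fun t => (μ t).meas := by
  refine Measurable.measure_of_isPiSystem_of_isProbabilityMeasure
    (S := {s : Set (Space d) | IsOpen s}) BorelSpace.measurable_eq isPiSystem_isOpen fun s hs => ?_
  refine LowerSemicontinuous.measurable (lowerSemicontinuous_iff_le_liminf.2 fun t => ?_)
  exact ProbabilityMeasure.le_liminf_measure_open_of_tendsto
    ((P₁.continuous_val.comp hμ).tendsto t) hs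

/-- The disintegration kernel of the space-time measure of a continuous curve. -/
noncomputable def curveKernel {μ : I → P₁ d} (hμ : Continuous μ) :
    ProbabilityTheory.Kernel I (Space d) := ⟨fun t => (μ t).meas, measurable_meas hμ⟩

instance {μ : I → P₁ d} (hμ : Continuous μ) :
    ProbabilityTheory.IsMarkovKernel (curveKernel hμ) :=
  ⟨fun t => inferInstanceAs (IsProbabilityMeasure (μ t).meas)⟩

theorem measurable_spaceTime_slice {μ : I → P₁ d} (hμ : Continuous μ) :
    Measurable fun t => (μ t).meas.map fun y => (y, t) := by
  refine Measure.measurable_of_measurable_coe _ fun s hs => ?_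
  have h : ∀ t, (μ t).meas.map (fun y => (y, t)) s
      = curveKernel hμ t (Prod.mk t ⁻¹' (Prod.swap ⁻¹' s)) := fun t => by
    rw [Measure.map_apply (by fun_prop) hs]; rfl
  simp_rw [h]
  exact ProbabilityTheory.Kernel.measurable_kernel_prodMk_left (measurable_swap hs)

theorem lintegral_spaceTime {μ : I → P₁ d} (hμ : Continuous μ) {f : Space d × I → ℝ≥0∞}
    (hf : Measurable f) :
    ∫⁻ z, f z ∂spaceTime μ = ∫⁻ t, ∫⁻ y, f (y, t) ∂(μ t).meas := by
  rw [spaceTime, Measure.lintegral_bind (measurable_spaceTime_slice hμ).aemeasurable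
    hf.aemeasurable]
  refine lintegral_congr fun t => lintegral_map hf (by fun_prop)

/-- Opens the way to the Fubini theorems for kernels, which put time first; hence the swap. -/
theorem spaceTime_eq_map_compProd {μ : I → P₁ d} (hμ : Continuous μ) :
    spaceTime μ = ((volume : Measure I).compProd (curveKernel hμ)).map Prod.swap := by
  refine Measure.ext_of_lintegral _ fun f hf => ?_
  rw [lintegral_spaceTime hμ hf, lintegral_map hf measurable_swap,
    Measure.lintegral_compProd (f := fun z => f z.swap) (hf.comp measurable_swap)]
  rfl

theorem isProbabilityMeasure_spaceTime {μ : I → P₁ d} (hμ : Continuous μ) :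
    IsProbabilityMeasure (spaceTime μ) := by
  rw [spaceTime_eq_map_compProd hμ]
  exact Measure.isProbabilityMeasure_map measurable_swap.aemeasurable

theorem integrable_comp_swap {E : Type*} [NormedAddCommGroup E] {μ : I → P₁ d}
    (hμ : Continuous μ) {f : Space d × I → E} (hf : Integrable f (spaceTime μ)) :
    Integrable (fun z : I × Space d => f (z.2, z.1))
      ((volume : Measure I).compProd (curveKernel hμ)) := by
  rw [spaceTime_eq_map_compProd hμ] at hf
  exact hf.comp_measurable measurable_swap

theorem integral_spaceTime {E : Type*} [NormedAddCommGroup E] [NormedSpace ℝ E] {μ : I → P₁ d}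
    (hμ : Continuous μ) {f : Space d × I → E} (hf : Integrable f (spaceTime μ)) :
    ∫ z, f z ∂spaceTime μ = ∫ t, ∫ y, f (y, t) ∂(μ t).meas := by
  have h := integrable_comp_swap hμ hf
  have := Measure.integral_compProd h
  rw [spaceTime_eq_map_compProd hμ, integral_map measurable_swap.aemeasurable
    (by rw [← spaceTime_eq_map_compProd hμ]; exact hf.aestronglyMeasurable)]
  exact this

theorem integrable_integral_spaceTime {E : Type*} [NormedAddCommGroup E] [NormedSpace ℝ E]
    {μ : I → P₁ d} (hμ : Continuous μ) {f : Space d × I → E} (hf : Integrable f (spaceTime μ)) :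
    Integrable (fun t => ∫ y, f (y, t) ∂(μ t).meas) (volume : Measure I) :=
  (integrable_comp_swap hμ hf).integral_compProd

theorem ae_integrable_slice {E : Type*} [NormedAddCommGroup E]
    {μ : I → P₁ d} (hμ : Continuous μ) {f : Space d × I → E} (hf : Integrable f (spaceTime μ)) :
    ∀ᵐ t : I, Integrable (fun y => f (y, t)) (μ t).meas :=
  (Measure.integrable_compProd_iff (integrable_comp_swap hμ hf).aestronglyMeasurable).1
    (integrable_comp_swap hμ hf) |>.1

/-- The first moment along the curve. -/
theorem continuous_integral_norm {μ : I → P₁ d} (hμ : Continuous μ) :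
    Continuous fun t => ∫ y, ‖y‖ ∂(μ t).meas :=
  (lipschitzWith_integral lipschitzWith_one_norm).continuous.comp hμ

theorem integrable_spaceTime_norm {μ : I → P₁ d} (hμ : Continuous μ) :
    Integrable (fun z : Space d × I => ‖z.1‖) (spaceTime μ) := by
  refine ⟨by fun_prop, ?_⟩
  rw [hasFiniteIntegral_iff_enorm, lintegral_spaceTime hμ (by fun_prop)]
  have : ∀ t, ∫⁻ y, ‖‖y‖‖ₑ ∂(μ t).meas = ENNReal.ofReal (∫ y, ‖y‖ ∂(μ t).meas) := fun t => by
    rw [ofReal_integral_eq_lintegral_ofReal (μ t).integrable_norm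
      (Eventually.of_forall fun y => norm_nonneg y)]
    exact lintegral_congr fun y => by rw [enorm_norm, ofReal_norm]
  simp_rw [this]
  exact ((continuous_integral_norm hμ).integrable_of_hasCompactSupport
    (HasCompactSupport.of_compactSpace _)).lintegral_lt_top

/-! ### From weak derivatives in time to primitives -/

theorem integral_unitInterval_eq (f : ℝ → ℝ) :
    ∫ t : I, f t = ∫ x in Icc (0 : ℝ) 1, f x :=
  integral_subtype_comap measurableSet_Icc f

open Real in
/-- A smooth approximation of the indicator function of `(s, t]`. -/
noncomputable def window (s t h x : ℝ) : ℝ :=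
  smoothTransition ((x - s) / h) - smoothTransition ((x - t) / h)

theorem contDiff_window (s t h : ℝ) : ContDiff ℝ ∞ (window s t h) :=
  (Real.smoothTransition.contDiff.comp ((contDiff_id.sub contDiff_const).div_const h)).sub
    (Real.smoothTransition.contDiff.comp ((contDiff_id.sub contDiff_const).div_const h))

theorem deriv_window (s t h x : ℝ) : deriv (window s t h) x =
    deriv Real.smoothTransition ((x - s) / h) / h
      - deriv Real.smoothTransition ((x - t) / h) / h := by
  have hd : ∀ r : ℝ, HasDerivAt (fun x => Real.smoothTransition ((x - r) / h))
      (deriv Real.smoothTransition ((x - r) / h) * (1 / h)) x := fun r =>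
    ((Real.smoothTransition.contDiff (n := 1)).differentiable (by simp) _).hasDerivAt.comp x
      (((hasDerivAt_id x).sub_const r).div_const h)
  have := ((hd s).sub (hd t)).deriv
  rw [show window s t h = (fun x => Real.smoothTransition ((x - s) / h))
    - fun x => Real.smoothTransition ((x - t) / h) from rfl, this]
  ring

theorem abs_window_le (s t h x : ℝ) : |window s t h x| ≤ 1 := by
  rw [window, abs_le]
  have h1 := Real.smoothTransition.nonneg ((x - s) / h)
  have h2 := Real.smoothTransition.nonneg ((x - t) / h)
  have h3 := Real.smoothTransition.le_one ((x - s) / h)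
  have h4 := Real.smoothTransition.le_one ((x - t) / h)
  constructor <;> linarith

theorem tsupport_window_subset {s t h : ℝ} (hst : s ≤ t) (hh : 0 < h) :
    tsupport (window s t h) ⊆ Icc s (t + h) := by
  refine closure_minimal (fun x hx => ?_) isClosed_Icc
  by_contra hc
  refine hx ?_
  rw [mem_Icc, not_and_or, not_le, not_le] at hc
  rcases hc with hc | hc
  · rw [window, Real.smoothTransition.zero_of_nonpos, Real.smoothTransition.zero_of_nonpos, sub_zero]
    · exact div_nonpos_of_nonpos_of_nonneg (by linarith) hh.le
    · exact div_nonpos_of_nonpos_of_nonneg (by linarith) hh.le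
  · rw [window, Real.smoothTransition.one_of_one_le, Real.smoothTransition.one_of_one_le, sub_self]
    · rw [le_div_iff₀ hh]; linarith
    · rw [le_div_iff₀ hh]; linarith

theorem tendsto_window {s t : ℝ} (hst : s ≤ t) (x : ℝ) :
    Tendsto (fun h => window s t h x) (𝓝[>] 0) (𝓝 ((Ioc s t).indicator 1 x)) := by
  have hone : ∀ r, r < x → ∀ᶠ h in 𝓝[>] (0 : ℝ), Real.smoothTransition ((x - r) / h) = 1 := by
    intro r hr
    filter_upwards [Ioo_mem_nhdsGT (sub_pos.2 hr)] with h hh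
    exact Real.smoothTransition.one_of_one_le ((le_div_iff₀ hh.1).2 (by linarith [hh.2]))
  have hzero : ∀ r, x ≤ r → ∀ᶠ h in 𝓝[>] (0 : ℝ), Real.smoothTransition ((x - r) / h) = 0 := by
    intro r hr
    filter_upwards [self_mem_nhdsWithin] with h hh
    exact Real.smoothTransition.zero_of_nonpos
      (div_nonpos_of_nonpos_of_nonneg (by linarith) (le_of_lt hh))
  refine tendsto_const_nhds.congr' ?_
  rcases le_or_gt x s with h1 | h1
  · filter_upwards [hzero s h1, hzero t (h1.trans hst)] with h e1 e2
    simp [window, e1, e2, indicator, not_lt.2 h1]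
  · rcases le_or_gt x t with h2 | h2
    · filter_upwards [hone s h1, hzero t h2] with h e1 e2
      simp [window, e1, e2, indicator, h1, h2]
    · filter_upwards [hone s h1, hone t h2] with h e1 e2
      simp [window, e1, e2, indicator, not_le.2 h2]

/-- The rescaled derivative is a one-sided approximate identity, supported in [s, s + h] and hence
in [0,1] for small h. The substitution x = s + h y removes the singularity. -/
theorem tendsto_integral_deriv_smoothTransition_mul {a : ℝ → ℝ} (ha : Continuous a) {s : ℝ}
    (hs0 : 0 < s) (hs1 : s < 1) :
    Tendsto (fun h => ∫ x in Icc (0 : ℝ) 1, deriv Real.smoothTransition ((x - s) / h) / h * a x)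
      (𝓝[>] 0) (𝓝 (a s)) := by
  have hS : Continuous (deriv Real.smoothTransition) :=
    (Real.smoothTransition.contDiff (n := 1)).continuous_deriv le_rfl
  have hS0 : ∀ y, y < 0 ∨ 1 < y → deriv Real.smoothTransition y = 0 := by
    rintro y (hy | hy)
    · have : Real.smoothTransition =ᶠ[𝓝 y] fun _ => 0 := by
        filter_upwards [Iio_mem_nhds hy] with x hx
        exact Real.smoothTransition.zero_of_nonpos (le_of_lt hx)
      rw [this.deriv_eq, deriv_const]
    · have : Real.smoothTransition =ᶠ[𝓝 y] fun _ => 1 := by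
        filter_upwards [Ioi_mem_nhds hy] with x hx
        exact Real.smoothTransition.one_of_one_le (le_of_lt hx)
      rw [this.deriv_eq, deriv_const]
  have hcont : Continuous fun h : ℝ => ∫ y in (0 : ℝ)..1,
      deriv Real.smoothTransition y * a (s + h * y) :=
    intervalIntegral.continuous_parametric_intervalIntegral_of_continuous' (by fun_prop) 0 1
  have hlim := (hcont.tendsto 0).mono_left (nhdsWithin_le_nhds (s := Ioi 0))
  have h0 : ∫ y in (0 : ℝ)..1, deriv Real.smoothTransition y * a (s + 0 * y) = a s := by
    simp only [zero_mul, add_zero, intervalIntegral.integral_mul_const]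
    rw [intervalIntegral.integral_deriv_eq_sub (fun x _ =>
      (Real.smoothTransition.contDiff (n := 1)).differentiable (by simp) x) (hS.intervalIntegrable _ _)]
    simp
  rw [h0] at hlim
  refine hlim.congr' ?_
  filter_upwards [Ioo_mem_nhdsGT (sub_pos.2 hs1)] with h hh
  have hh0 : h ≠ 0 := hh.1.ne'
  have e1 : ∫ x in Icc (0 : ℝ) 1, deriv Real.smoothTransition ((x - s) / h) / h * a x
      = ∫ x in Icc s (s + h), deriv Real.smoothTransition ((x - s) / h) / h * a x := by
    refine setIntegral_eq_of_subset_of_forall_sdiff_eq_zero measurableSet_Icc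
      (Icc_subset_Icc hs0.le (by linarith [hh.2])) fun x hx => ?_
    rw [hS0, zero_div, zero_mul]
    have := hx.2
    rw [mem_Icc, not_and_or, not_le, not_le] at this
    rcases this with h1 | h1
    · left; exact div_neg_of_neg_of_pos (by linarith) hh.1
    · right; rw [lt_div_iff₀ hh.1]; linarith
  rw [e1, integral_Icc_eq_integral_Ioc, ← intervalIntegral.integral_of_le (by linarith [hh.1])]
  have e2 := intervalIntegral.integral_comp_div_sub (a := s) (b := s + h)
    (fun y => deriv Real.smoothTransition y * a (s + h * y)) hh0 (s / h)
  have e3 : s / h - s / h = 0 := sub_self _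
  have e4 : (s + h) / h - s / h = 1 := by field_simp; ring
  rw [e3, e4, smul_eq_mul] at e2
  rw [eq_comm, ← mul_right_inj' hh0, ← e2, ← intervalIntegral.integral_const_mul]
  refine intervalIntegral.integral_congr fun x _ => ?_
  rw [show s + h * (x / h - s / h) = x by field_simp; ring, ← sub_div]
  field_simp

/-- A continuous function whose distributional derivative is integrable is the primitive of its
derivative. -/
theorem sub_eq_setIntegral_of_weak_deriv {a b : I → ℝ} (ha : Continuous a) (hb : Integrable b)
    (h : ∀ η : ℝ → ℝ, ContDiff ℝ ∞ η → tsupport η ⊆ Ioo (0 : ℝ) 1 →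
      ∫ t : I, (deriv η t * a t + η t * b t) = 0) {s t : I} (hst : s ≤ t) :
    a t - a s = ∫ r in Ioc s t, b r := by
  set a' : ℝ → ℝ := fun x => a (projIcc 0 1 zero_le_one x) with ha'
  set b' : ℝ → ℝ := (Icc (0 : ℝ) 1).indicator fun x => b (projIcc 0 1 zero_le_one x) with hb'
  have ha'c : Continuous a' := ha.comp continuous_projIcc
  have haa : ∀ t : I, a' t = a t := fun t => by simp [ha']
  have hbb : ∀ t : I, b' t = b t := fun t => by simp [hb']
  have hb'i : Integrable b' := by
    rw [hb', integrable_indicator_iff measurableSet_Icc]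
    have h1 : Integrable ((fun x : ℝ => b (projIcc 0 1 zero_le_one x)) ∘ ((↑) : I → ℝ)) := by
      refine hb.congr (Eventually.of_forall fun t => ?_)
      simp
    have := (unitInterval.measurePreserving_coe.integrable_comp_emb
      unitInterval.measurableEmbedding_coe
      (g := fun x : ℝ => b (projIcc 0 1 zero_le_one x))).1 h1
    exact this
  -- Test functions live in the open interval, so s and t are interior at first; the windows
  -- approximating the indicator of (s, t] are admissible for small width.
  have key : ∀ s t : ℝ, 0 < s → s ≤ t → t < 1 → a' t - a' s = ∫ x in s..t, b' x := by
    intro s t hs hst ht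
    have hs1 : s < 1 := hst.trans_lt ht
    have ht0 : 0 < t := hs.trans_le hst
    have l1 := (tendsto_integral_deriv_smoothTransition_mul ha'c hs hs1).sub
      (tendsto_integral_deriv_smoothTransition_mul ha'c ht0 ht)
    have l2 : Tendsto (fun h => ∫ x in Icc (0 : ℝ) 1, window s t h x * b' x) (𝓝[>] 0)
        (𝓝 (∫ x in Icc (0 : ℝ) 1, (Ioc s t).indicator 1 x * b' x)) := by
      refine tendsto_integral_filter_of_dominated_convergence (fun x => ‖b' x‖)
        (Eventually.of_forall fun h =>
          (contDiff_window s t h).continuous.aestronglyMeasurable.mul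
            hb'i.aestronglyMeasurable.restrict) (Eventually.of_forall fun h =>
          Eventually.of_forall fun x => ?_) hb'i.norm.restrict
        (Eventually.of_forall fun x => (tendsto_window hst x).mul_const _)
      rw [norm_mul]
      exact mul_le_of_le_one_left (norm_nonneg _) (abs_window_le s t h x)
    have l3 : ∫ x in Icc (0 : ℝ) 1, (Ioc s t).indicator 1 x * b' x = ∫ x in s..t, b' x := by
      rw [intervalIntegral.integral_of_le hst]
      have : (fun x => (Ioc s t).indicator 1 x * b' x) = (Ioc s t).indicator b' := by
        ext x; by_cases hx : x ∈ Ioc s t <;> simp [hx]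
      rw [this, setIntegral_indicator measurableSet_Ioc, inter_eq_right.2]
      exact Ioc_subset_Icc_self.trans (Icc_subset_Icc hs.le ht.le)
    have l4 : Tendsto (fun _ : ℝ => (0 : ℝ)) (𝓝[>] 0) (𝓝 (a' s - a' t + ∫ x in s..t, b' x)) := by
      rw [← l3]
      refine (l1.add l2).congr' ?_
      filter_upwards [Ioo_mem_nhdsGT (sub_pos.2 ht)] with h' hh
      have hS : Continuous (deriv Real.smoothTransition) :=
        (Real.smoothTransition.contDiff (n := 1)).continuous_deriv le_rfl
      have hi : ∀ r, IntegrableOn (fun x => deriv Real.smoothTransition ((x - r) / h') / h' * a' x)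
          (Icc 0 1) := fun r => (Continuous.continuousOn (by fun_prop)).integrableOn_Icc
      have hi2 : IntegrableOn (fun x => window s t h' x * b' x) (Icc 0 1) :=
        (hb'i.bdd_mul (c := 1) (contDiff_window s t h').continuous.aestronglyMeasurable
          (Eventually.of_forall fun x => abs_window_le s t h' x)).integrableOn
      have hi3 : IntegrableOn (fun x => deriv Real.smoothTransition ((x - s) / h') / h' * a' x
          - deriv Real.smoothTransition ((x - t) / h') / h' * a' x) (Icc 0 1) := (hi s).sub (hi t)
      rw [← integral_sub (hi s) (hi t), ← integral_add hi3 hi2, ← integral_unitInterval_eq]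
      refine Eq.trans ?_ (h (window s t h') (contDiff_window s t h')
        ((tsupport_window_subset hst hh.1).trans fun x hx =>
          ⟨hs.trans_le hx.1, hx.2.trans_lt (by linarith [hh.2])⟩))
      refine integral_congr_ae (Eventually.of_forall fun x => ?_)
      simp only [haa, hbb, deriv_window]
      ring
    have := tendsto_nhds_unique l4 tendsto_const_nhds
    linarith
  -- Φ is constant in the interior and continuous, hence constant up to the endpoints 0 and 1.
  set Φ : ℝ → ℝ := fun x => a' x - ∫ y in (0 : ℝ)..x, b' y with hΦ
  have hΦc : Continuous Φ := ha'c.sub (intervalIntegral.continuous_primitive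
    (fun _ _ => hb'i.intervalIntegrable) 0)
  have hconst : ∀ x ∈ Ioo (0 : ℝ) 1, ∀ y ∈ Ioo (0 : ℝ) 1, x ≤ y → Φ x = Φ y := by
    intro x hx y hy hxy
    have h1 := key x y hx.1 hxy hy.2
    have h2 := intervalIntegral.integral_add_adjacent_intervals (a := 0) (b := x) (c := y)
      (hb'i.intervalIntegrable) (hb'i.intervalIntegrable)
    simp only [hΦ]
    linarith
  have hhalf : (1 / 2 : ℝ) ∈ Ioo (0 : ℝ) 1 := by norm_num
  have hΦ' : EqOn Φ (fun _ => Φ (1 / 2)) (closure (Ioo (0 : ℝ) 1)) := by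
    refine EqOn.closure (fun x hx => ?_) hΦc continuous_const
    rcases le_total x (1 / 2) with hle | hle
    · exact hconst x hx _ hhalf hle
    · exact (hconst _ hhalf x hx hle).symm
  rw [closure_Ioo (zero_ne_one' ℝ)] at hΦ'
  have h1 := hΦ' s.2
  have h2 := hΦ' t.2
  have h3 := intervalIntegral.integral_add_adjacent_intervals (a := 0) (b := (s : ℝ)) (c := t)
    (hb'i.intervalIntegrable) (hb'i.intervalIntegrable)
  have h4 : ∫ r in Ioc s t, b r = ∫ x in (s : ℝ)..t, b' x := by
    rw [intervalIntegral.integral_of_le (show (s : ℝ) ≤ t from hst)]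
    have e : ∀ r : I, (Ioc s t).indicator b r = (Ioc (s : ℝ) t).indicator b' r := fun r => by
      have hmem : r ∈ Ioc s t ↔ (r : ℝ) ∈ Ioc (s : ℝ) t := Iff.rfl
      by_cases hr : r ∈ Ioc s t
      · rw [indicator_of_mem hr, indicator_of_mem (hmem.1 hr), hbb]
      · rw [indicator_of_notMem hr, indicator_of_notMem (fun h => hr (hmem.2 h))]
    rw [← integral_indicator measurableSet_Ioc, integral_congr_ae (Eventually.of_forall e),
      integral_unitInterval_eq, setIntegral_indicator measurableSet_Ioc, inter_eq_right.2]
    exact Ioc_subset_Icc_self.trans (Icc_subset_Icc s.2.1 t.2.2)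
  rw [h4]
  simp only [hΦ, haa] at h1 h2
  linarith

/-! ### Evolution of integrals along the continuity equation -/

theorem JointlyUniformlyContinuous.uniformContinuous {Y : Type*} [PseudoMetricSpace Y]
    {G : Space d → P₁ d → Y} (hG : JointlyUniformlyContinuous G) :
    UniformContinuous fun z : Space d × P₁ d => G z.1 z.2 := by
  refine Metric.uniformContinuous_iff.2 fun η hη => ?_
  obtain ⟨r, hr, h⟩ := hG η hη
  refine ⟨r, hr, fun {a b} hab => ?_⟩
  rw [Prod.dist_eq, max_lt_iff] at hab
  refine h _ _ _ _ hab.1 ?_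
  rw [← edist_eq_W₁, edist_dist]
  exact (ENNReal.ofReal_lt_ofReal_iff hr).2 hab.2

theorem integrable_apply_of_bounded {X E : Type*} [MeasurableSpace X] [NormedAddCommGroup E]
    [NormedSpace ℝ E] {m : Measure X} {A : X → E →L[ℝ] ℝ} {v : X → E}
    (hA : AEStronglyMeasurable A m) {C : ℝ} (hC : ∀ x, ‖A x‖ ≤ C) (hv : Integrable v m) :
    Integrable (fun x => A x (v x)) m :=
  integrable_pairing_of_bounded m hv (ContinuousLinearMap.id ℝ (E →L[ℝ] ℝ)) hA hC

/-- The points of space-time with time in `(s, t]`. -/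
def slab (d : ℕ) (s t : I) : Set (Space d × I) := Prod.snd ⁻¹' Ioc s t

theorem measurableSet_slab (s t : I) : MeasurableSet (slab d s t) :=
  measurable_snd measurableSet_Ioc

theorem setIntegral_slab {E : Type*} [NormedAddCommGroup E] [NormedSpace ℝ E] {μ : I → P₁ d}
    (hμ : Continuous μ) {f : Space d × I → E} (hf : Integrable f (spaceTime μ)) (s t : I) :
    ∫ z in slab d s t, f z ∂spaceTime μ = ∫ r in Ioc s t, ∫ y, f (y, r) ∂(μ r).meas := by
  rw [← integral_indicator (measurableSet_slab s t),
    integral_spaceTime hμ (hf.indicator (measurableSet_slab s t)),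
    ← integral_indicator measurableSet_Ioc]
  refine integral_congr_ae (Eventually.of_forall fun r => ?_)
  by_cases hr : r ∈ Ioc s t
  · have : ∀ y : Space d, (y, r) ∈ slab d s t := fun y => hr
    simp [hr, this]
  · have : ∀ y : Space d, (y, r) ∉ slab d s t := fun y => hr
    simp [hr, this]

section Field

variable {D : Data d} {μ : I → P₁ d}

theorem Data.IsAdmissible.continuous_field (hD : D.IsAdmissible) (hμ : Continuous μ) :
    Continuous fun z : Space d × I => D.F z.1 (μ z.2) :=
  hD.field_cont.uniformContinuous.continuous.comp
    (continuous_fst.prodMk (hμ.comp continuous_snd))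

theorem Data.IsAdmissible.integrable_field (hD : D.IsAdmissible) (hμ : Continuous μ) :
    Integrable (fun z : Space d × I => D.F z.1 (μ z.2)) (spaceTime μ) := by
  have := isProbabilityMeasure_spaceTime hμ
  obtain ⟨C, C', -, hC', h⟩ := hD.field_growth
  obtain ⟨M, hM⟩ := (isCompact_range (continuous_integral_norm hμ)).bddAbove
  refine ((integrable_const (C + C' * M)).add ((integrable_spaceTime_norm hμ).const_mul C')).mono'
    (hD.continuous_field hμ).aestronglyMeasurable (Eventually.of_forall fun z => ?_)
  refine (h z.1 (μ z.2)).trans ?_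
  have h1 : ∫ y, ‖y‖ ∂(μ z.2).meas ≤ M := hM ⟨z.2, rfl⟩
  have h2 := mul_le_mul_of_nonneg_left h1 hC'
  simp only [Pi.add_apply]
  nlinarith

end Field

/-- The total velocity of a controlled curve. -/
def velocity (D : Data d) (μ : I → P₁ d) (u : Space d × I → D.U) (z : Space d × I) : Space d :=
  D.F z.1 (μ z.2) + u z

theorem Data.IsAdmissible.integrable_velocity {D : Data d} (hD : D.IsAdmissible) {μ : I → P₁ d}
    (hμ : Continuous μ) {u : Space d × I → D.U} (hu : Integrable u (spaceTime μ)) :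
    Integrable (velocity D μ u) (spaceTime μ) :=
  (hD.integrable_field hμ).add (D.U.subtypeL.integrable_comp hu)

section TestFunction

variable {φ : Space d × ℝ → ℝ}

theorem deriv_snd_eq (hφ : ContDiff ℝ ∞ φ) (y : Space d) (t : ℝ) :
    deriv (fun s => φ (y, s)) t = fderiv ℝ φ (y, t) (0, 1) := by
  have h1 := ((hφ.differentiable (by simp) (y, t)).hasFDerivAt).comp_hasDerivAt t
    ((hasDerivAt_const t y).prodMk (hasDerivAt_id t))
  exact h1.deriv

theorem fderiv_fst_eq (hφ : ContDiff ℝ ∞ φ) (y : Space d) (t : ℝ) :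
    fderiv ℝ (fun x => φ (x, t)) y
      = (fderiv ℝ φ (y, t)).comp (ContinuousLinearMap.inl ℝ (Space d) ℝ) :=
  (((hφ.differentiable (by simp) (y, t)).hasFDerivAt).comp y (hasFDerivAt_prodMk_left y t)).fderiv

theorem inner_gradient_fst_eq (hφ : ContDiff ℝ ∞ φ) (y v : Space d) (t : ℝ) :
    inner ℝ (gradient (fun x => φ (x, t)) y) v = fderiv ℝ φ (y, t) (v, 0) := by
  rw [inner_gradient_left, fderiv_fst_eq hφ]; rfl

theorem continuous_fderiv_coe (hφ : ContDiff ℝ ∞ φ) :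
    Continuous fun z : Space d × I => fderiv ℝ φ (z.1, (z.2 : ℝ)) :=
  (hφ.continuous_fderiv (by simp)).comp (by fun_prop)

theorem exists_fderiv_bound (hφ : ContDiff ℝ ∞ φ) (hc : HasCompactSupport φ) :
    ∃ C, ∀ z, ‖fderiv ℝ φ z‖ ≤ C :=
  (hc.fderiv ℝ).exists_bound_of_continuous (hφ.continuous_fderiv (by simp))

/-- The continuity equation for a flux with a density. -/
theorem continuityEquation_withDensityᵥ_iff {D : Data d} (hD : D.IsAdmissible) {μ : I → P₁ d}
    (hμ : Continuous μ) {u : Space d × I → D.U} (hu : Integrable u (spaceTime μ)) :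
    D.ContinuityEquation μ ((spaceTime μ).withDensityᵥ u) ↔
      ∀ φ : Space d × ℝ → ℝ, ContDiff ℝ ∞ φ → HasCompactSupport φ →
        tsupport φ ⊆ univ ×ˢ Ioo (0 : ℝ) 1 →
        ∫ z, fderiv ℝ φ (z.1, (z.2 : ℝ)) (D.F z.1 (μ z.2), 1) ∂spaceTime μ
          + ∫ z, fderiv ℝ φ (z.1, (z.2 : ℝ)) ((u z : Space d), 0) ∂spaceTime μ = 0 := by
  have := isProbabilityMeasure_spaceTime hμ
  refine forall_congr' fun φ => forall_congr' fun hφ => forall_congr' fun hc =>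
    forall_congr' fun _ => ?_
  obtain ⟨C, hC⟩ := exists_fderiv_bound hφ hc
  have e1 : ∫ z, fderiv ℝ φ (z.1, (z.2 : ℝ)) (D.F z.1 (μ z.2), 1) ∂spaceTime μ
      = ∫ t : I, ∫ y, (deriv (fun s => φ (y, s)) (t : ℝ) +
        inner ℝ (gradient (fun z => φ (z, (t : ℝ))) y) (D.F y (μ t))) ∂(μ t).meas := by
    rw [integral_spaceTime hμ (integrable_apply_of_bounded
      (continuous_fderiv_coe hφ).aestronglyMeasurable (fun z => hC _)
      ((hD.integrable_field hμ).prodMk (integrable_const (1 : ℝ))))]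
    refine integral_congr_ae (Eventually.of_forall fun t => ?_)
    refine integral_congr_ae (Eventually.of_forall fun y => ?_)
    simp only
    rw [deriv_snd_eq hφ, inner_gradient_fst_eq hφ, ← map_add]
    simp
  have e2 : ∫ᵛ x, gradient (fun z => φ (z, (x.2 : ℝ))) x.1 ∂[pairing D.U; (spaceTime μ).withDensityᵥ u]
      = ∫ z, fderiv ℝ φ (z.1, (z.2 : ℝ)) ((u z : Space d), 0) ∂spaceTime μ := by
    have hg : ∀ x : Space d × I, gradient (fun z => φ (z, (x.2 : ℝ))) x.1
        = (InnerProductSpace.toDual ℝ (Space d)).symm ((fderiv ℝ φ (x.1, (x.2 : ℝ))).comp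
          (ContinuousLinearMap.inl ℝ (Space d) ℝ)) := fun x => by
      rw [gradient, fderiv_fst_eq hφ]
    have hcont : Continuous fun x : Space d × I => gradient (fun z => φ (z, (x.2 : ℝ))) x.1 := by
      simp_rw [hg]
      exact (LinearIsometryEquiv.continuous _).comp
        ((continuous_fderiv_coe hφ).clm_comp continuous_const)
    rw [integral_withDensityᵥ (C := C) _ hu _ hcont.stronglyMeasurable fun x => ?_]
    · refine integral_congr_ae (Eventually.of_forall fun z => ?_)
      simp only
      rw [pairing_apply, inner_gradient_fst_eq hφ]
    · rw [hg, LinearIsometryEquiv.norm_map]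
      refine (ContinuousLinearMap.opNorm_comp_le _ _).trans ?_
      calc _ ≤ C * 1 := mul_le_mul (hC _) (ContinuousLinearMap.norm_inl_le_one ℝ (Space d) ℝ)
            (norm_nonneg _) ((norm_nonneg _).trans (hC 0))
        _ = C := mul_one C
  rw [e1, e2]

end TestFunction

/-- Evolution of the integral of a smooth compactly supported function. -/
theorem integral_sub_integral_eq_of_hasCompactSupport {D : Data d} (hD : D.IsAdmissible)
    {μ : I → P₁ d} (hμ : Continuous μ) {u : Space d × I → D.U} (hu : Integrable u (spaceTime μ))
    (hCE : D.ContinuityEquation μ ((spaceTime μ).withDensityᵥ u)) {ζ : Space d → ℝ}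
    (hζ : ContDiff ℝ ∞ ζ) (hζc : HasCompactSupport ζ) {s t : I} (hst : s ≤ t) :
    ∫ y, ζ y ∂(μ t).meas - ∫ y, ζ y ∂(μ s).meas
      = ∫ z in slab d s t, fderiv ℝ ζ z.1 (velocity D μ u z) ∂spaceTime μ := by
  have := isProbabilityMeasure_spaceTime hμ
  rw [continuityEquation_withDensityᵥ_iff hD hμ hu] at hCE
  obtain ⟨C, hC⟩ := (hζc.fderiv ℝ).exists_bound_of_continuous (hζ.continuous_fderiv (by simp))
  have hdc : Continuous fun z : Space d × I => fderiv ℝ ζ z.1 :=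
    (hζ.continuous_fderiv (by simp)).comp continuous_fst
  have hint := integrable_apply_of_bounded (A := fun z : Space d × I => fderiv ℝ ζ z.1)
    (hdc.aestronglyMeasurable (μ := spaceTime μ)) (fun z => hC z.1) (hD.integrable_velocity hμ hu)
  have hlip : LipschitzWith ⟨C, (norm_nonneg _).trans (hC 0)⟩ ζ :=
    lipschitzWith_of_nnnorm_fderiv_le (hζ.differentiable (by simp)) fun y => hC y
  rw [setIntegral_slab hμ hint]
  refine sub_eq_setIntegral_of_weak_deriv ((lipschitzWith_integral hlip).continuous.comp hμ)
    (integrable_integral_spaceTime hμ hint) (fun η hη hηs => ?_) hst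
  -- Testing with a product turns the equation into the weak derivative in time of t ↦ ∫ ζ dμ_t.
  set φ : Space d × ℝ → ℝ := fun z => ζ z.1 * η z.2 with hφ
  have hφs : ContDiff ℝ ∞ φ := (hζ.comp contDiff_fst).mul (hη.comp contDiff_snd)
  have hηc : IsCompact (tsupport η) :=
    isCompact_Icc.of_isClosed_subset (isClosed_tsupport η) (hηs.trans Ioo_subset_Icc_self)
  have hφc : HasCompactSupport φ := by
    refine HasCompactSupport.of_support_subset_isCompact (hζc.isCompact.prod hηc) fun z hz => ?_
    exact ⟨subset_tsupport _ (left_ne_zero_of_mul hz), subset_tsupport _ (right_ne_zero_of_mul hz)⟩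
  have hφt : tsupport φ ⊆ univ ×ˢ Ioo (0 : ℝ) 1 := by
    have : tsupport φ ⊆ univ ×ˢ tsupport η := by
      refine closure_minimal (fun z hz => ⟨mem_univ _, subset_tsupport _ (right_ne_zero_of_mul hz)⟩)
        (isClosed_univ.prod (isClosed_tsupport η))
    exact this.trans (prod_mono le_rfl hηs)
  have hder : ∀ (y : Space d) (r : ℝ) (v : Space d) (τ : ℝ), fderiv ℝ φ (y, r) (v, τ)
      = η r * fderiv ℝ ζ y v + deriv η r * ζ y * τ := by
    intro y r v τ
    have h1 : HasFDerivAt (fun z : Space d × ℝ => ζ z.1)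
        ((fderiv ℝ ζ y).comp (ContinuousLinearMap.fst ℝ (Space d) ℝ)) (y, r) :=
      (hζ.differentiable (by simp) y).hasFDerivAt.comp (y, r) hasFDerivAt_fst
    have h2 : HasFDerivAt (fun z : Space d × ℝ => η z.2)
        (deriv η r • (ContinuousLinearMap.snd ℝ (Space d) ℝ)) (y, r) :=
      (hη.differentiable (by simp) r).hasDerivAt.comp_hasFDerivAt (y, r) hasFDerivAt_snd
    rw [show φ = (fun z => ζ z.1) * fun z => η z.2 from rfl, (h1.mul h2).fderiv]
    simp
    ring
  have h := hCE φ hφs hφc hφt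
  obtain ⟨C', hC'⟩ := exists_fderiv_bound hφs hφc
  have i1 := integrable_apply_of_bounded (m := spaceTime μ)
      (continuous_fderiv_coe hφs).aestronglyMeasurable (fun z => hC' _)
      ((hD.integrable_field hμ).prodMk (integrable_const (1 : ℝ)))
  have i2 := integrable_apply_of_bounded (m := spaceTime μ)
      (continuous_fderiv_coe hφs).aestronglyMeasurable (fun z => hC' _)
      ((D.U.subtypeL.integrable_comp hu).prodMk (integrable_const (0 : ℝ)))
  have h' := (integral_add i1 i2).trans h
  have i3 : Integrable (fun z : Space d × I => fderiv ℝ φ (z.1, (z.2 : ℝ)) (D.F z.1 (μ z.2), (1 : ℝ))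
      + fderiv ℝ φ (z.1, (z.2 : ℝ)) (D.U.subtypeL (u z), (0 : ℝ))) (spaceTime μ) := i1.add i2
  rw [integral_spaceTime hμ i3] at h'
  rw [← h']
  refine integral_congr_ae ?_
  filter_upwards [ae_integrable_slice hμ hint] with r hr
  have hζi : Integrable ζ (μ r).meas := (μ r).integrable_of_lipschitz hlip
  change deriv η r * (∫ y, ζ y ∂(μ r).meas) + _ = _
  rw [← integral_const_mul, ← integral_const_mul,
    ← integral_add (hζi.const_mul _) (hr.const_mul _)]
  refine integral_congr_ae (Eventually.of_forall fun y => ?_)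
  simp only [hder, velocity, Submodule.subtypeL_apply, map_add]
  ring

/-- Evolution of the integral of a smooth function of linear growth. -/
theorem integral_sub_integral_eq {D : Data d} (hD : D.IsAdmissible)
    {μ : I → P₁ d} (hμ : Continuous μ) {u : Space d × I → D.U} (hu : Integrable u (spaceTime μ))
    (hCE : D.ContinuityEquation μ ((spaceTime μ).withDensityᵥ u)) {f : Space d → ℝ}
    (hf : ContDiff ℝ ∞ f) {b : ℝ} (hfb : ∀ x, ‖fderiv ℝ f x‖ ≤ b) {s t : I} (hst : s ≤ t) :
    ∫ y, f y ∂(μ t).meas - ∫ y, f y ∂(μ s).meas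
      = ∫ z in slab d s t, fderiv ℝ f z.1 (velocity D μ u z) ∂spaceTime μ := by
  have hb : 0 ≤ b := (norm_nonneg _).trans (hfb 0)
  have hlip : LipschitzWith ⟨b, hb⟩ f :=
    lipschitzWith_of_nnnorm_fderiv_le (hf.differentiable (by simp)) fun y => hfb y
  obtain ⟨C, hC1, hC⟩ := exists_truncation d
  have hfab : ∀ x, |f x| ≤ |f 0| + b * ‖x‖ := fun x => by
    have h1 := hlip.norm_sub_le x 0
    have h2 := norm_le_insert' (f x) (f 0)
    simp only [sub_zero, Real.norm_eq_abs] at h1 h2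
    change _ ≤ b * ‖x‖ at h1
    linarith
  have hR := hC f |f 0| b hf (abs_nonneg _) hfab hfb
  have hC0 : 0 ≤ C := zero_le_one.trans hC1
  refine tendsto_nhds_unique ((tendsto_integral_cutoff_mul (μ t)
    ((μ t).integrable_of_lipschitz hlip)).sub (tendsto_integral_cutoff_mul (μ s)
    ((μ s).integrable_of_lipschitz hlip))) ?_
  -- For R ≥ 1 the truncated gradients are bounded by C(|f 0| + b), so an integrable multiple of the
  -- speed dominates.
  have key : Tendsto (fun R : ℝ => ∫ z in slab d s t,
      fderiv ℝ (fun x => cutoff R x * f x) z.1 (velocity D μ u z) ∂spaceTime μ) atTop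
      (𝓝 (∫ z in slab d s t, fderiv ℝ f z.1 (velocity D μ u z) ∂spaceTime μ)) := by
    have hv := hD.integrable_velocity hμ hu
    refine tendsto_integral_filter_of_dominated_convergence
      (fun z => C * (|f 0| + b) * ‖velocity D μ u z‖) ?_ ?_ (hv.norm.const_mul _).restrict ?_
    · filter_upwards [eventually_ge_atTop 1] with R hR1
      have hdc : Continuous fun z : Space d × I => fderiv ℝ (fun x => cutoff R x * f x) z.1 :=
        ((hR R hR1).1.continuous_fderiv (by simp)).comp continuous_fst
      exact ((integrable_apply_of_bounded hdc.aestronglyMeasurable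
        (fun z => (hR R hR1).2.2.2 z.1) hv).restrict).aestronglyMeasurable
    · filter_upwards [eventually_ge_atTop 1] with R hR1
      refine Eventually.of_forall fun z => (ContinuousLinearMap.le_opNorm _ _).trans ?_
      gcongr
      refine ((hR R hR1).2.2.2 z.1).trans ?_
      gcongr
      exact div_le_self (abs_nonneg _) hR1
    · refine Eventually.of_forall fun z => tendsto_const_nhds.congr' ?_
      filter_upwards [tendsto_cutoff z.1] with R hR1
      have : (fun x => cutoff R x * f x) =ᶠ[𝓝 z.1] f := by
        filter_upwards [hR1] with x hx
        rw [hx, one_mul]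
      rw [this.fderiv_eq]
  refine key.congr' ?_
  filter_upwards [eventually_ge_atTop 1] with R hR1
  exact (integral_sub_integral_eq_of_hasCompactSupport hD hμ hu hCE (hR R hR1).1
    (hR R hR1).2.1 hst).symm

theorem setIntegral_Ioc_unitInterval (b : I → ℝ) {s t : I} (hst : s ≤ t) :
    ∫ r in Ioc s t, b r = ∫ x in (s : ℝ)..t, b (projIcc 0 1 zero_le_one x) := by
  have h := unitInterval.measurePreserving_coe.setIntegral_preimage_emb
    unitInterval.measurableEmbedding_coe (fun x : ℝ => b (projIcc 0 1 zero_le_one x))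
    (Ioc (s : ℝ) t)
  rw [intervalIntegral.integral_of_le (show (s : ℝ) ≤ t from hst)]
  rw [Measure.restrict_restrict measurableSet_Ioc, inter_eq_left.2
    (Ioc_subset_Icc_self.trans (Icc_subset_Icc s.2.1 t.2.2))] at h
  rw [← h]
  simp only [projIcc_val]
  rfl

/-- Grönwall's inequality in integral form. -/
theorem le_mul_exp_of_le_add_integral {a : I → ℝ} (ha : Continuous a) (ha0 : ∀ t, 0 ≤ a t)
    {c K : ℝ} (hK : 0 ≤ K) (h : ∀ t, a t ≤ c + K * ∫ r in Ioc 0 t, a r) (t : I) :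
    a t ≤ c * Real.exp K := by
  have hc : 0 ≤ c := by simpa using (ha0 0).trans (h 0)
  set a' : ℝ → ℝ := fun x => a (projIcc 0 1 zero_le_one x) with ha'
  have ha'c : Continuous a' := ha.comp continuous_projIcc
  -- Grönwall in differential form is applied to this majorant, since a itself is only continuous.
  set f : ℝ → ℝ := fun x => c + K * ∫ y in (0 : ℝ)..x, a' y with hf
  have hder : ∀ x, HasDerivAt f (K * a' x) x := fun x =>
    ((ha'c.integral_hasStrictDerivAt 0 x).hasDerivAt.const_mul K).const_add c
  have haf : ∀ t : I, a t ≤ f t := fun t => by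
    have := h t
    rwa [setIntegral_Ioc_unitInterval a t.2.1] at this
  have hf0 : f 0 = c := by simp [hf]
  have hg := norm_le_gronwallBound_of_norm_deriv_right_le (f := f) (f' := fun x => K * a' x)
    (δ := c) (K := K) (ε := 0) (a := 0) (b := 1)
    (continuous_iff_continuousAt.2 fun x => (hder x).continuousAt).continuousOn
    (fun x _ => (hder x).hasDerivWithinAt) (by rw [hf0, Real.norm_of_nonneg hc])
    (fun x hx => by
      have h1 : a' x ≤ f x := by
        have := haf ⟨x, hx.1, hx.2.le⟩
        rw [ha']
        simp only
        rwa [projIcc_of_mem zero_le_one ⟨hx.1, hx.2.le⟩]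
      have h2 : 0 ≤ a' x := ha0 _
      rw [Real.norm_of_nonneg (mul_nonneg hK h2), Real.norm_of_nonneg (h2.trans h1), add_zero]
      gcongr) t t.2
  rw [gronwallBound_ε0, sub_zero] at hg
  refine (haf t).trans ((le_abs_self _).trans (hg.trans ?_))
  gcongr
  exact mul_le_of_le_one_right hK t.2.2

/-- Propagation of the integral of a function along a controlled curve. -/
theorem integral_le_mul_exp {D : Data d} (hD : D.IsAdmissible) {μ : I → P₁ d}
    (hμ : Continuous μ) {u : Space d × I → D.U} (hu : Integrable u (spaceTime μ))
    (hCE : D.ContinuityEquation μ ((spaceTime μ).withDensityᵥ u)) {f : Space d → ℝ}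
    (hf : ContDiff ℝ ∞ f) (hf0 : ∀ y, 0 ≤ f y) {b : ℝ} (hfb : ∀ x, ‖fderiv ℝ f x‖ ≤ b)
    {h w : Space d × I → ℝ} (hh : Integrable h (spaceTime μ)) (hw : Integrable w (spaceTime μ))
    (hw0 : ∀ z, 0 ≤ w z) {α c K : ℝ} (hα : 0 ≤ α) (hK : 0 ≤ K)
    (hle : ∀ z, fderiv ℝ f z.1 (velocity D μ u z) ≤ h z + w z)
    (hc : ∫ z, w z ∂spaceTime μ ≤ c)
    (hhK : ∀ r, ∫ y, h (y, r) ∂(μ r).meas ≤ α + K * ∫ y, f y ∂(μ r).meas) (t : I) :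
    ∫ y, f y ∂(μ t).meas ≤ (∫ y, f y ∂(μ 0).meas + α + c) * Real.exp K := by
  have hlip : LipschitzWith ⟨b, (norm_nonneg _).trans (hfb 0)⟩ f :=
    lipschitzWith_of_nnnorm_fderiv_le (hf.differentiable (by simp)) fun y => hfb y
  have hcont : Continuous fun t => ∫ y, f y ∂(μ t).meas :=
    (lipschitzWith_integral hlip).continuous.comp hμ
  -- The part h of the velocity estimate is controlled at each time by the quantity itself and feeds
  -- Grönwall; the part w, which comes from the control, is known only through its space-time
  -- integral c.
  refine le_mul_exp_of_le_add_integral hcont (fun t => integral_nonneg hf0) hK (fun t => ?_) t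
  have h1 := integral_sub_integral_eq hD hμ hu hCE hf hfb (s := 0) (t := t) t.2.1
  have hv := integrable_apply_of_bounded (A := fun z : Space d × I => fderiv ℝ f z.1)
    (((hf.continuous_fderiv (by simp)).comp continuous_fst).aestronglyMeasurable
      (μ := spaceTime μ)) (fun z => hfb z.1) (hD.integrable_velocity hμ hu)
  have h2 : ∫ z in slab d 0 t, fderiv ℝ f z.1 (velocity D μ u z) ∂spaceTime μ
      ≤ ∫ z in slab d 0 t, h z ∂spaceTime μ + ∫ z in slab d 0 t, w z ∂spaceTime μ := by
    rw [← integral_add hh.restrict hw.restrict]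
    exact integral_mono hv.restrict (hh.add hw).restrict hle
  have h3 : ∫ z in slab d 0 t, w z ∂spaceTime μ ≤ c :=
    (setIntegral_le_integral hw (Eventually.of_forall hw0)).trans hc
  have h4 : ∫ z in slab d 0 t, h z ∂spaceTime μ
      ≤ α + K * ∫ r in Ioc 0 t, ∫ y, f y ∂(μ r).meas := by
    rw [setIntegral_slab hμ hh]
    have hfi : Integrable (fun r => ∫ y, f y ∂(μ r).meas) (volume : Measure I) :=
      hcont.integrable_of_hasCompactSupport (HasCompactSupport.of_compactSpace _)
    have hfi' : Integrable (fun r => K * ∫ y, f y ∂(μ r).meas) (volume.restrict (Ioc 0 t)) :=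
      (hfi.const_mul K).restrict
    calc ∫ r in Ioc 0 t, ∫ y, h (y, r) ∂(μ r).meas
        ≤ ∫ r in Ioc 0 t, (α + K * ∫ y, f y ∂(μ r).meas) :=
          integral_mono (integrable_integral_spaceTime hμ hh).restrict
            ((integrable_const α).add hfi') hhK
      _ = volume.real (Ioc 0 t) * α + K * ∫ r in Ioc 0 t, ∫ y, f y ∂(μ r).meas := by
          rw [integral_add (integrable_const α) hfi', integral_const_mul]
          simp
      _ ≤ α + K * ∫ r in Ioc 0 t, ∫ y, f y ∂(μ r).meas := by
          gcongr
          exact mul_le_of_le_one_left hα measureReal_le_one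
  linarith

/-- The metric speed of a controlled curve is bounded by the norm of its velocity. -/
theorem exists_W₁_le_integral_norm_velocity (d : ℕ) : ∃ A : ℝ, 1 ≤ A ∧
    ∀ (D : Data d) (μ : I → P₁ d) (u : Space d × I → D.U), D.IsAdmissible → Continuous μ →
      Integrable u (spaceTime μ) → D.ContinuityEquation μ ((spaceTime μ).withDensityᵥ u) →
      ∀ s t : I, s ≤ t → W₁ (μ s) (μ t)
        ≤ ENNReal.ofReal (A * ∫ z in slab d s t, ‖velocity D μ u z‖ ∂spaceTime μ) := by
  obtain ⟨A, hA, h⟩ := exists_W₁_le_of_forall_smooth d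
  refine ⟨A, hA, fun D μ u hD hμ hu hCE s t hst => ?_⟩
  rw [W₁_comm]
  refine h _ _ _ fun f hf _ hfb => ?_
  have hv := hD.integrable_velocity hμ hu
  rw [integral_sub_integral_eq hD hμ hu hCE hf hfb hst]
  have hi := integrable_apply_of_bounded (A := fun z : Space d × I => fderiv ℝ f z.1)
    (((hf.continuous_fderiv (by simp)).comp continuous_fst).aestronglyMeasurable
      (μ := spaceTime μ)) (fun z => hfb z.1) hv
  refine integral_mono hi.restrict hv.norm.restrict fun z => ?_
  refine (le_abs_self _).trans (((fderiv ℝ f z.1).le_opNorm _).trans ?_)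
  exact mul_le_of_le_one_left (norm_nonneg _) (hfb _)

/-! ### Compactness of controlled curves -/

/-- A family of controlled curves with the same initial datum and uniformly integrable controls. -/
structure IsControlledFamily (D : Data d) {N : Type*} (μ : N → I → P₁ d)
    (u : N → Space d × I → D.U) : Prop where
  continuous : ∀ n, Continuous (μ n)
  integrable : ∀ n, Integrable (u n) (spaceTime (μ n))
  equation : ∀ n, D.ContinuityEquation (μ n) ((spaceTime (μ n)).withDensityᵥ (u n))
  initial : ∀ n, μ n 0 = D.m₀
  uniform : ∀ η : ℝ, 0 < η → ∃ A : ℝ, 0 ≤ A ∧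
    ∀ n, ∫ z, max (‖u n z‖ - A) 0 ∂spaceTime (μ n) ≤ η

theorem integrable_max_sub {X E : Type*} [MeasurableSpace X] [NormedAddCommGroup E] {m : Measure X}
    [IsFiniteMeasure m] {u : X → E} (hu : Integrable u m) (A : ℝ) :
    Integrable (fun x => max (‖u x‖ - A) 0) m :=
  (hu.norm.sub (integrable_const A)).pos_part

namespace IsControlledFamily

variable {D : Data d} {N : Type*} {μ : N → I → P₁ d} {u : N → Space d × I → D.U}

/-- Grönwall for `excess 1`, a smooth substitute for |y|. The drift bound C + C'(|y| + ∫|z| dμ)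
integrates to C + 2C' ∫|y| dμ, whence the rate 2C'; a uniform L¹ bound on the controls enters as a
source term. -/
theorem exists_integral_norm_le (h : IsControlledFamily D μ u) (hD : D.IsAdmissible) :
    ∃ M : ℝ, 0 ≤ M ∧ ∀ n t, ∫ y, ‖y‖ ∂(μ n t).meas ≤ M := by
  obtain ⟨C, C', hC, hC', hF⟩ := hD.field_growth
  obtain ⟨A, hA, hAu⟩ := h.uniform 1 one_pos
  set M := (∫ y, excess 1 y ∂D.m₀.meas + (C + 2 * C') + (A + 1)) * Real.exp (2 * C') with hM
  have hE : 0 ≤ ∫ y, excess 1 y ∂D.m₀.meas := integral_nonneg fun y => excess_nonneg y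
  have hM0 : 0 ≤ M := by positivity
  have hmom : ∀ n t, ∫ y, ‖y‖ ∂(μ n t).meas ≤ 1 + ∫ y, excess 1 y ∂(μ n t).meas := by
    intro n t
    have hi : Integrable (fun y : Space d => 1 + excess 1 y) (μ n t).meas :=
      (integrable_const 1).add (integrable_excess _ one_pos)
    calc ∫ y, ‖y‖ ∂(μ n t).meas ≤ ∫ y, (1 + excess 1 y) ∂(μ n t).meas :=
          integral_mono (μ n t).integrable_norm hi fun y => by
            have := norm_sub_le_excess 1 y; simp only; linarith
      _ = 1 + ∫ y, excess 1 y ∂(μ n t).meas := by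
          rw [integral_add (integrable_const 1) (integrable_excess _ one_pos)]; simp
  refine ⟨1 + M, by positivity, fun n t => (hmom n t).trans ?_⟩
  gcongr
  have := isProbabilityMeasure_spaceTime (h.continuous n)
  have hmomi : Integrable (fun z : Space d × I => ∫ y, ‖y‖ ∂(μ n z.2).meas) (spaceTime (μ n)) := by
    have hc := (continuous_integral_norm (h.continuous n)).comp (continuous_snd (X := Space d))
    obtain ⟨B, hB⟩ := (isCompact_range (continuous_integral_norm (h.continuous n))).bddAbove
    refine Integrable.of_bound hc.aestronglyMeasurable B (Eventually.of_forall fun z => ?_)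
    rw [Real.norm_of_nonneg (integral_nonneg fun y => norm_nonneg _)]
    exact hB ⟨z.2, rfl⟩
  rw [hM, ← h.initial n]
  refine integral_le_mul_exp hD (h.continuous n) (h.integrable n) (h.equation n)
    (contDiff_excess one_pos) excess_nonneg (norm_fderiv_excess_le_one one_pos)
    (h := fun z => C + C' * (‖z.1‖ + ∫ y, ‖y‖ ∂(μ n z.2).meas)) (w := fun z => ‖u n z‖)
    ((integrable_const C).add (((integrable_spaceTime_norm (h.continuous n)).add hmomi).const_mul _))
    (h.integrable n).norm (fun z => norm_nonneg _) (by positivity) (by positivity)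
    (fun z => ?_) ?_ (fun r => ?_) t
  · refine (Real.le_norm_self _).trans ((ContinuousLinearMap.le_opNorm _ _).trans ?_)
    calc _ ≤ 1 * ‖velocity D (μ n) (u n) z‖ := by
          gcongr; exact norm_fderiv_excess_le_one one_pos _
      _ ≤ _ := by
          rw [one_mul]
          exact (norm_add_le _ _).trans (add_le_add (hF _ _) le_rfl)
  · calc ∫ z, ‖u n z‖ ∂spaceTime (μ n) ≤ ∫ z, (A + max (‖u n z‖ - A) 0) ∂spaceTime (μ n) :=
          integral_mono (h.integrable n).norm
            ((integrable_const A).add (integrable_max_sub (h.integrable n) A)) fun z => by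
              have := le_max_left (‖u n z‖ - A) 0; simp only; linarith
      _ = A + ∫ z, max (‖u n z‖ - A) 0 ∂spaceTime (μ n) := by
          rw [integral_add (integrable_const A) (integrable_max_sub (h.integrable n) A)]; simp
      _ ≤ A + 1 := by gcongr; exact hAu n
  · have hi : Integrable (fun y : Space d => C' * (‖y‖ + ∫ y, ‖y‖ ∂(μ n r).meas)) (μ n r).meas :=
      ((μ n r).integrable_norm.add (integrable_const _)).const_mul _
    simp only
    rw [integral_add (integrable_const C) hi, integral_const_mul,
      integral_add (μ n r).integrable_norm (integrable_const _)]
    simp only [integral_const, probReal_univ, one_smul]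
    have := mul_le_mul_of_nonneg_left (hmom n r) hC'
    linarith

/-- The control is split at a level A. The part above A has small integral by uniform integrability;
the part below A is bounded and meets the gradient bound |y|/R. What remains is the drift, absorbed
at the fixed rate 2C'. -/
theorem exists_integral_excess_le (h : IsControlledFamily D μ u) (hD : D.IsAdmissible) {η : ℝ}
    (hη : 0 < η) : ∃ R₀ : ℝ, 0 < R₀ ∧ ∀ R, R₀ ≤ R → ∀ n t,
      ∫ y, excess R y ∂(μ n t).meas ≤ η := by
  obtain ⟨C, C', hC, hC', hF⟩ := hD.field_growth
  obtain ⟨M, hM, hmom⟩ := h.exists_integral_norm_le hD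
  set e := Real.exp (2 * C') with he
  have he0 : 0 < e := Real.exp_pos _
  -- Three contributions, each amplified by e: the tail of the initial datum, the bounded part of
  -- the velocity and the large controls.
  obtain ⟨A, hA, hAu⟩ := h.uniform (η / (3 * e)) (by positivity)
  set B := C + C' * M + A with hB
  have hB0 : 0 ≤ B := by positivity
  have hlim : Tendsto (fun R : ℝ => B * (M / R)) atTop (𝓝 0) := by
    simpa using (tendsto_const_nhds.div_atTop tendsto_id).const_mul B
  have hη3 : 0 < η / (3 * e) := by positivity
  obtain ⟨R₁, hR₁⟩ := eventually_atTop.1 (((tendsto_integral_excess D.m₀).eventually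
    (ge_mem_nhds hη3)).and (hlim.eventually (ge_mem_nhds hη3)))
  refine ⟨max R₁ 1, by positivity, fun R hR n t => ?_⟩
  have hR0 : 0 < R := one_pos.trans_le ((le_max_right _ _).trans hR)
  have := isProbabilityMeasure_spaceTime (h.continuous n)
  obtain ⟨h1, h2⟩ := hR₁ R ((le_max_left _ _).trans hR)
  have hexi : Integrable (fun z : Space d × I => excess R z.1) (spaceTime (μ n)) := by
    refine (integrable_spaceTime_norm (h.continuous n)).mono'
      ((contDiff_excess hR0).continuous.comp continuous_fst).aestronglyMeasurable
      (Eventually.of_forall fun z => ?_)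
    rw [Real.norm_of_nonneg (excess_nonneg _)]
    exact excess_le_norm hR0.le _
  have key := integral_le_mul_exp hD (h.continuous n) (h.integrable n) (h.equation n)
    (contDiff_excess hR0) excess_nonneg (norm_fderiv_excess_le_one hR0)
    (h := fun z => B * (‖z.1‖ / R) + 2 * C' * excess R z.1)
    (w := fun z => max (‖u n z‖ - A) 0) (α := B * (M / R)) (c := η / (3 * e)) (K := 2 * C')
    ((((integrable_spaceTime_norm (h.continuous n)).div_const R).const_mul B).add
      (hexi.const_mul _))
    (integrable_max_sub (h.integrable n) A) (fun z => le_max_right _ _) (by positivity)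
    (by positivity) (fun z => ?_) (hAu n) (fun r => ?_) t
  · rw [h.initial n] at key
    calc _ ≤ _ := key
      _ ≤ (η / (3 * e) + η / (3 * e) + η / (3 * e)) * e := by gcongr
      _ = η := by field_simp; ring
  · refine (Real.le_norm_self _).trans ((ContinuousLinearMap.le_opNorm _ _).trans ?_)
    set q := ‖fderiv ℝ (excess R) z.1‖ with hq
    have q0 : 0 ≤ q := norm_nonneg _
    have q1 : q ≤ 1 := norm_fderiv_excess_le_one hR0 _
    have q2 : q ≤ ‖z.1‖ / R := norm_fderiv_excess_le_div hR0 _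
    have q3 : q * ‖z.1‖ ≤ 2 * excess R z.1 := norm_fderiv_excess_mul_norm_le hR0 _
    have hv : ‖velocity D (μ n) (u n) z‖ ≤ B + C' * ‖z.1‖ + max (‖u n z‖ - A) 0 := by
      have v1 : ‖velocity D (μ n) (u n) z‖ ≤ ‖D.F z.1 (μ n z.2)‖ + ‖u n z‖ := norm_add_le _ _
      have v2 := hF z.1 (μ n z.2)
      have v3 := mul_le_mul_of_nonneg_left (hmom n z.2) hC'
      have v4 := le_max_left (‖u n z‖ - A) 0
      rw [hB]
      linarith
    have hm0 : 0 ≤ max (‖u n z‖ - A) 0 := le_max_right _ _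
    calc q * ‖velocity D (μ n) (u n) z‖ ≤ q * (B + C' * ‖z.1‖ + max (‖u n z‖ - A) 0) := by gcongr
      _ = B * q + C' * (q * ‖z.1‖) + q * max (‖u n z‖ - A) 0 := by ring
      _ ≤ B * (‖z.1‖ / R) + C' * (2 * excess R z.1) + 1 * max (‖u n z‖ - A) 0 := by gcongr
      _ = _ := by ring
  · have i1 : Integrable (fun y : Space d => B * (‖y‖ / R)) (μ n r).meas :=
      ((μ n r).integrable_norm.div_const R).const_mul B
    have i2 : Integrable (fun y : Space d => 2 * C' * excess R y) (μ n r).meas :=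
      (integrable_excess _ hR0).const_mul _
    simp only
    rw [integral_add i1 i2, integral_const_mul, integral_const_mul, integral_div]
    gcongr
    exact hmom n r

/-- The same splitting applied to the speed: drift and moderate controls contribute at most V |t -
s|, and large controls a small amount however short the interval. -/
theorem exists_dist_le (h : IsControlledFamily D μ u) (hD : D.IsAdmissible) {η : ℝ}
    (hη : 0 < η) : ∃ r : ℝ, 0 < r ∧ ∀ n (s t : I), dist s t < r → dist (μ n s) (μ n t) ≤ η := by
  obtain ⟨C, C', hC, hC', hF⟩ := hD.field_growth
  obtain ⟨M, hM, hmom⟩ := h.exists_integral_norm_le hD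
  obtain ⟨B, hB, hW⟩ := exists_W₁_le_integral_norm_velocity d
  have hB0 : 0 < B := one_pos.trans_le hB
  obtain ⟨A, hA, hAu⟩ := h.uniform (η / (2 * B)) (by positivity)
  set V := C + 2 * C' * M + A with hV
  have hV0 : 0 ≤ V := by positivity
  refine ⟨η / (2 * B * (V + 1)), by positivity, ?_⟩
  have key : ∀ n (s t : I), s ≤ t → dist s t < η / (2 * B * (V + 1)) →
      dist (μ n s) (μ n t) ≤ η := by
    intro n s t hst hd
    have := isProbabilityMeasure_spaceTime (h.continuous n)
    have hv := hD.integrable_velocity (h.continuous n) (h.integrable n)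
    have hni := integrable_spaceTime_norm (h.continuous n)
    have hmi := integrable_max_sub (h.integrable n) A
    have hki : Integrable (fun z : Space d × I => C + C' * M + A + C' * ‖z.1‖) (spaceTime (μ n)) :=
      (integrable_const _).add (hni.const_mul C')
    have h1 : ∫ z in slab d s t, ‖velocity D (μ n) (u n) z‖ ∂spaceTime (μ n)
        ≤ V * dist s t + η / (2 * B) := by
      have e1 : ∫ z in slab d s t, ‖velocity D (μ n) (u n) z‖ ∂spaceTime (μ n)
          ≤ ∫ z in slab d s t, (C + C' * M + A + C' * ‖z.1‖ + max (‖u n z‖ - A) 0)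
            ∂spaceTime (μ n) := by
        refine integral_mono hv.norm.restrict (hki.add hmi).restrict fun z => ?_
        have v1 : ‖velocity D (μ n) (u n) z‖ ≤ ‖D.F z.1 (μ n z.2)‖ + ‖u n z‖ := norm_add_le _ _
        have v2 := hF z.1 (μ n z.2)
        have v3 := mul_le_mul_of_nonneg_left (hmom n z.2) hC'
        have v4 := le_max_left (‖u n z‖ - A) 0
        simp only
        linarith
      have e2 : ∫ z in slab d s t, max (‖u n z‖ - A) 0 ∂spaceTime (μ n) ≤ η / (2 * B) :=
        (setIntegral_le_integral hmi (Eventually.of_forall fun z => le_max_right _ _)).trans (hAu n)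
      have e3 : ∫ z in slab d s t, (C + C' * M + A + C' * ‖z.1‖) ∂spaceTime (μ n)
          ≤ V * dist s t := by
        have hle : ∀ r, ∫ y, (C + C' * M + A + C' * ‖y‖) ∂(μ n r).meas ≤ V := fun r => by
          rw [integral_add (integrable_const _) ((μ n r).integrable_norm.const_mul C'),
            integral_const_mul]
          have := mul_le_mul_of_nonneg_left (hmom n r) hC'
          simp only [integral_const, probReal_univ, one_smul, hV]
          linarith
        rw [setIntegral_slab (h.continuous n) hki]
        calc _ ≤ ∫ r in Ioc s t, V := integral_mono
              (integrable_integral_spaceTime (h.continuous n) hki).restrict (integrable_const V) hle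
          _ = V * dist s t := by
              rw [setIntegral_const, smul_eq_mul, mul_comm, Measure.real, unitInterval.volume_Ioc,
                ENNReal.toReal_ofReal (sub_nonneg.2 (Subtype.coe_le_coe.2 hst)), dist_comm, Subtype.dist_eq, Real.dist_eq,
                abs_of_nonneg (sub_nonneg.2 (Subtype.coe_le_coe.2 hst))]
      rw [integral_add hki.restrict hmi.restrict] at e1
      linarith
    have h2 := hW D (μ n) (u n) hD (h.continuous n) (h.integrable n) (h.equation n) s t hst
    rw [← edist_eq_W₁, edist_dist, ENNReal.ofReal_le_ofReal_iff (mul_nonneg hB0.le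
      (integral_nonneg fun z => norm_nonneg _))] at h2
    rw [lt_div_iff₀ (by positivity)] at hd
    have h3 := mul_le_mul_of_nonneg_left h1 hB0.le
    have h4 : B * (V * dist s t + η / (2 * B)) = B * V * dist s t + η / 2 := by
      field_simp
    have h5 : 0 ≤ B * dist s t := by positivity
    nlinarith
  intro n s t hd
  rcases le_total s t with hst | hst
  · exact key n s t hst hd
  · rw [dist_comm]
    exact key n t s hst (by rwa [dist_comm])

/-- Compactness of sequences of controlled curves. -/
theorem exists_tendsto_subseq {μ : ℕ → I → P₁ d} {u : ℕ → Space d × I → D.U}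
    (h : IsControlledFamily D μ u) (hD : D.IsAdmissible) :
    ∃ (ν : I → P₁ d) (ι : ℕ → ℕ), Continuous ν ∧ StrictMono ι ∧
      CurveTendsto (fun n => μ (ι n)) ν := by
  -- The worst tail over all curves and times tends to 0 and defines one compact subset of P₁
  -- containing every value, as Arzelà–Ascoli requires.
  set ζ : ℕ → ℝ := fun k => ⨆ p : ℕ × I, ∫ y, excess (k + 1 : ℝ) y ∂(μ p.1 p.2).meas with hζ
  obtain ⟨M, hM, hmom⟩ := h.exists_integral_norm_le hD
  have hbdd : ∀ k : ℕ, BddAbove (range fun p : ℕ × I =>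
      ∫ y, excess (k + 1 : ℝ) y ∂(μ p.1 p.2).meas) := by
    rintro k
    refine ⟨M, ?_⟩
    rintro _ ⟨p, rfl⟩
    exact (integral_mono (integrable_excess _ (by positivity)) (μ p.1 p.2).integrable_norm
      fun y => excess_le_norm (by positivity) y).trans (hmom _ _)
  have hζ0 : Tendsto ζ atTop (𝓝 0) := by
    refine Metric.tendsto_atTop.2 fun η hη => ?_
    obtain ⟨R, hR, hRη⟩ := h.exists_integral_excess_le hD (half_pos hη)
    refine ⟨⌈R⌉₊, fun k hk => ?_⟩
    have h1 : ζ k ≤ η / 2 := ciSup_le fun p => hRη _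
      ((Nat.le_ceil R).trans ((Nat.cast_le.2 hk).trans (by linarith))) _ _
    have h2 : 0 ≤ ζ k := Real.iSup_nonneg fun p => integral_nonneg fun y => excess_nonneg y
    rw [Real.dist_eq, sub_zero, abs_of_nonneg h2]
    linarith
  let f : ℕ → BoundedContinuousFunction I (P₁ d) := fun n =>
    BoundedContinuousFunction.mkOfCompact ⟨μ n, h.continuous n⟩
  have hcpt : IsCompact (closure (range f)) := by
    refine BoundedContinuousFunction.arzela_ascoli _ (isCompact_setOf_integral_excess_le hζ0) _ ?_ ?_
    · rintro _ t ⟨n, rfl⟩ k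
      exact le_ciSup (hbdd k) (n, t)
    · refine UniformEquicontinuous.equicontinuous (Metric.uniformEquicontinuous_iff.2 fun η hη => ?_)
      obtain ⟨r, hr, hrη⟩ := h.exists_dist_le hD (half_pos hη)
      refine ⟨r, hr, ?_⟩
      rintro s t hst ⟨_, n, rfl⟩
      exact (hrη n s t hst).trans_lt (half_lt_self hη)
  obtain ⟨g, -, ι, hι, hlim⟩ := hcpt.tendsto_subseq (x := f) fun n => subset_closure ⟨n, rfl⟩
  refine ⟨g, ι, g.continuous, hι, ?_⟩
  refine tendsto_of_tendsto_of_tendsto_of_le_of_le tendsto_const_nhds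
    (tendsto_iff_edist_tendsto_0.1 hlim) (fun n => zero_le) fun n => ?_
  exact (BoundedContinuousFunction.edist_eq_iSup (f := f (ι n)) (g := g)).ge

end IsControlledFamily

end MeanFieldControl

namespace MeanFieldControl

/-! ### Young measures and their barycenters -/

section Barycenter

variable {X V : Type*} [MeasurableSpace X] [NormedAddCommGroup V] [NormedSpace ℝ V]
  [FiniteDimensional ℝ V] [MeasurableSpace V] [BorelSpace V]

/-- A measure on a product with integrable second coordinate has a barycentric projection, which
satisfies Jensen's inequality. -/
theorem exists_barycenter (ρ : Measure (X × V)) [IsProbabilityMeasure ρ]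
    (hρ : Integrable (fun p : X × V => p.2) ρ) :
    ∃ v : X → V, Measurable v ∧ Integrable v ρ.fst ∧
      (∀ f : X → V →L[ℝ] ℝ, StronglyMeasurable f → (∃ C, ∀ z, ‖f z‖ ≤ C) →
        ∫ z, f z (v z) ∂ρ.fst = ∫ p, f p.1 p.2 ∂ρ) ∧
      ∀ ψ : V → ℝ, ConvexOn ℝ univ ψ → (∀ w, 0 ≤ ψ w) →
        ∫⁻ z, ENNReal.ofReal (ψ (v z)) ∂ρ.fst ≤ ∫⁻ p, ENNReal.ofReal (ψ p.2) ∂ρ := by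
  have := FiniteDimensional.proper ℝ V
  have hsm : StronglyMeasurable fun z => ∫ w, w ∂ρ.condKernel z :=
    StronglyMeasurable.integral_kernel_prod_right (f := fun _ w => w)
      measurable_snd.stronglyMeasurable
  have hslice : ∀ᵐ z ∂ρ.fst, Integrable (fun w : V => w) (ρ.condKernel z) := hρ.condKernel_ae
  -- The barycenter is the mean of the conditional law of the second coordinate; the inequality is
  -- Jensen's, fibre by fibre, and is trivial on fibres of infinite cost.
  refine ⟨fun z => ∫ w, w ∂ρ.condKernel z, hsm.measurable, hρ.integral_condKernel, ?_, ?_⟩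
  · rintro f hf ⟨C, hC⟩
    have hi : Integrable (fun p : X × V => f p.1 p.2) ρ :=
      integrable_pairing_of_bounded (f := fun p : X × V => f p.1) ρ hρ
        (ContinuousLinearMap.id ℝ (V →L[ℝ] ℝ))
        (hf.comp_measurable measurable_fst).aestronglyMeasurable fun p => hC p.1
    rw [← Measure.integral_condKernel hi]
    refine integral_congr_ae ?_
    filter_upwards [hslice] with z hz
    exact ((f z).integral_comp_comm hz).symm
  · intro ψ hψ hψ0
    have hψc : Continuous ψ := continuousOn_univ.1 (hψ.continuousOn isOpen_univ)
    have hm : Measurable fun p : X × V => ENNReal.ofReal (ψ p.2) :=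
      (hψc.measurable.comp measurable_snd).ennreal_ofReal
    rw [← Measure.lintegral_condKernel hm]
    refine lintegral_mono_ae ?_
    filter_upwards [hslice] with z hz
    by_cases htop : ∫⁻ w, ENNReal.ofReal (ψ w) ∂ρ.condKernel z = ⊤
    · simp only [htop, le_top]
    · have hψi : Integrable ψ (ρ.condKernel z) := by
        refine ⟨hψc.aestronglyMeasurable, ?_⟩
        rw [hasFiniteIntegral_iff_ofReal (Eventually.of_forall hψ0)]
        exact lt_top_iff_ne_top.2 htop
      rw [← ofReal_integral_eq_lintegral_ofReal hψi (Eventually.of_forall hψ0)]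
      exact ENNReal.ofReal_le_ofReal (hψ.map_integral_le hψc.continuousOn isClosed_univ
        (Eventually.of_forall fun _ => mem_univ _) hz hψi)

end Barycenter

section Clip

variable {V : Type*} [NormedAddCommGroup V] [NormedSpace ℝ V]

/-- The radial truncation at level `A`. -/
noncomputable def clip (A : ℝ) (v : V) : V := (A / max A ‖v‖) • v

theorem continuous_clip {A : ℝ} (hA : 0 < A) : Continuous (clip A : V → V) := by
  unfold clip
  refine Continuous.smul (continuous_const.div (by fun_prop) fun v => ?_) continuous_id
  exact (hA.trans_le (le_max_left _ _)).ne'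

theorem norm_clip_le {A : ℝ} (hA : 0 < A) (v : V) : ‖clip A v‖ ≤ A := by
  have h : 0 < max A ‖v‖ := hA.trans_le (le_max_left _ _)
  rw [clip, norm_smul, Real.norm_of_nonneg (by positivity), div_mul_eq_mul_div, div_le_iff₀ h]
  gcongr
  exact le_max_right _ _

theorem norm_sub_clip_le {A : ℝ} (hA : 0 < A) (v : V) : ‖v - clip A v‖ ≤ max (‖v‖ - A) 0 := by
  have h : 0 < max A ‖v‖ := hA.trans_le (le_max_left _ _)
  have h1 : v - clip A v = (1 - A / max A ‖v‖) • v := by rw [clip, sub_smul, one_smul]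
  have h2 : 0 ≤ 1 - A / max A ‖v‖ := sub_nonneg.2 (div_le_one_of_le₀ (le_max_left _ _) h.le)
  rw [h1, norm_smul, Real.norm_of_nonneg h2]
  rcases le_total ‖v‖ A with hv | hv
  · rw [max_eq_left hv, div_self hA.ne', sub_self, zero_mul]
    exact le_max_right _ _
  · rw [max_eq_right hv, sub_mul, one_mul, div_mul_cancel₀]
    · exact le_max_left _ _
    · exact (hA.trans_le hv).ne'

end Clip

theorem integral_norm_le_of_integral_max_sub_le {X V : Type*} [MeasurableSpace X]
    [NormedAddCommGroup V] {m : Measure X} [IsProbabilityMeasure m] {u : X → V}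
    (hu : Integrable u m) {A η : ℝ} (h : ∫ x, max (‖u x‖ - A) 0 ∂m ≤ η) :
    ∫ x, ‖u x‖ ∂m ≤ A + η :=
  calc ∫ x, ‖u x‖ ∂m ≤ ∫ x, (A + max (‖u x‖ - A) 0) ∂m :=
        integral_mono hu.norm ((integrable_const A).add (integrable_max_sub hu A)) fun x => by
          have := le_max_left (‖u x‖ - A) 0; simp only; linarith
    _ = A + ∫ x, max (‖u x‖ - A) 0 ∂m := by
        rw [integral_add (integrable_const A) (integrable_max_sub hu A)]; simp
    _ ≤ A + η := by gcongr

section GraphLaw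

variable {X V : Type*} [MeasurableSpace X] [MeasurableSpace V]

/-- The law of the graph of a measurable function. -/
noncomputable def graphLaw (m : ProbabilityMeasure X) {u : X → V} (hu : Measurable u) :
    ProbabilityMeasure (X × V) := m.map (measurable_id.prodMk hu).aemeasurable

theorem integral_graphLaw (m : ProbabilityMeasure X) {u : X → V} (hu : Measurable u)
    {f : X × V → ℝ} (hf : StronglyMeasurable f) :
    ∫ p, f p ∂(graphLaw m hu : Measure (X × V)) = ∫ z, f (z, u z) ∂(m : Measure X) :=
  integral_map (measurable_id.prodMk hu).aemeasurable hf.aestronglyMeasurable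

theorem lintegral_graphLaw (m : ProbabilityMeasure X) {u : X → V} (hu : Measurable u)
    {f : X × V → ℝ≥0∞} (hf : Measurable f) :
    ∫⁻ p, f p ∂(graphLaw m hu : Measure (X × V)) = ∫⁻ z, f (z, u z) ∂(m : Measure X) :=
  lintegral_map hf (measurable_id.prodMk hu)

end GraphLaw

theorem lintegral_ofReal_le_of_tendsto {Ω : Type*} [TopologicalSpace Ω] [MeasurableSpace Ω]
    [OpensMeasurableSpace Ω] [HasOuterApproxClosed Ω] {ρs : ℕ → ProbabilityMeasure Ω}
    {ρ : ProbabilityMeasure Ω} (h : Tendsto ρs atTop (𝓝 ρ)) {f : Ω → ℝ} (hf : Continuous f)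
    (hf0 : ∀ x, 0 ≤ f x) (hfi : ∀ n, Integrable f (ρs n : Measure Ω)) {c : ℝ}
    (hc : ∀ n, ∫ x, f x ∂(ρs n : Measure Ω) ≤ c) :
    Integrable f (ρ : Measure Ω) ∧ ∫ x, f x ∂(ρ : Measure Ω) ≤ c := by
  have h1 : ∫⁻ x, ENNReal.ofReal (f x) ∂(ρ : Measure Ω) ≤ ENNReal.ofReal c := by
    refine (lintegral_le_liminf_of_lowerSemicontinuous h
      (ENNReal.continuous_ofReal.comp hf).lowerSemicontinuous).trans ?_
    refine liminf_le_of_frequently_le' (Eventually.of_forall fun n => ?_).frequently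
    simp only [Function.comp_apply]
    rw [← ofReal_integral_eq_lintegral_ofReal (hfi n) (Eventually.of_forall hf0)]
    exact ENNReal.ofReal_le_ofReal (hc n)
  have hi : Integrable f (ρ : Measure Ω) := by
    refine ⟨hf.measurable.aestronglyMeasurable, ?_⟩
    rw [hasFiniteIntegral_iff_ofReal (Eventually.of_forall hf0)]
    exact h1.trans_lt ENNReal.ofReal_lt_top
  refine ⟨hi, ?_⟩
  rw [← ofReal_integral_eq_lintegral_ofReal hi (Eventually.of_forall hf0)] at h1
  exact (ENNReal.ofReal_le_ofReal_iff ((integral_nonneg hf0).trans (hc 0))).1 h1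

/-- Convergence of the integrals of functions that are linear in the second variable, under uniform
integrability. -/
theorem tendsto_integral_apply_of_uniform {X V : Type*} [MetricSpace X] [MeasurableSpace X]
    [BorelSpace X] [NormedAddCommGroup V] [NormedSpace ℝ V] [FiniteDimensional ℝ V]
    [MeasurableSpace V] [BorelSpace V] {ρs : ℕ → ProbabilityMeasure (X × V)}
    {ρ : ProbabilityMeasure (X × V)} (h : Tendsto ρs atTop (𝓝 ρ))
    (hi : ∀ n, Integrable (fun p : X × V => p.2) (ρs n : Measure (X × V)))
    (hη : ∀ η : ℝ, 0 < η → ∃ A : ℝ, 0 ≤ A ∧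
      ∀ n, ∫ p, max (‖p.2‖ - A) 0 ∂(ρs n : Measure (X × V)) ≤ η)
    (hρ : Integrable (fun p : X × V => p.2) (ρ : Measure (X × V)))
    (f : BoundedContinuousFunction X (V →L[ℝ] ℝ)) :
    Tendsto (fun n => ∫ p, f p.1 p.2 ∂(ρs n : Measure (X × V))) atTop
      (𝓝 (∫ p, f p.1 p.2 ∂(ρ : Measure (X × V)))) := by
  have := FiniteDimensional.proper ℝ V
  refine Metric.tendsto_atTop.2 fun ε hε => ?_
  obtain ⟨A₀, hA₀, hA₀u⟩ := hη (ε / (4 * (‖f‖ + 1))) (by positivity)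
  -- The shift makes the truncation level positive. Replacing w by `clip A w` gives a bounded
  -- continuous integrand, with an error of at most ε/4 along the sequence and also at the limit.
  set A := A₀ + 1 with hAdef
  have hA : 0 < A := by positivity
  have hmono : ∀ w : V, max (‖w‖ - A) 0 ≤ max (‖w‖ - A₀) 0 := fun w =>
    max_le_max (by rw [hAdef]; linarith) le_rfl
  have hAu : ∀ n, ∫ p, max (‖p.2‖ - A) 0 ∂(ρs n : Measure (X × V)) ≤ ε / (4 * (‖f‖ + 1)) :=
    fun n => (integral_mono (integrable_max_sub (hi n) A) (integrable_max_sub (hi n) A₀)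
      fun p => hmono p.2).trans (hA₀u n)
  have hAu' := (lintegral_ofReal_le_of_tendsto h (f := fun p : X × V => max (‖p.2‖ - A) 0)
    (by fun_prop) (fun _ => le_max_right _ _) (fun n => integrable_max_sub (hi n) A) hAu).2
  have hcl : Continuous fun p : X × V => f p.1 (clip A p.2) :=
    (f.continuous.comp continuous_fst).clm_apply ((continuous_clip hA).comp continuous_snd)
  have hclb : ∀ p : X × V, ‖f p.1 (clip A p.2)‖ ≤ ‖f‖ * A := fun p =>
    (ContinuousLinearMap.le_opNorm _ _).trans (mul_le_mul (f.norm_coe_le_norm _)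
      (norm_clip_le hA _) (norm_nonneg _) (norm_nonneg f))
  let g : BoundedContinuousFunction (X × V) ℝ :=
    BoundedContinuousFunction.ofNormedAddCommGroup _ hcl _ hclb
  have hg := (ProbabilityMeasure.tendsto_iff_forall_integral_tendsto.1 h) g
  have hfi : ∀ τ : ProbabilityMeasure (X × V),
      Integrable (fun p : X × V => p.2) (τ : Measure (X × V)) →
      Integrable (fun p : X × V => f p.1 p.2) (τ : Measure (X × V)) := fun τ hτ =>
    integrable_apply_of_bounded (A := fun p : X × V => f p.1)
      (f.continuous.comp continuous_fst).aestronglyMeasurable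
      (fun p => f.norm_coe_le_norm _) hτ
  have hclose : ∀ τ : ProbabilityMeasure (X × V),
      Integrable (fun p : X × V => p.2) (τ : Measure (X × V)) →
      ∫ p, max (‖p.2‖ - A) 0 ∂(τ : Measure (X × V)) ≤ ε / (4 * (‖f‖ + 1)) →
      |∫ p, f p.1 p.2 ∂(τ : Measure (X × V)) - ∫ p, g p ∂(τ : Measure (X × V))| ≤ ε / 4 := by
    intro τ hτ hτA
    rw [← integral_sub (hfi τ hτ) (g.integrable _)]
    have hle : ∀ p : X × V, ‖f p.1 p.2 - g p‖ ≤ ‖f‖ * max (‖p.2‖ - A) 0 := fun p => by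
      show ‖f p.1 p.2 - f p.1 (clip A p.2)‖ ≤ _
      rw [← map_sub]
      exact (ContinuousLinearMap.le_opNorm _ _).trans (mul_le_mul (f.norm_coe_le_norm _)
        (norm_sub_clip_le hA _) (norm_nonneg _) (norm_nonneg f))
    refine (norm_integral_le_of_norm_le (f := fun p : X × V => f p.1 p.2 - g p)
      ((integrable_max_sub hτ A).const_mul ‖f‖) (Eventually.of_forall hle)).trans ?_
    rw [integral_const_mul]
    have h0 : 0 ≤ ∫ p, max (‖p.2‖ - A) 0 ∂(τ : Measure (X × V)) :=
      integral_nonneg fun p => le_max_right (‖p.2‖ - A) 0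
    calc ‖f‖ * ∫ p, max (‖p.2‖ - A) 0 ∂(τ : Measure (X × V))
        ≤ (‖f‖ + 1) * (ε / (4 * (‖f‖ + 1))) :=
          mul_le_mul (by linarith) hτA h0 (by positivity)
      _ = ε / 4 := by field_simp
  obtain ⟨N, hN⟩ := Metric.tendsto_atTop.1 hg (ε / 4) (by positivity)
  refine ⟨N, fun n hn => ?_⟩
  have h1 := hclose (ρs n) (hi n) (hAu n)
  have h2 := hclose ρ hρ hAu'
  have h3 := hN n hn
  rw [Real.dist_eq] at h3 ⊢
  rw [abs_le] at h1 h2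
  rw [abs_lt] at h3 ⊢
  constructor <;> linarith [h1.1, h1.2, h2.1, h2.2, h3.1, h3.2]

section YoungMeasure

variable {X V : Type*} [MetricSpace X] [CompleteSpace X] [SecondCountableTopology X]
  [MeasurableSpace X] [BorelSpace X] [NormedAddCommGroup V] [NormedSpace ℝ V]
  [FiniteDimensional ℝ V] [MeasurableSpace V] [BorelSpace V]

variable {ms : ℕ → ProbabilityMeasure X} {m : ProbabilityMeasure X} {u : ℕ → X → V}

/-- The first marginals converge and so are tight by the converse half of Prokhorov's theorem; for
the second coordinate, Markov's inequality and the bound B suffice. -/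
theorem isTightMeasureSet_graphLaw (hm : Tendsto ms atTop (𝓝 m)) (hum : ∀ n, Measurable (u n))
    (hui : ∀ n, Integrable (u n) (ms n : Measure X)) {B : ℝ}
    (hB : ∀ n, ∫ z, ‖u n z‖ ∂(ms n : Measure X) ≤ B) :
    IsTightMeasureSet {(ρ : Measure (X × V)) | ρ ∈ range fun n => graphLaw (ms n) (hum n)} := by
  have := FiniteDimensional.proper ℝ V
  have hcl : IsCompact (closure (range ms)) :=
    hm.isCompact_insert_range.closure_of_subset (subset_insert _ _)
  have ht := isTightMeasureSet_iff_exists_isCompact_measure_compl_le.1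
    (isTightMeasureSet_of_isCompact_closure hcl)
  refine isTightMeasureSet_iff_exists_isCompact_measure_compl_le.2 fun ε hε => ?_
  obtain ⟨K, hK, hKε⟩ := ht (ε / 2) (ENNReal.half_pos hε.ne')
  have hlim : Tendsto (fun R : ℝ => ENNReal.ofReal (B / R)) atTop (𝓝 0) := by
    simpa using ENNReal.tendsto_ofReal (tendsto_const_nhds.div_atTop tendsto_id :
      Tendsto (fun R : ℝ => B / R) atTop (𝓝 0))
  obtain ⟨R, hR, hR0⟩ := ((hlim.eventually (ge_mem_nhds (ENNReal.half_pos hε.ne'))).and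
    (eventually_gt_atTop 0)).exists
  refine ⟨K ×ˢ Metric.closedBall 0 R, hK.prod (isCompact_closedBall _ _), ?_⟩
  rintro _ ⟨_, ⟨n, rfl⟩, rfl⟩
  have hmeas : MeasurableSet (K ×ˢ Metric.closedBall (0 : V) R) :=
    hK.measurableSet.prod Metric.isClosed_closedBall.measurableSet
  have e : (graphLaw (ms n) (hum n) : Measure (X × V)) (K ×ˢ Metric.closedBall (0 : V) R)ᶜ
      = (ms n : Measure X) ((fun z => (z, u n z)) ⁻¹' (K ×ˢ Metric.closedBall (0 : V) R)ᶜ) :=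
    Measure.map_apply (measurable_id.prodMk (hum n)) hmeas.compl
  have hsub : (fun z => (z, u n z)) ⁻¹' (K ×ˢ Metric.closedBall (0 : V) R)ᶜ
      ⊆ Kᶜ ∪ {z | ENNReal.ofReal R ≤ ‖u n z‖ₑ} := by
    intro z hz
    by_cases hzK : z ∈ K
    · right
      have : R < ‖u n z‖ := by
        by_contra hle
        exact hz ⟨hzK, by simpa using hle⟩
      show ENNReal.ofReal R ≤ ‖u n z‖ₑ
      rw [← ofReal_norm]
      exact ENNReal.ofReal_le_ofReal this.le
    · exact Or.inl hzK
  rw [e]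
  refine (measure_mono hsub).trans ((measure_union_le _ _).trans ?_)
  rw [← ENNReal.add_halves ε]
  refine add_le_add (hKε _ ⟨ms n, ⟨n, rfl⟩, rfl⟩) ?_
  refine (meas_ge_le_lintegral_div (hum n).enorm.aemeasurable (by simpa using hR0)
    ENNReal.ofReal_ne_top).trans (le_trans ?_ hR)
  rw [ENNReal.ofReal_div_of_pos hR0, ← ofReal_integral_norm_eq_lintegral_enorm (hui n)]
  gcongr
  exact hB n

/-- Compactness of uniformly integrable vector fields over a narrowly convergent sequence of
measures, with lower semicontinuity of convex integrands. -/
theorem exists_tendsto_subseq_of_uniform (hm : Tendsto ms atTop (𝓝 m))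
    (hum : ∀ n, Measurable (u n)) (hui : ∀ n, Integrable (u n) (ms n : Measure X))
    (hη : ∀ η : ℝ, 0 < η → ∃ A : ℝ, 0 ≤ A ∧
      ∀ n, ∫ z, max (‖u n z‖ - A) 0 ∂(ms n : Measure X) ≤ η) :
    ∃ (v : X → V) (ι : ℕ → ℕ), StrictMono ι ∧ Measurable v ∧ Integrable v (m : Measure X) ∧
      (∀ f : BoundedContinuousFunction X (V →L[ℝ] ℝ),
        Tendsto (fun n => ∫ z, f z (u (ι n) z) ∂(ms (ι n) : Measure X)) atTop
          (𝓝 (∫ z, f z (v z) ∂(m : Measure X)))) ∧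
      ∀ ψ : V → ℝ, ConvexOn ℝ univ ψ → (∀ w, 0 ≤ ψ w) →
        ∫⁻ z, ENNReal.ofReal (ψ (v z)) ∂(m : Measure X) ≤
          liminf (fun n => ∫⁻ z, ENNReal.ofReal (ψ (u (ι n) z)) ∂(ms (ι n) : Measure X)) atTop := by
  have := FiniteDimensional.proper ℝ V
  obtain ⟨A₁, hA₁, hA₁u⟩ := hη 1 one_pos
  have hB := fun n => integral_norm_le_of_integral_max_sub_le (hui n) (hA₁u n)
  obtain ⟨ρ, -, ι, hι, hlim⟩ := (isCompact_closure_of_isTightMeasureSet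
    (isTightMeasureSet_graphLaw hm hum hui hB)).isSeqCompact
    (x := fun n => graphLaw (ms n) (hum n)) fun n => subset_closure ⟨n, rfl⟩
  have hgi : ∀ n, Integrable (fun p : X × V => p.2) (graphLaw (ms n) (hum n) : Measure (X × V)) :=
    fun n => (integrable_map_measure (f := fun z => (z, u n z)) (g := fun p : X × V => p.2)
      measurable_snd.aestronglyMeasurable (measurable_id.prodMk (hum n)).aemeasurable).2 (hui n)
  have hgn : ∀ n, ∫ p, ‖p.2‖ ∂(graphLaw (ms n) (hum n) : Measure (X × V)) ≤ A₁ + 1 := fun n =>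
    (integral_graphLaw (ms n) (hum n) (f := fun p => ‖p.2‖)
      (continuous_snd.norm.stronglyMeasurable)).trans_le (hB n)
  have hρn := (lintegral_ofReal_le_of_tendsto hlim (f := fun p : X × V => ‖p.2‖)
    continuous_snd.norm (fun p => norm_nonneg _) (fun n => (hgi _).norm) (fun n => hgn _)).1
  have hρ : Integrable (fun p : X × V => p.2) (ρ : Measure (X × V)) :=
    (integrable_norm_iff continuous_snd.aestronglyMeasurable).1 hρn
  -- The limiting Young measure lies over the limit m, so its barycenter is a vector field defined
  -- m-almost everywhere.
  have hfst : (ρ : Measure (X × V)).fst = m := by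
    have h1 := ((ProbabilityMeasure.continuous_map (Ω := X × V) continuous_fst).tendsto ρ).comp hlim
    have h2 : Tendsto (fun n => ms (ι n)) atTop (𝓝 m) := hm.comp hι.tendsto_atTop
    have h3 : ∀ n, (graphLaw (ms (ι n)) (hum (ι n))).map
        (continuous_fst.measurable (α := X × V)).aemeasurable = ms (ι n) := by
      intro n
      refine Subtype.ext ?_
      show ((ms (ι n) : Measure X).map fun z => (id z, u (ι n) z)).map Prod.fst = ms (ι n)
      rw [Measure.map_map measurable_fst (measurable_id.prodMk (hum (ι n)))]
      exact Measure.map_id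
    have h4 := tendsto_nhds_unique (h1.congr h3) h2
    exact congrArg Subtype.val h4
  obtain ⟨v, hv, hvi, hvf, hvψ⟩ := exists_barycenter (ρ : Measure (X × V)) hρ
  rw [hfst] at hvi hvf hvψ
  refine ⟨v, ι, hι, hv, hvi, fun f => ?_, fun ψ hψ hψ0 => ?_⟩
  · rw [hvf f f.continuous.stronglyMeasurable ⟨‖f‖, f.norm_coe_le_norm⟩]
    have hsm : StronglyMeasurable fun p : X × V => f p.1 p.2 :=
      ((f.continuous.comp continuous_fst).clm_apply continuous_snd).stronglyMeasurable
    refine (tendsto_integral_apply_of_uniform hlim (fun n => hgi _) (fun η h => ?_) hρ f).congr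
      fun n => integral_graphLaw (ms (ι n)) (hum (ι n)) hsm
    obtain ⟨A, hA, hAu⟩ := hη η h
    refine ⟨A, hA, fun n => ?_⟩
    show ∫ p : X × V, max (‖p.2‖ - A) 0 ∂(graphLaw (ms (ι n)) (hum (ι n)) : Measure (X × V)) ≤ η
    rw [integral_graphLaw (f := fun p : X × V => max (‖p.2‖ - A) 0) _ _
      (Continuous.stronglyMeasurable (by fun_prop))]
    exact hAu _
  · have hψc : Continuous ψ := continuousOn_univ.1 (hψ.continuousOn isOpen_univ)
    have hc : Continuous fun p : X × V => ENNReal.ofReal (ψ p.2) :=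
      ENNReal.continuous_ofReal.comp (hψc.comp continuous_snd)
    refine (hvψ ψ hψ hψ0).trans
      ((lintegral_le_liminf_of_lowerSemicontinuous hlim hc.lowerSemicontinuous).trans_eq ?_)
    exact congrArg (fun s => liminf s atTop) (funext fun n =>
      lintegral_graphLaw (ms (ι n)) (hum (ι n)) hc.measurable)

end YoungMeasure

/-! ### Weak limits in L² and identification of densities -/

section WeakLimit

variable {X : Type*} [MeasurableSpace X] {m : Measure X}

theorem eLpNorm_two_sq (f : X → ℝ) : eLpNorm f 2 m ^ 2 = ∫⁻ x, ‖f x‖ₑ ^ 2 ∂m := by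
  have h := eLpNorm_nnreal_pow_eq_lintegral (μ := m) (f := f) (p := 2) two_ne_zero
  simpa using h

theorem memLp_two_of_lintegral_lt_top {f : X → ℝ} (hf : AEStronglyMeasurable f m)
    (h : ∫⁻ x, ‖f x‖ₑ ^ 2 ∂m < ⊤) : MemLp f 2 m := by
  refine ⟨hf, ?_⟩
  rw [← eLpNorm_two_sq] at h
  exact (ENNReal.pow_lt_top_iff.1 h).resolve_right two_ne_zero

/-- Bounded sequences in `L²` have weakly convergent subsequences. -/
theorem exists_weak_limit [MeasurableSpace.CountablyGenerated X] [SigmaFinite m]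
    {G : ℕ → X → ℝ} (hG : ∀ n, AEStronglyMeasurable (G n) m)
    {c : ℝ≥0∞} (hc : c < ⊤) (hGc : ∀ n, ∫⁻ x, ‖G n x‖ₑ ^ 2 ∂m ≤ c) :
    ∃ (h : X → ℝ) (ι : ℕ → ℕ), StrictMono ι ∧ MemLp h 2 m ∧ ∫⁻ x, ‖h x‖ₑ ^ 2 ∂m ≤ c ∧
      ∀ ζ : X → ℝ, MemLp ζ 2 m →
        Tendsto (fun n => ∫ x, G (ι n) x * ζ x ∂m) atTop (𝓝 (∫ x, h x * ζ x ∂m)) := by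
  have hGm : ∀ n, MemLp (G n) 2 m := fun n =>
    memLp_two_of_lintegral_lt_top (hG n) ((hGc n).trans_lt hc)
  set r : ℝ := √c.toReal with hr
  have hnorm : ∀ {f : X → ℝ} (hf : MemLp f 2 m), ‖hf.toLp f‖ ≤ r ↔ ∫⁻ x, ‖f x‖ₑ ^ 2 ∂m ≤ c := by
    intro f hf
    rw [Lp.norm_toLp, hr, Real.le_sqrt ENNReal.toReal_nonneg ENNReal.toReal_nonneg, ← ENNReal.toReal_pow, eLpNorm_two_sq,
      ENNReal.toReal_le_toReal _ hc.ne]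
    rw [← eLpNorm_two_sq]
    exact ENNReal.pow_ne_top hf.2.ne
  -- Riesz representation followed by sequential Banach–Alaoglu; L² is separable because the
  -- σ-algebra is countably generated and m is σ-finite.
  set ℓ : ℕ → WeakDual ℝ (Lp ℝ 2 m) := fun n =>
    StrongDual.toWeakDual (InnerProductSpace.toDual ℝ (Lp ℝ 2 m) ((hGm n).toLp (G n))) with hℓ
  have : Fact ((2 : ℝ≥0∞) ≠ ⊤) := ⟨ENNReal.ofNat_ne_top⟩
  obtain ⟨ℓ', hℓ', ι, hι, hlim⟩ := WeakDual.isSeqCompact_closedBall ℝ (Lp ℝ 2 m) 0 r (x := ℓ)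
    fun n => by
      refine mem_preimage.2 ((mem_closedBall_zero_iff (E := StrongDual ℝ (Lp ℝ 2 m))).2 ?_)
      exact ((InnerProductSpace.toDual ℝ (Lp ℝ 2 m)).norm_map _).trans_le
        ((hnorm (hGm n)).2 (hGc n))
  set H : Lp ℝ 2 m := (InnerProductSpace.toDual ℝ (Lp ℝ 2 m)).symm (WeakDual.toStrongDual ℓ')
    with hH
  have hHn : ‖H‖ ≤ r := by
    rw [hH, LinearIsometryEquiv.norm_map]
    exact mem_closedBall_zero_iff.1 hℓ'
  refine ⟨H, ι, hι, Lp.memLp H, ?_, fun ζ hζ => ?_⟩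
  · rw [← hnorm (Lp.memLp H), Lp.toLp_coeFn]
    exact hHn
  · have h1 := ((WeakDual.eval_continuous (𝕜 := ℝ) (hζ.toLp ζ)).tendsto ℓ').comp hlim
    have h2 : ∀ {f : X → ℝ} (hf : MemLp f 2 m),
        inner ℝ (hf.toLp f) (hζ.toLp ζ) = ∫ x, f x * ζ x ∂m := by
      intro f hf
      rw [L2.inner_def]
      refine integral_congr_ae ?_
      filter_upwards [hf.coeFn_toLp, hζ.coeFn_toLp] with x e1 e2
      rw [e1, e2]
      exact mul_comm _ _
    have h3 : ℓ' (hζ.toLp ζ) = ∫ x, H x * ζ x ∂m := by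
      rw [← h2 (Lp.memLp H), Lp.toLp_coeFn, hH]
      exact (InnerProductSpace.toDual_symm_apply (𝕜 := ℝ)).symm
    rw [← h3]
    exact h1.congr fun n => h2 (hGm (ι n))

end WeakLimit

section Identification

theorem measurable_density (m : P₁ d) : Measurable (density m) :=
  (Measure.measurable_rnDeriv _ _).ennreal_toReal

theorem integral_density_mul {m : P₁ d} (hm : m.meas ≪ volume) (f : Space d → ℝ) :
    ∫ x, density m x * f x = ∫ x, f x ∂m.meas :=
  integral_toReal_rnDeriv_mul hm

theorem integrable_density (m : P₁ d) : Integrable (density m) :=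
  Measure.integrable_toReal_rnDeriv

/-- A probability measure that differs from one with an `L²` density by an `L²` function has an `L²`
density. -/
theorem hasL2Density_of_integral_sub_eq {m m₁ : P₁ d} (h₁ : HasL2Density m₁) {h : Space d → ℝ}
    (hh : MemLp h 2 volume)
    (hmh : ∀ ζ : Space d → ℝ, Continuous ζ → HasCompactSupport ζ →
      ∫ x, ζ x ∂m.meas - ∫ x, ζ x ∂m₁.meas = ∫ x, h x * ζ x) :
    HasL2Density m ∧ ∀ᵐ x, density m x - density m₁ x = h x := by
  set f : Space d → ℝ := fun x => density m₁ x + h x with hf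
  have hfL : MemLp f 2 volume := h₁.2.add hh
  have hfloc : LocallyIntegrable f volume := hfL.locallyIntegrable (by norm_num)
  have hhloc : LocallyIntegrable h volume := hh.locallyIntegrable (by norm_num)
  -- The candidate density f may change sign a priori and is only locally integrable. Its positive
  -- and negative parts define locally finite measures p and q, and the tested identity becomes m +
  -- q = p between positive measures.
  set p : Measure (Space d) := volume.withDensity fun x => ENNReal.ofReal (f x) with hp
  set q : Measure (Space d) := volume.withDensity fun x => ENNReal.ofReal (-f x) with hq
  have hloc : ∀ g : Space d → ℝ, LocallyIntegrable g volume →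
      IsLocallyFiniteMeasure ((volume : Measure (Space d)).withDensity
        fun x => ENNReal.ofReal (g x)) := by
    refine fun g hg => ⟨fun x => ?_⟩
    obtain ⟨s, hs, hgs⟩ := hg x
    refine ⟨s, hs, ?_⟩
    rw [withDensity_apply']
    exact hgs.lintegral_lt_top
  have hploc : IsLocallyFiniteMeasure p := hloc f hfloc
  have hqloc : IsLocallyFiniteMeasure q := hloc _ hfloc.neg
  have hmul : ∀ {g : Space d → ℝ}, MemLp g 2 volume → ∀ {ζ : Space d → ℝ}, Continuous ζ →
      HasCompactSupport ζ → Integrable fun x => g x * ζ x := by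
    intro g hg ζ hζ hζc
    exact ((hg.locallyIntegrable (by norm_num)).integrable_smul_left_of_hasCompactSupport hζ
      hζc).congr (Eventually.of_forall fun x => mul_comm _ _)
  have hpq : ∀ ζ : Space d → ℝ, Continuous ζ → HasCompactSupport ζ →
      ∫ x, ζ x ∂p - ∫ x, ζ x ∂q = ∫ x, f x * ζ x := by
    intro ζ hζ hζc
    have hd : ∀ {g : Space d → ℝ}, MemLp g 2 volume → ∫ x, ζ x
        ∂((volume : Measure (Space d)).withDensity fun x => ENNReal.ofReal (g x))
        = ∫ x, max (g x) 0 * ζ x := by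
      intro g hg
      rw [integral_withDensity_eq_integral_toReal_smul₀ hg.1.aemeasurable.ennreal_ofReal
        (Eventually.of_forall fun x => ENNReal.ofReal_lt_top)]
      refine integral_congr_ae (Eventually.of_forall fun x => ?_)
      simp only [ENNReal.toReal_ofReal', smul_eq_mul]
    have hn : MemLp (fun x => -f x) 2 volume := hfL.neg
    rw [hp, hq, hd hfL, hd hn, ← integral_sub (hmul hfL.pos_part hζ hζc)
      (hmul hn.pos_part hζ hζc)]
    refine integral_congr_ae (Eventually.of_forall fun x => ?_)
    simp only
    rw [← sub_mul]
    congr 1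
    rcases le_total (f x) 0 with h0 | h0
    · rw [max_eq_right h0, max_eq_left (neg_nonneg.2 h0)]; ring
    · rw [max_eq_left h0, max_eq_right (neg_nonpos.2 h0)]; ring
  have hadd : IsLocallyFiniteMeasure (m.meas + q) := by
    refine ⟨fun x => ?_⟩
    obtain ⟨s, hs, hqs⟩ := q.finiteAt_nhds x
    exact ⟨s, hs, by rw [Measure.add_apply]; exact ENNReal.add_lt_top.2 ⟨measure_lt_top _ _, hqs⟩⟩
  have heq : m.meas + q = p := by
    have hζ : ∀ ζ : Space d → ℝ, Continuous ζ → HasCompactSupport ζ →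
        ∫ x, ζ x ∂(m.meas + q) = ∫ x, ζ x ∂p := by
      intro ζ hc hcc
      rw [integral_add_measure (hc.integrable_of_hasCompactSupport hcc)
        (hc.integrable_of_hasCompactSupport hcc)]
      have e1 := hpq ζ hc hcc
      have e2 := hmh ζ hc hcc
      have e3 : ∫ x, f x * ζ x = (∫ x, density m₁ x * ζ x) + ∫ x, h x * ζ x := by
        rw [← integral_add (hmul h₁.2 hc hcc) (hmul hh hc hcc)]
        refine integral_congr_ae (Eventually.of_forall fun x => ?_)
        simp only [hf]
        ring
      rw [e3, integral_density_mul h₁.1, ← e2] at e1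
      linarith
    exact Measure.ext_of_integral_eq_on_compactlySupported fun ζ =>
      hζ ζ ζ.continuous ζ.hasCompactSupport
  have hac : m.meas ≪ volume := by
    have : m.meas ≪ p := by rw [← heq]; exact Measure.absolutelyContinuous_of_le (Measure.le_add_right le_rfl)
    exact this.trans (withDensity_absolutelyContinuous _ _)
  have hae : ∀ᵐ x, density m x - density m₁ x = h x := by
    rw [← Measure.withDensity_rnDeriv_eq _ _ hac, hq, ← withDensity_add_left
      (Measure.measurable_rnDeriv _ _), hp, withDensity_eq_iff_of_sigmaFinite
      ((Measure.measurable_rnDeriv _ _).aemeasurable.add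
        (f := m.meas.rnDeriv volume) (g := fun x => ENNReal.ofReal (-f x))
        hfL.1.aemeasurable.neg.ennreal_ofReal)
      hfL.1.aemeasurable.ennreal_ofReal] at heq
    filter_upwards [heq] with x hx
    have hx' : density m x = f x := by
      -- Where f were negative, the right side would vanish while the density of q is positive.
      rcases le_or_gt 0 (f x) with h0 | h0
      · simp only [Pi.add_apply, ENNReal.ofReal_of_nonpos (neg_nonpos.2 h0), add_zero] at hx
        rw [density, hx, ENNReal.toReal_ofReal h0]
      · rw [Pi.add_apply, ENNReal.ofReal_of_nonpos h0.le, add_eq_zero] at hx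
        exact absurd (ENNReal.ofReal_eq_zero.1 hx.2) (by linarith)
    rw [hx', hf]
    simp
  refine ⟨⟨hac, hh.add h₁.2 |>.ae_eq ?_⟩, hae⟩
  filter_upwards [hae] with x hx
  simp only [Pi.add_apply]
  linarith

end Identification

/-! ### The mollified terminal penalty -/

section Mollification

variable {k : Space d → ℝ}

theorem IsKernel.continuous_rescale (hk : IsKernel k) (δ : ℝ) : Continuous (rescale k δ) :=
  (hk.continuous.comp (continuous_const_smul _)).div_const _

theorem IsKernel.exists_rescale_le (hk : IsKernel k) {δ : ℝ} (hδ : 0 < δ) :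
    ∃ C, ∀ x, ‖rescale k δ x‖ ≤ C := by
  obtain ⟨C, hC⟩ := hk.bounded
  refine ⟨C / δ ^ d, fun x => ?_⟩
  rw [rescale, norm_div, Real.norm_of_nonneg (pow_nonneg hδ.le d)]
  gcongr
  exact hC _

theorem IsKernel.continuous_convolve (hk : IsKernel k) {δ : ℝ} (hδ : 0 < δ) (m : P₁ d) :
    Continuous (convolve (rescale k δ) m) := by
  obtain ⟨C, hC⟩ := hk.exists_rescale_le hδ
  refine continuous_of_dominated (bound := fun _ => C) (fun y => ?_)
    (fun y => Eventually.of_forall fun x => hC _) (integrable_const C)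
    (Eventually.of_forall fun x => ?_)
  · exact ((hk.continuous_rescale δ).comp (by fun_prop)).aestronglyMeasurable
  · exact (hk.continuous_rescale δ).comp (by fun_prop)

theorem integral_rescale_sub_mul {δ : ℝ} (hδ : 0 < δ) (ζ : Space d → ℝ) (x : Space d) :
    ∫ y, rescale k δ (y - x) * ζ y = ∫ z, k z * ζ (x + δ • z) := by
  have h1 := integral_sub_right_eq_self (μ := (volume : Measure (Space d)))
    (fun w => rescale k δ w * ζ (x + w)) x
  have h2 := Measure.integral_comp_inv_smul_of_nonneg (volume : Measure (Space d))
    (fun z => k z * ζ (x + δ • z)) hδ.le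
  simp only [smul_inv_smul₀ hδ.ne', finrank_euclideanSpace, Fintype.card_fin] at h2
  simp only [add_sub_cancel] at h1
  rw [h1]
  have h3 : ∀ w, rescale k δ w * ζ (x + w) = (δ ^ d)⁻¹ * (k (δ⁻¹ • w) * ζ (x + w)) := fun w => by
    rw [rescale]; ring
  simp_rw [h3]
  rw [integral_const_mul, h2, smul_eq_mul, inv_mul_cancel_left₀ (pow_pos hδ d).ne']

/-- Fubini moves the mollifier from the measure onto the test function, where its effect can be
estimated uniformly. -/
theorem IsKernel.integral_convolve_mul (hk : IsKernel k) {δ : ℝ} (hδ : 0 < δ) (m : P₁ d)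
    {ζ : Space d → ℝ} (hζ : Continuous ζ) (hζc : HasCompactSupport ζ) :
    ∫ y, convolve (rescale k δ) m y * ζ y = ∫ x, (∫ z, k z * ζ (x + δ • z)) ∂m.meas := by
  obtain ⟨C, hC⟩ := hk.exists_rescale_le hδ
  simp_rw [← integral_rescale_sub_mul hδ, convolve, ← integral_mul_const]
  refine integral_integral_swap ?_
  have hζi := hζ.integrable_of_hasCompactSupport hζc (μ := volume)
  refine ((hζi.norm.const_mul C).mul_prod (integrable_const (1 : ℝ))).mono'
    (Continuous.aestronglyMeasurable ?_) (Eventually.of_forall fun p => ?_)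
  · exact ((hk.continuous_rescale δ).comp (by fun_prop)).mul (hζ.comp continuous_fst)
  · simp only [mul_one, Function.uncurry, norm_mul]
    gcongr
    exact hC _

/-- Mollification of a continuous compactly supported function converges uniformly. -/
theorem IsKernel.exists_abs_sub_le (hk : IsKernel k) (hk1 : ∫ x, k x = 1) {ζ : Space d → ℝ}
    (hζ : Continuous ζ) (hζc : HasCompactSupport ζ) {η : ℝ} (hη : 0 < η) :
    ∃ δ₀ : ℝ, 0 < δ₀ ∧ ∀ δ, 0 < δ → δ < δ₀ →
      ∀ x, |(∫ z, k z * ζ (x + δ • z)) - ζ x| ≤ η := by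
  have hki : Integrable k := not_imp_comm.1 integral_undef (by rw [hk1]; exact one_ne_zero)
  obtain ⟨B, hB⟩ := hζc.exists_bound_of_continuous hζ
  have hB0 : 0 ≤ B := (norm_nonneg _).trans (hB 0)
  obtain ⟨r, hr, hrη⟩ := Metric.uniformContinuous_iff.1
    (hζc.uniformContinuous_of_continuous hζ) (η / 2) (half_pos hη)
  set M := ∫ z, ‖z‖ * k z with hM
  have hM0 : 0 ≤ M := integral_nonneg fun z => mul_nonneg (norm_nonneg _) (hk.nonneg z)
  refine ⟨η * r / (4 * (B + 1) * (M + 1)), by positivity, fun δ hδ hδ₀ x => ?_⟩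
  have hi1 : Integrable fun z => k z * ζ (x + δ • z) :=
    (hki.norm.mul_const B).mono' ((hk.continuous.mul (hζ.comp (by fun_prop))).aestronglyMeasurable)
      (Eventually.of_forall fun z => by rw [norm_mul]; gcongr; exact hB _)
  have hi2 : Integrable fun z => k z * ζ x := hki.mul_const _
  have e : (∫ z, k z * ζ (x + δ • z)) - ζ x = ∫ z, (k z * ζ (x + δ • z) - k z * ζ x) := by
    rw [integral_sub hi1 hi2, integral_mul_const, hk1, one_mul]
  have hi3 : Integrable fun z => η / 2 * k z + 2 * B * δ / r * (‖z‖ * k z) :=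
    (hki.const_mul _).add (hk.moment.const_mul _)
  -- Uniform continuity handles δ|z| < r. Elsewhere the difference is at most 2B ≤ 2Bδ|z|/r, which
  -- the first moment of k controls.
  have hle : ∀ z, ‖k z * ζ (x + δ • z) - k z * ζ x‖
      ≤ η / 2 * k z + 2 * B * δ / r * (‖z‖ * k z) := by
    intro z
    have hkz := hk.nonneg z
    rw [← mul_sub, norm_mul, Real.norm_of_nonneg hkz]
    have : ‖ζ (x + δ • z) - ζ x‖ ≤ η / 2 + 2 * B * δ / r * ‖z‖ := by
      rcases lt_or_ge (δ * ‖z‖) r with h | h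
      · have h1 := hrη (a := x + δ • z) (b := x) (by
          rw [dist_eq_norm, add_sub_cancel_left, norm_smul, Real.norm_of_nonneg hδ.le]; exact h)
        rw [dist_eq_norm] at h1
        have : 0 ≤ 2 * B * δ / r * ‖z‖ := by positivity
        linarith
      · have h1 := norm_sub_le (ζ (x + δ • z)) (ζ x)
        have h2 := hB (x + δ • z)
        have h3 := hB x
        have h4 : 2 * B ≤ 2 * B * δ / r * ‖z‖ := by
          rw [div_mul_eq_mul_div, le_div_iff₀ hr]
          nlinarith
        linarith
    calc k z * ‖ζ (x + δ • z) - ζ x‖ ≤ k z * (η / 2 + 2 * B * δ / r * ‖z‖) := by gcongr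
      _ = _ := by ring
  rw [e]
  refine (norm_integral_le_of_norm_le (f := fun z => k z * ζ (x + δ • z) - k z * ζ x) hi3
    (Eventually.of_forall hle)).trans ?_
  rw [integral_add (hki.const_mul _) (hk.moment.const_mul _), integral_const_mul,
    integral_const_mul, hk1, ← hM]
  rw [lt_div_iff₀ (by positivity)] at hδ₀
  have : 2 * B * δ / r * M ≤ η / 2 := by
    rw [div_mul_eq_mul_div, div_le_iff₀ hr]
    have h1 : B * M ≤ (B + 1) * (M + 1) := by nlinarith
    have h2 := mul_le_mul_of_nonneg_left h1 hδ.le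
    nlinarith
  linarith

/-- The mollification error is uniform in the point, so it is the same for all probability measures;
what is left is narrow convergence. -/
theorem IsKernel.tendsto_integral_convolve_mul (hk : IsKernel k) (hk1 : ∫ x, k x = 1)
    {δ : ℕ → ℝ} (hδ : ∀ n, 0 < δ n) (hδ0 : Tendsto δ atTop (𝓝 0)) {ms : ℕ → P₁ d} {m : P₁ d}
    (hm : Tendsto ms atTop (𝓝 m)) {ζ : Space d → ℝ} (hζ : Continuous ζ)
    (hζc : HasCompactSupport ζ) :
    Tendsto (fun n => ∫ y, convolve (rescale k (δ n)) (ms n) y * ζ y) atTop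
      (𝓝 (∫ x, ζ x ∂m.meas)) := by
  obtain ⟨B, hB⟩ := hζc.exists_bound_of_continuous hζ
  have h1 := (ProbabilityMeasure.tendsto_iff_forall_integral_tendsto.1
    ((P₁.continuous_val.tendsto m).comp hm))
    (BoundedContinuousFunction.ofNormedAddCommGroup ζ hζ B hB)
  refine Metric.tendsto_atTop.2 fun η hη => ?_
  obtain ⟨δ₀, hδ₀, h⟩ := hk.exists_abs_sub_le hk1 hζ hζc (half_pos hη)
  obtain ⟨N, hN⟩ := Metric.tendsto_atTop.1 h1 (η / 2) (half_pos hη)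
  obtain ⟨N', hN'⟩ := eventually_atTop.1 (hδ0.eventually (gt_mem_nhds hδ₀))
  refine ⟨max N N', fun n hn => ?_⟩
  have h2 := hN n ((le_max_left _ _).trans hn)
  have h3 := h (δ n) (hδ n) (hN' n ((le_max_right _ _).trans hn))
  rw [hk.integral_convolve_mul (hδ n) _ hζ hζc]
  refine (dist_triangle _ (∫ x, ζ x ∂(ms n).meas) _).trans_lt ?_
  have h4 : dist (∫ x, (∫ z, k z * ζ (x + δ n • z)) ∂(ms n).meas) (∫ x, ζ x ∂(ms n).meas)
      ≤ η / 2 := by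
    have hi : Integrable ζ (ms n).meas := Integrable.of_bound hζ.aestronglyMeasurable B
      (Eventually.of_forall hB)
    have hsm : StronglyMeasurable fun x => ∫ z, k z * ζ (x + δ n • z) :=
      StronglyMeasurable.integral_prod_right' (f := fun p : Space d × Space d =>
        k p.2 * ζ (p.1 + δ n • p.2)) (Continuous.stronglyMeasurable
        ((hk.continuous.comp continuous_snd).mul (hζ.comp (by fun_prop))))
    have hi' : Integrable (fun x => ∫ z, k z * ζ (x + δ n • z)) (ms n).meas :=
      Integrable.of_bound hsm.aestronglyMeasurable (η / 2 + B) (Eventually.of_forall fun x => by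
        have e1 := h3 x
        have e2 := hB x
        rw [Real.norm_eq_abs] at e2 ⊢
        have := abs_sub_abs_le_abs_sub (∫ z, k z * ζ (x + δ n • z)) (ζ x)
        linarith)
    rw [dist_eq_norm, ← integral_sub hi' hi]
    refine (norm_integral_le_of_norm_le_const (μ := (ms n).meas) (C := η / 2)
      (f := fun x => (∫ z, k z * ζ (x + δ n • z)) - ζ x) (Eventually.of_forall h3)).trans ?_
    simp
  have h5 : dist (∫ x, ζ x ∂(ms n).meas) (∫ x, ζ x ∂m.meas) < η / 2 := h2
  linarith

/-- A level above the liminf bounds the mollified differences in L² along a subsequence. Their weak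
limit has to be m - m₁ as a distribution, so finiteness of the liminf itself forces m to have an L²
density, and the norm is weakly lower semicontinuous. -/
theorem terminal_le_liminf {D : Data d} (hD : HasL2Density D.m₁) (hk : IsKernel k)
    (hk1 : ∫ x, k x = 1) (ε : ℝ)
    {δ : ℕ → ℝ} (hδ : ∀ n, 0 < δ n) (hδ0 : Tendsto δ atTop (𝓝 0)) {ms : ℕ → P₁ d} {m : P₁ d}
    (hm : Tendsto ms atTop (𝓝 m)) (hε : 0 < ε) :
    D.terminal ε m ≤ liminf (fun n => D.terminalMollified k ε (δ n) (ms n)) atTop := by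
  set G : ℕ → Space d → ℝ := fun n y =>
    convolve (rescale k (δ n)) (ms n) y - convolve (rescale k (δ n)) D.m₁ y with hG
  have key : ∀ c : ℝ≥0∞, c < ⊤ → (∃ᶠ n in atTop, ∫⁻ y, ‖G n y‖ₑ ^ 2 ≤ c) →
      HasL2Density m ∧ ∫⁻ y, ‖density m y - density D.m₁ y‖ₑ ^ 2 ≤ c := by
    intro c hc hfreq
    obtain ⟨κ, hκ, hκc⟩ := extraction_of_frequently_atTop hfreq
    have hGc : ∀ n, Continuous (G n) := fun n =>
      (hk.continuous_convolve (hδ n) _).sub (hk.continuous_convolve (hδ n) _)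
    obtain ⟨h, ι, hι, hh, hhc, hlim⟩ := exists_weak_limit (G := fun n => G (κ n))
      (fun n => (hGc _).aestronglyMeasurable (μ := volume)) hc hκc
    have hs : Tendsto (fun n => κ (ι n)) atTop atTop :=
      hκ.tendsto_atTop.comp hι.tendsto_atTop
    obtain ⟨h1, h2⟩ := hasL2Density_of_integral_sub_eq (m := m) hD hh fun ζ hζ hζc => by
      have hζL : MemLp ζ 2 volume := hζ.memLp_of_hasCompactSupport hζc
      refine tendsto_nhds_unique ?_ (hlim ζ hζL)
      refine ((hk.tendsto_integral_convolve_mul hk1 (fun n => hδ _) (hδ0.comp hs) (hm.comp hs)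
        hζ hζc).sub (hk.tendsto_integral_convolve_mul hk1 (fun n => hδ _) (hδ0.comp hs)
        (tendsto_const_nhds (x := D.m₁)) hζ hζc)).congr fun n => ?_
      have hi : ∀ m' : P₁ d, Integrable fun y =>
          convolve (rescale k (δ (κ (ι n)))) m' y * ζ y := fun m' =>
        ((hk.continuous_convolve (hδ _) m').mul hζ).integrable_of_hasCompactSupport hζc.mul_left
      simp only [Function.comp_apply]
      rw [← integral_sub (hi _) (hi _)]
      refine integral_congr_ae (Eventually.of_forall fun y => ?_)
      simp only [hG]
      ring
    refine ⟨h1, le_trans (le_of_eq (lintegral_congr_ae ?_)) hhc⟩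
    filter_upwards [h2] with y hy
    rw [hy]
  have h0 : ENNReal.ofReal (1 / ε) ≠ 0 := by simpa using hε
  refine le_of_forall_gt fun a ha => ?_
  obtain ⟨b, hb, hba⟩ := exists_between ha
  have hfreq := frequently_lt_of_liminf_lt (by isBoundedDefault) hb
  have hb' : b / ENNReal.ofReal (1 / ε) < ⊤ := ENNReal.div_lt_top (hba.trans_le le_top).ne h0
  obtain ⟨h1, h2⟩ := key _ hb' (hfreq.mono fun n hn => by
    rw [ENNReal.le_div_iff_mul_le (Or.inl h0) (Or.inl ENNReal.ofReal_ne_top), mul_comm]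
    exact hn.le)
  rw [Data.terminal, if_pos h1]
  rw [ENNReal.le_div_iff_mul_le (Or.inl h0) (Or.inl ENNReal.ofReal_ne_top), mul_comm] at h2
  exact h2.trans_lt hba

/-- Jensen's inequality for the square and a weight of mass at most one, in the form of
Cauchy–Schwarz for the measure a dm. -/
theorem sq_lintegral_le {X : Type*} [MeasurableSpace X] {m : Measure X} {a b : X → ℝ≥0∞}
    (ha : Measurable a) (hb : Measurable b) (ha1 : ∫⁻ x, a x ∂m ≤ 1) :
    (∫⁻ x, a x * b x ∂m) ^ 2 ≤ ∫⁻ x, a x * b x ^ 2 ∂m := by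
  have h := ENNReal.lintegral_mul_le_Lp_mul_Lq (m.withDensity a) Real.HolderConjugate.two_two
    hb.aemeasurable (aemeasurable_const (b := (1 : ℝ≥0∞)))
  simp only [Pi.mul_apply, mul_one, ENNReal.one_rpow, lintegral_const, one_mul,
    withDensity_apply _ MeasurableSet.univ, Measure.restrict_univ] at h
  rw [lintegral_withDensity_eq_lintegral_mul _ ha hb,
    lintegral_withDensity_eq_lintegral_mul _ ha (hb.pow_const _)] at h
  have h1 : (∫⁻ x, a x ∂m) ^ (1 / 2 : ℝ) ≤ 1 := ENNReal.rpow_le_one ha1 (by norm_num)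
  have h2 := (h.trans (mul_le_of_le_one_right' h1))
  calc (∫⁻ x, a x * b x ∂m) ^ 2 ≤ ((∫⁻ x, a x * b x ^ (2 : ℝ) ∂m) ^ (1 / 2 : ℝ)) ^ 2 := by
        gcongr
        exact h2
    _ = ∫⁻ x, a x * b x ^ 2 ∂m := by
        rw [← ENNReal.rpow_natCast, ← ENNReal.rpow_mul]
        simp

/-- Averaging against a probability density contracts the L² norm: Jensen's inequality pointwise,
then Tonelli, integrating the kernel in y first. -/
theorem IsKernel.terminalMollified_le_terminal (hk : IsKernel k) (hk1 : ∫ x, k x = 1)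
    {D : Data d} (hD : HasL2Density D.m₁) (ε : ℝ) {δ : ℝ} (hδ : 0 < δ) (m : P₁ d) :
    D.terminalMollified k ε δ m ≤ D.terminal ε m := by
  by_cases hm : HasL2Density m
  swap
  · rw [Data.terminal, if_neg hm]; exact le_top
  rw [Data.terminal, if_pos hm, Data.terminalMollified]
  refine mul_le_mul_right ?_ _
  set f : Space d → ℝ := fun x => density m x - density D.m₁ x with hf
  set a : Space d → ℝ≥0∞ := fun x => ENNReal.ofReal (rescale k δ x) with ha
  have ham : Measurable a := (hk.continuous_rescale δ).measurable.ennreal_ofReal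
  have hfm : Measurable fun x => ‖f x‖ₑ :=
    ((measurable_density m).sub (measurable_density D.m₁)).enorm
  have hr0 : ∀ x, 0 ≤ rescale k δ x := fun x => div_nonneg (hk.nonneg _) (pow_nonneg hδ.le d)
  have hr1 : ∫ x, rescale k δ x = 1 := by
    have := integral_rescale_sub_mul (k := k) hδ (fun _ => 1) 0
    simpa [hk1] using this
  have ha1 : ∫⁻ x, a x = 1 := by
    rw [ha, ← ofReal_integral_eq_lintegral_ofReal
      (not_imp_comm.1 integral_undef (by rw [hr1]; exact one_ne_zero))
      (Eventually.of_forall hr0), hr1, ENNReal.ofReal_one]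
  have hle : ∀ y, ‖convolve (rescale k δ) m y - convolve (rescale k δ) D.m₁ y‖ₑ ^ 2
      ≤ ∫⁻ x, a (y - x) * ‖f x‖ₑ ^ 2 := by
    intro y
    obtain ⟨C, hC⟩ := hk.exists_rescale_le hδ
    have hi : ∀ m' : P₁ d, Integrable fun x => density m' x * rescale k δ (y - x) := fun m' =>
      (integrable_density m').mul_bdd (c := C)
        ((hk.continuous_rescale δ).comp (by fun_prop)).aestronglyMeasurable
        (Eventually.of_forall fun x => hC _)
    have e : convolve (rescale k δ) m y - convolve (rescale k δ) D.m₁ y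
        = ∫ x, rescale k δ (y - x) * f x := by
      rw [convolve, convolve, ← integral_density_mul hm.1, ← integral_density_mul hD.1,
        ← integral_sub (hi _) (hi _)]
      refine integral_congr_ae (Eventually.of_forall fun x => ?_)
      simp only [hf]
      ring
    have h1 : ‖∫ x, rescale k δ (y - x) * f x‖ₑ ≤ ∫⁻ x, a (y - x) * ‖f x‖ₑ := by
      refine (enorm_integral_le_lintegral_enorm _).trans_eq (lintegral_congr fun x => ?_)
      rw [enorm_mul, Real.enorm_of_nonneg (hr0 _)]
    rw [e]
    calc _ ≤ (∫⁻ x, a (y - x) * ‖f x‖ₑ) ^ 2 := by gcongr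
      _ ≤ _ := sq_lintegral_le (ham.comp (by fun_prop)) hfm
          (by rw [lintegral_sub_left_eq_self a y, ha1])
  calc _ ≤ ∫⁻ y, ∫⁻ x, a (y - x) * ‖f x‖ₑ ^ 2 := lintegral_mono hle
    _ = ∫⁻ x, ∫⁻ y, a (y - x) * ‖f x‖ₑ ^ 2 := lintegral_lintegral_swap
        ((ham.comp (by fun_prop)).mul ((hfm.comp measurable_snd).pow_const 2)).aemeasurable
    _ = ∫⁻ x, ‖f x‖ₑ ^ 2 := lintegral_congr fun x => by
        rw [lintegral_mul_const _ (show Measurable fun y => a (y - x) from ham.comp (by fun_prop)),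
          lintegral_sub_right_eq_self a x, ha1,
          one_mul]

end Mollification

/-! ### Uniform integrability of controls and passage to the limit -/

/-- Controls of bounded cost are uniformly integrable. -/
theorem IsControlCost.exists_integral_max_sub_le {U : Submodule ℝ (Space d)} {ψ : U → ℝ}
    (hψ : IsControlCost ψ) {X N : Type*} [MeasurableSpace X] {m : N → Measure X}
    [∀ n, IsProbabilityMeasure (m n)] {u : N → X → U} (hum : ∀ n, Measurable (u n))
    (hui : ∀ n, Integrable (u n) (m n)) {M : ℝ≥0∞} (hM : M < ⊤)
    (h : ∀ n, ∫⁻ x, ENNReal.ofReal (ψ (u n x)) ∂m n ≤ M) {η : ℝ} (hη : 0 < η) :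
    ∃ A : ℝ, 0 ≤ A ∧ ∀ n, ∫ x, max (‖u n x‖ - A) 0 ∂m n ≤ η := by
  obtain ⟨φ, hφ, C, -, hφψ⟩ := hψ.moderated
  -- Beyond some level φ(r) ≥ κ r, hence ‖w‖ ≤ (ψ w + 1)/κ there, the 1 coming from φ - 1 ≤ ψ.
  -- Integration gives at most (M + 1)/κ = η.
  set κ : ℝ := (M.toReal + 1) / η with hκ
  have hκ0 : 0 < κ := by have := ENNReal.toReal_nonneg (a := M); positivity
  obtain ⟨A, hA⟩ := eventually_atTop.1 (hφ.superlinear.eventually_ge_atTop κ)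
  refine ⟨max A 1, by positivity, fun n => ?_⟩
  have hle : ∀ w : U, max (‖w‖ - max A 1) 0 ≤ (ψ w + 1) / κ := by
    intro w
    have h0 : 0 ≤ (ψ w + 1) / κ := div_nonneg (by linarith [hψ.nonneg w]) hκ0.le
    refine max_le ?_ h0
    rcases le_total ‖w‖ (max A 1) with hw | hw
    · linarith
    · have hw0 : 0 < ‖w‖ := one_pos.trans_le ((le_max_right _ _).trans hw)
      have h1 := hA ‖w‖ ((le_max_left _ _).trans hw)
      rw [le_div_iff₀ hw0] at h1
      have h2 : ‖w‖ ≤ (ψ w + 1) / κ := by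
        rw [le_div_iff₀ hκ0]
        linarith [(hφψ w).1]
      have : (1 : ℝ) ≤ max A 1 := le_max_right _ _
      linarith
  have hψi : Integrable (fun x => ψ (u n x)) (m n) := by
    refine ⟨(hψ.lsc.measurable.comp (hum n)).aestronglyMeasurable, ?_⟩
    rw [hasFiniteIntegral_iff_ofReal (Eventually.of_forall fun x => hψ.nonneg _)]
    exact (h n).trans_lt hM
  have hψM : ∫ x, ψ (u n x) ∂m n ≤ M.toReal := by
    rw [← ENNReal.ofReal_le_ofReal_iff ENNReal.toReal_nonneg, ENNReal.ofReal_toReal hM.ne,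
      ofReal_integral_eq_lintegral_ofReal hψi (Eventually.of_forall fun x => hψ.nonneg _)]
    exact h n
  have hi : Integrable (fun x => ψ (u n x) + 1) (m n) := hψi.add (integrable_const 1)
  calc ∫ x, max (‖u n x‖ - max A 1) 0 ∂m n ≤ ∫ x, (ψ (u n x) + 1) / κ ∂m n :=
        integral_mono (integrable_max_sub (hui n) _) (hi.div_const κ) fun x => hle _
    _ = (∫ x, ψ (u n x) ∂m n + 1) / κ := by
        rw [integral_div, integral_add hψi (integrable_const 1)]; simp
    _ ≤ (M.toReal + 1) / κ := by gcongr
    _ = η := by rw [hκ]; field_simp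

/-- A curve that solves the continuity equation with an integrable control is absolutely
continuous. -/
theorem isACCurve_of_continuityEquation {D : Data d} (hD : D.IsAdmissible) {μ : I → P₁ d}
    (hμ : Continuous μ) {u : Space d × I → D.U} (hum : Measurable u)
    (hu : Integrable u (spaceTime μ))
    (hCE : D.ContinuityEquation μ ((spaceTime μ).withDensityᵥ u)) : IsACCurve μ := by
  obtain ⟨A, hA, hW⟩ := exists_W₁_le_integral_norm_velocity d
  have hv := hD.integrable_velocity hμ hu
  have hvm : Measurable fun z => ‖velocity D μ u z‖ₑ :=
    ((hD.continuous_field hμ).measurable.add (measurable_subtype_coe.comp hum)).enorm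
  have hgm : Measurable fun r : I => ∫⁻ y, ‖velocity D μ u (y, r)‖ₑ ∂(μ r).meas :=
    Measurable.lintegral_kernel_prod_right (κ := curveKernel hμ)
      (f := fun r y => ‖velocity D μ u (y, r)‖ₑ) (hvm.comp measurable_swap)
  refine ⟨fun r => ENNReal.ofReal A * ∫⁻ y, ‖velocity D μ u (y, r)‖ₑ ∂(μ r).meas,
    hgm.const_mul _, ?_, fun s t hst => (hW D μ u hD hμ hu hCE s t hst).trans ?_⟩
  · rw [lintegral_const_mul _ hgm, ← lintegral_spaceTime hμ hvm]
    exact ENNReal.mul_ne_top ENNReal.ofReal_ne_top hv.2.ne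
  · rw [ENNReal.ofReal_mul (zero_le_one.trans hA), lintegral_const_mul _ hgm,
      ofReal_integral_norm_eq_lintegral_enorm hv.restrict,
      ← lintegral_indicator (measurableSet_slab s t),
      lintegral_spaceTime hμ (hvm.indicator (measurableSet_slab s t)),
      ← lintegral_indicator measurableSet_Icc]
    refine mul_le_mul_right (lintegral_mono fun r => ?_) _
    by_cases hr : r ∈ Icc s t
    · rw [indicator_of_mem hr]
      exact lintegral_mono fun y => indicator_le_self _ _ _
    · have : ∀ y : Space d, (y, r) ∉ slab d s t := fun y hy => hr (Ioc_subset_Icc_self hy)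
      simp [this]

/-- The space-time measure of a continuous curve as a probability measure. -/
noncomputable def spaceTimeLaw {μ : I → P₁ d} (hμ : Continuous μ) :
    ProbabilityMeasure (Space d × I) := ⟨spaceTime μ, isProbabilityMeasure_spaceTime hμ⟩

section Limit

variable {μs : ℕ → I → P₁ d} {μ : I → P₁ d}

theorem CurveTendsto.comp (h : CurveTendsto μs μ) {ι : ℕ → ℕ} (hι : StrictMono ι) :
    CurveTendsto (fun n => μs (ι n)) μ :=
  Tendsto.comp (f := ι) h hι.tendsto_atTop

theorem CurveTendsto.eventually_lt (h : CurveTendsto μs μ) {r : ℝ} (hr : 0 < r) :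
    ∀ᶠ n in atTop, ∀ t, W₁ (μs n t) (μ t) < ENNReal.ofReal r := by
  filter_upwards [h.eventually (gt_mem_nhds (ENNReal.ofReal_pos.2 hr))] with n hn t
  exact (le_iSup (fun t => W₁ (μs n t) (μ t)) t).trans_lt hn

theorem CurveTendsto.tendsto_apply (h : CurveTendsto μs μ) (t : I) :
    Tendsto (fun n => μs n t) atTop (𝓝 (μ t)) :=
  tendsto_iff_edist_tendsto_0.2 (tendsto_of_tendsto_of_tendsto_of_le_of_le tendsto_const_nhds h
    (fun _ => zero_le) fun n => le_iSup (fun t => W₁ (μs n t) (μ t)) t)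

/-- Narrow convergence at each time, then dominated convergence in time. -/
theorem CurveTendsto.tendsto_spaceTimeLaw (h : CurveTendsto μs μ) (hμs : ∀ n, Continuous (μs n))
    (hμ : Continuous μ) :
    Tendsto (fun n => spaceTimeLaw (hμs n)) atTop (𝓝 (spaceTimeLaw hμ)) := by
  refine ProbabilityMeasure.tendsto_iff_forall_integral_tendsto.2 fun f => ?_
  have hi : ∀ {ν : I → P₁ d} (hν : Continuous ν), Integrable f (spaceTime ν) := fun hν =>
    have := isProbabilityMeasure_spaceTime hν
    f.integrable _
  have e : ∀ {ν : I → P₁ d} (hν : Continuous ν),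
      ∫ z, f z ∂(spaceTimeLaw hν : Measure (Space d × I)) = ∫ t, ∫ y, f (y, t) ∂(ν t).meas :=
    fun hν => integral_spaceTime hν (hi hν)
  simp_rw [e]
  refine tendsto_integral_of_dominated_convergence (fun _ => ‖f‖)
    (fun n => (integrable_integral_spaceTime (hμs n) (hi (hμs n))).aestronglyMeasurable)
    (integrable_const _) (fun n => Eventually.of_forall fun t => ?_)
    (Eventually.of_forall fun t => ?_)
  · refine (norm_integral_le_of_norm_le_const (μ := (μs n t).meas)
      (Eventually.of_forall fun y => f.norm_coe_le_norm _)).trans ?_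
    simp
  · exact (ProbabilityMeasure.tendsto_iff_forall_integral_tendsto.1
      ((P₁.continuous_val.tendsto _).comp (h.tendsto_apply t)))
      (f.compContinuous ⟨fun y => (y, t), by fun_prop⟩)

/-- Near an infinite value l is infinite; near a finite one, each nearby point is either covered by
continuity or carries the value ∞. -/
theorem lowerSemicontinuous_of_isOpen_of_continuousOn {X : Type*} [TopologicalSpace X]
    {l : X → ℝ≥0∞} (h1 : IsOpen {y | l y = ⊤}) (h2 : ContinuousOn l {y | l y < ⊤}) :
    LowerSemicontinuous l := by
  intro y a ha
  by_cases hy : l y = ⊤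
  · filter_upwards [h1.mem_nhds hy] with z hz
    rw [show l z = ⊤ from hz]
    exact ha.trans_le le_top
  · have h3 := (h2 y (lt_top_iff_ne_top.2 hy)).eventually (lt_mem_nhds ha)
    filter_upwards [eventually_nhdsWithin_iff.1 h3] with z hz
    by_cases hz' : l z = ⊤
    · rw [hz']
      exact ha.trans_le le_top
    · exact hz (lt_top_iff_ne_top.2 hz')

/-- Lower semicontinuity of the state cost. -/
theorem IsStateCost.lintegral_le_liminf {L : Space d → P₁ d → ℝ≥0∞} (hL : IsStateCost L)
    (h : CurveTendsto μs μ) (hμs : ∀ n, Continuous (μs n)) (hμ : Continuous μ) :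
    ∫⁻ t, ∫⁻ y, L y (μ t) ∂(μ t).meas ≤
      liminf (fun n => ∫⁻ t, ∫⁻ y, L y (μs n t) ∂(μs n t).meas) atTop := by
  have hlim := h.tendsto_spaceTimeLaw hμs hμ
  rcases hL with ⟨hfin, huc⟩ | ⟨l, hl, hopen, hcont⟩
  · have hc : ∀ {ν : I → P₁ d}, Continuous ν →
        Continuous fun z : Space d × I => L z.1 (ν z.2) := by
      intro ν hν
      have h1 : Continuous fun z : Space d × I => (L z.1 (ν z.2)).toReal :=
        huc.uniformContinuous.continuous.comp (continuous_fst.prodMk (hν.comp continuous_snd))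
      exact (ENNReal.continuous_ofReal.comp h1).congr fun z => ENNReal.ofReal_toReal (hfin _ _)
    refine ENNReal.le_of_forall_pos_le_add fun η hη _ => ?_
    obtain ⟨r, hr, hrη⟩ := huc η hη
    -- Uniform continuity freezes the measure argument at the limit curve with an error η uniform in
    -- space and time, leaving a fixed continuous integrand against varying measures.
    have hev : ∀ᶠ n in atTop, ∫⁻ z, L z.1 (μ z.2) ∂spaceTime (μs n)
        ≤ (∫⁻ t, ∫⁻ y, L y (μs n t) ∂(μs n t).meas) + η := by
      filter_upwards [h.eventually_lt hr] with n hn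
      have := isProbabilityMeasure_spaceTime (hμs n)
      have e := lintegral_spaceTime (hμs n) (hc (hμs n)).measurable
      simp only at e
      rw [← e]
      have hle : ∀ z : Space d × I, L z.1 (μ z.2) ≤ L z.1 (μs n z.2) + η := by
        intro z
        have h1 := hrη z.1 z.1 (μs n z.2) (μ z.2) (by simpa using hr) (hn z.2)
        rw [Real.dist_eq, abs_lt] at h1
        rw [← ENNReal.toReal_le_toReal (hfin _ _) (ENNReal.add_ne_top.2 ⟨hfin _ _, ENNReal.coe_ne_top⟩),
          ENNReal.toReal_add (hfin _ _) ENNReal.coe_ne_top, ENNReal.coe_toReal]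
        linarith [h1.1]
      refine (lintegral_mono hle).trans_eq ?_
      rw [lintegral_add_right _ measurable_const]
      simp
    calc ∫⁻ t, ∫⁻ y, L y (μ t) ∂(μ t).meas
        = ∫⁻ z, L z.1 (μ z.2) ∂spaceTime μ := (lintegral_spaceTime hμ (hc hμ).measurable).symm
      _ ≤ liminf (fun n => ∫⁻ z, L z.1 (μ z.2) ∂spaceTime (μs n)) atTop :=
          lintegral_le_liminf_of_lowerSemicontinuous hlim (hc hμ).lowerSemicontinuous
      _ ≤ liminf (fun n => (∫⁻ t, ∫⁻ y, L y (μs n t) ∂(μs n t).meas) + η) atTop :=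
          liminf_le_liminf hev
      _ = _ := liminf_add_const atTop _ _ (by isBoundedDefault) (by isBoundedDefault)
  · have hlsc : LowerSemicontinuous fun z : Space d × I => l z.1 :=
      (lowerSemicontinuous_of_isOpen_of_continuousOn hopen hcont).comp continuous_fst
    have e : ∀ {ν : I → P₁ d}, Continuous ν →
        ∫⁻ t, ∫⁻ y, L y (ν t) ∂(ν t).meas = ∫⁻ z, l z.1 ∂spaceTime ν := by
      intro ν hν
      simp_rw [lintegral_spaceTime hν hlsc.measurable, hl]
    rw [e hμ]
    refine (lintegral_le_liminf_of_lowerSemicontinuous hlim hlsc).trans_eq ?_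
    exact congrArg (fun s => liminf s atTop) (funext fun n => (e (hμs n)).symm)

/-- Stability of the continuity equation. -/
theorem continuityEquation_of_tendsto {D : Data d} (hD : D.IsAdmissible)
    (h : CurveTendsto μs μ) (hμs : ∀ n, Continuous (μs n)) (hμ : Continuous μ)
    {u : ℕ → Space d × I → D.U} (hu : ∀ n, Integrable (u n) (spaceTime (μs n)))
    {v : Space d × I → D.U} (hv : Integrable v (spaceTime μ))
    (huv : ∀ f : BoundedContinuousFunction (Space d × I) (D.U →L[ℝ] ℝ),
      Tendsto (fun n => ∫ z, f z (u n z) ∂spaceTime (μs n)) atTop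
        (𝓝 (∫ z, f z (v z) ∂spaceTime μ)))
    (hCE : ∀ n, D.ContinuityEquation (μs n) ((spaceTime (μs n)).withDensityᵥ (u n))) :
    D.ContinuityEquation μ ((spaceTime μ).withDensityᵥ v) := by
  rw [continuityEquation_withDensityᵥ_iff hD hμ hv]
  intro φ hφ hφc hφt
  obtain ⟨C, hC⟩ := exists_fderiv_bound hφ hφc
  have hC0 : 0 ≤ C := (norm_nonneg _).trans (hC 0)
  have hlim := h.tendsto_spaceTimeLaw hμs hμ
  have hcd := continuous_fderiv_coe hφ (d := d)
  have l2 : Tendsto (fun n => ∫ z, fderiv ℝ φ (z.1, (z.2 : ℝ)) ((u n z : Space d), 0)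
      ∂spaceTime (μs n)) atTop
      (𝓝 (∫ z, fderiv ℝ φ (z.1, (z.2 : ℝ)) ((v z : Space d), 0) ∂spaceTime μ)) := by
    set T : D.U →L[ℝ] Space d × ℝ := (ContinuousLinearMap.inl ℝ (Space d) ℝ).comp D.U.subtypeL
    exact huv (BoundedContinuousFunction.ofNormedAddCommGroup
      (fun z : Space d × I => (fderiv ℝ φ (z.1, (z.2 : ℝ))).comp T)
      (hcd.clm_comp continuous_const) (C * ‖T‖) fun z =>
        (ContinuousLinearMap.opNorm_comp_le _ _).trans (by gcongr; exact hC _))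
  have hfc : ∀ {ν : I → P₁ d}, Continuous ν → Continuous fun z : Space d × I =>
      fderiv ℝ φ (z.1, (z.2 : ℝ)) (D.F z.1 (ν z.2), 1) := fun hν =>
    hcd.clm_apply ((hD.continuous_field hν).prodMk continuous_const)
  have l1 : Tendsto (fun n => ∫ z, fderiv ℝ φ (z.1, (z.2 : ℝ)) (D.F z.1 (μs n z.2), 1)
      ∂spaceTime (μs n)) atTop
      (𝓝 (∫ z, fderiv ℝ φ (z.1, (z.2 : ℝ)) (D.F z.1 (μ z.2), 1) ∂spaceTime μ)) := by
    -- The field grows linearly, but multiplied by the derivatives of φ it is bounded and can be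
    -- used as a narrow test function.
    have hcs : HasCompactSupport fun z : Space d × I =>
        fderiv ℝ φ (z.1, (z.2 : ℝ)) (D.F z.1 (μ z.2), 1) := by
      refine HasCompactSupport.intro ((hφc.isCompact.image continuous_fst).prod isCompact_univ)
        fun z hz => ?_
      have : (z.1, (z.2 : ℝ)) ∉ tsupport φ := fun hm => hz ⟨⟨_, hm, rfl⟩, mem_univ _⟩
      rw [image_eq_zero_of_notMem_tsupport (f := fderiv ℝ φ)
        (fun hm => this (tsupport_fderiv_subset ℝ hm))]
      rfl
    obtain ⟨B, hB⟩ := hcs.exists_bound_of_continuous (hfc hμ)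
    have l3 := (ProbabilityMeasure.tendsto_iff_forall_integral_tendsto.1 hlim)
      (BoundedContinuousFunction.ofNormedAddCommGroup _ (hfc hμ) B hB)
    -- The dependence of the field on the moving curve is removed by joint uniform continuity, using
    -- uniform W₁ convergence in time.
    have l4 : Tendsto (fun n => ∫ z, fderiv ℝ φ (z.1, (z.2 : ℝ)) (D.F z.1 (μs n z.2), 1)
        ∂spaceTime (μs n) - ∫ z, fderiv ℝ φ (z.1, (z.2 : ℝ)) (D.F z.1 (μ z.2), 1)
        ∂spaceTime (μs n)) atTop (𝓝 0) := by
      refine Metric.tendsto_nhds.2 fun η hη => ?_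
      obtain ⟨r, hr, hrη⟩ := hD.field_cont (η / (2 * (C + 1))) (by positivity)
      filter_upwards [h.eventually_lt hr] with n hn
      have := isProbabilityMeasure_spaceTime (hμs n)
      have i1 := integrable_apply_of_bounded (m := spaceTime (μs n)) hcd.aestronglyMeasurable
        (fun z => hC _) ((hD.integrable_field (hμs n)).prodMk (integrable_const (1 : ℝ)))
      have i2 : Integrable (fun z : Space d × I =>
          fderiv ℝ φ (z.1, (z.2 : ℝ)) (D.F z.1 (μ z.2), 1)) (spaceTime (μs n)) :=
        Integrable.of_bound (hfc hμ).aestronglyMeasurable B (Eventually.of_forall hB)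
      rw [← integral_sub i1 i2, dist_zero_right]
      refine (norm_integral_le_of_norm_le_const (μ := spaceTime (μs n)) (C := η / 2)
        (Eventually.of_forall fun z => ?_)).trans_lt ?_
      · rw [← map_sub]
        refine (ContinuousLinearMap.le_opNorm _ _).trans ?_
        have h1 := hrη z.1 z.1 (μs n z.2) (μ z.2) (by simpa using hr) (hn z.2)
        rw [dist_eq_norm] at h1
        have h2 : ‖(D.F z.1 (μs n z.2), (1 : ℝ)) - (D.F z.1 (μ z.2), 1)‖
            ≤ η / (2 * (C + 1)) := by
          rw [Prod.mk_sub_mk, sub_self, Prod.norm_mk, norm_zero]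
          exact max_le h1.le (by positivity)
        calc _ ≤ (C + 1) * (η / (2 * (C + 1))) :=
              mul_le_mul ((hC _).trans (by linarith)) h2 (norm_nonneg _) (by positivity)
          _ = η / 2 := by field_simp
      · simpa using hη
    have l5 := l4.add l3
    rw [zero_add] at l5
    refine l5.congr fun n => ?_
    exact sub_add_cancel _ _
  refine tendsto_nhds_unique (l1.add l2) (tendsto_const_nhds.congr fun n => ?_)
  exact (((continuityEquation_withDensityᵥ_iff hD (hμs n) (hu n)).1 (hCE n)) φ hφ hφc hφt).symm

end Limit

theorem liminf_add_liminf_le (a b : ℕ → ℝ≥0∞) :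
    liminf a atTop + liminf b atTop ≤ liminf (fun n => a n + b n) atTop := by
  simp only [liminf_eq_iSup_iInf_of_nat]
  rw [ENNReal.iSup_add_iSup_of_monotone]
  · exact iSup_mono fun n => le_iInf₂ fun i hi => add_le_add (iInf₂_le i hi) (iInf₂_le i hi)
  · exact fun n m hnm => biInf_mono fun i hi => hnm.trans hi
  · exact fun n m hnm => biInf_mono fun i hi => hnm.trans hi

/-- A control whose cost almost attains the control cost of the flux. -/
theorem Data.exists_control_lintegral_lt (D : Data d) {μ : I → P₁ d} {ν : Flux D.U}
    (h : D.Psi μ ν < ⊤) {η : ℝ≥0∞} (hη : η ≠ 0) :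
    ∃ u : Space d × I → D.U, Measurable u ∧ Integrable u (spaceTime μ) ∧
      ν = (spaceTime μ).withDensityᵥ u ∧
      ∫⁻ t : I, ∫⁻ y, ENNReal.ofReal (D.ψ (u (y, t))) ∂(μ t).meas < D.Psi μ ν + η := by
  have h1 : D.Psi μ ν < D.Psi μ ν + η := ENNReal.lt_add_right h.ne hη
  conv_lhs at h1 => rw [Data.Psi]
  simp only [iInf_lt_iff] at h1
  obtain ⟨u, ⟨h2, h3, h4⟩, h5⟩ := h1
  exact ⟨u, h2, h3, h4, h5⟩

/-- Narrow convergence of fluxes with densities. -/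
theorem narrowTendsto_of_tendsto {U : Submodule ℝ (Space d)} {μs : ℕ → I → P₁ d} {μ : I → P₁ d}
    {u : ℕ → Space d × I → U} (hu : ∀ n, Integrable (u n) (spaceTime (μs n)))
    {v : Space d × I → U} (hv : Integrable v (spaceTime μ))
    (huv : ∀ f : BoundedContinuousFunction (Space d × I) (U →L[ℝ] ℝ),
      Tendsto (fun n => ∫ z, f z (u n z) ∂spaceTime (μs n)) atTop
        (𝓝 (∫ z, f z (v z) ∂spaceTime μ))) :
    NarrowTendsto (fun n => (spaceTime (μs n)).withDensityᵥ (u n))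
      ((spaceTime μ).withDensityᵥ v) := by
  intro f
  have hfc : Continuous fun x => (f x : Space d) := continuous_subtype_val.comp f.continuous
  have hfb : ∀ x, ‖(f x : Space d)‖ ≤ ‖f‖ := f.norm_coe_le_norm
  have e : ∀ {m : Measure (Space d × I)} {w : Space d × I → U}, Integrable w m →
      ∫ᵛ x, (f x : Space d) ∂[pairing U; m.withDensityᵥ w] = ∫ z, pairing U (f z) (w z) ∂m :=
    fun hw => integral_withDensityᵥ _ hw _ hfc.stronglyMeasurable hfb
  simp_rw [e hv, e (hu _)]
  exact huv (BoundedContinuousFunction.ofNormedAddCommGroup (fun z => pairing U (f z))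
    ((pairing U).continuous.comp hfc) ‖f‖ fun z =>
      ContinuousLinearMap.opNorm_le_bound _ (norm_nonneg f) fun w =>
        (norm_inner_le_norm (𝕜 := ℝ) (f z : Space d) (w : Space d)).trans
          (by gcongr; exacts [hfb z, le_rfl]))

end MeanFieldControl

open MeanFieldControl

/-! ### The convergence theorem -/

theorem theorem1p2 {d : ℕ} (D : MeanFieldControl.Data d) (hD : D.IsAdmissible)
    (k : MeanFieldControl.Space d → ℝ) (hk : MeanFieldControl.IsKernel k) (hk1 : ∫ x, k x = 1)
    (ε : ℝ) (hε : 0 < ε) (hfeas : D.IsFeasible (D.energy ε))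
    (δ : ℕ → ℝ) (hδ : ∀ n, 0 < δ n) (hδ0 : Tendsto δ atTop (𝓝 0))
    (μs : ℕ → I → MeanFieldControl.P₁ d) (νs : ℕ → MeanFieldControl.Flux D.U)
    (hsol : ∀ n, D.IsSolution (D.energyMollified k ε (δ n)) (μs n, νs n)) :
    ∃ (μ : I → MeanFieldControl.P₁ d) (ν : MeanFieldControl.Flux D.U) (ι : ℕ → ℕ),
      StrictMono ι ∧
      MeanFieldControl.CurveTendsto (fun n => μs (ι n)) μ ∧
      MeanFieldControl.NarrowTendsto (fun n => νs (ι n)) ν ∧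
      D.IsSolution (D.energy ε) (μ, ν) := by
  obtain ⟨q₀, hq₀, hq₀E⟩ := hfeas
  have hmin : ∀ n, ∀ q ∈ D.constraint,
      D.energyMollified k ε (δ n) (μs n, νs n) ≤ D.energy ε q := fun n q hq =>
    ((hsol n).2 hq).trans
      (add_le_add le_rfl (hk.terminalMollified_le_terminal hk1 hD.target ε (hδ n) _))
  have hPsi : ∀ n, D.Psi (μs n) (νs n) ≤ D.energy ε q₀ := fun n =>
    le_trans (le_trans le_self_add le_self_add) (hmin n q₀ hq₀)
  -- The control cost is an infimum over densities; near-optimal densities with slack 1/(n+1) are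
  -- enough, because the slack is bounded by 1 and vanishes in the limit.
  have hη : ∀ n : ℕ, ((n : ℝ≥0∞) + 1)⁻¹ ≠ 0 := fun n => by simp
  choose u hum hui hνu hψu using fun n =>
    D.exists_control_lintegral_lt ((hPsi n).trans_lt hq₀E) (hη n)
  have hμs : ∀ n, Continuous (μs n) := fun n => (hsol n).1.1.continuous
  have hprob : ∀ n, IsProbabilityMeasure (spaceTime (μs n)) := fun n =>
    isProbabilityMeasure_spaceTime (hμs n)
  have hψm : ∀ w : Space d × I → D.U, Measurable w →
      Measurable fun z => ENNReal.ofReal (D.ψ (w z)) := fun w hw =>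
    (hD.controlCost.lsc.measurable.comp hw).ennreal_ofReal
  have hψst : ∀ n, ∫⁻ z, ENNReal.ofReal (D.ψ (u n z)) ∂spaceTime (μs n)
      ≤ D.Psi (μs n) (νs n) + ((n : ℝ≥0∞) + 1)⁻¹ := fun n => by
    rw [lintegral_spaceTime (hμs n) (hψm _ (hum n))]
    exact (hψu n).le
  have hfam : IsControlledFamily D μs u :=
    { continuous := hμs
      integrable := hui
      equation := fun n => hνu n ▸ (hsol n).1.2.1
      initial := fun n => (hsol n).1.2.2
      uniform := fun η hη => hD.controlCost.exists_integral_max_sub_le hum hui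
        (M := D.energy ε q₀ + 1) (ENNReal.add_lt_top.2 ⟨hq₀E, ENNReal.one_lt_top⟩)
        (fun n => (hψst n).trans (add_le_add (hPsi n) (by simp))) hη }
  obtain ⟨μ, ι₁, hμ, hι₁, hlim₁⟩ := hfam.exists_tendsto_subseq hD
  obtain ⟨v, ι₂, hι₂, hv, hvi, hvf, hvψ⟩ := exists_tendsto_subseq_of_uniform
    (hlim₁.tendsto_spaceTimeLaw (fun n => hμs _) hμ) (u := fun n => u (ι₁ n)) (fun n => hum _)
    (fun n => hui _) (fun η hη => by
      obtain ⟨A, hA, h⟩ := hfam.uniform η hη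
      exact ⟨A, hA, fun n => h _⟩)
  set ι : ℕ → ℕ := fun n => ι₁ (ι₂ n) with hι
  have hιm : StrictMono ι := hι₁.comp hι₂
  have hlim : CurveTendsto (fun n => μs (ι n)) μ := hlim₁.comp hι₂
  have hνι : (fun n => νs (ι n)) = fun n => (spaceTime (μs (ι n))).withDensityᵥ (u (ι n)) :=
    funext fun n => hνu (ι n)
  have hCE := continuityEquation_of_tendsto hD hlim (fun n => hμs _) hμ (fun n => hui (ι n)) hvi hvf
    fun n => hfam.equation (ι n)
  -- Arzelà–Ascoli yields only a continuous limit; its absolute continuity is recovered from the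
  -- limiting equation and the integrability of v.
  refine ⟨μ, (spaceTime μ).withDensityᵥ v, ι, hιm, hlim, ?_,
    ⟨isACCurve_of_continuityEquation hD hμ hv hvi hCE, hCE, ?_⟩, fun q hq => ?_⟩
  · rw [hνι]
    exact narrowTendsto_of_tendsto (fun n => hui _) hvi hvf
  · exact tendsto_nhds_unique (hlim.tendsto_apply 0)
      (tendsto_const_nhds.congr fun n => (hfam.initial _).symm)
  · have h1 : D.Psi μ ((spaceTime μ).withDensityᵥ v) ≤ liminf (fun n =>
        ∫⁻ z, ENNReal.ofReal (D.ψ (u (ι n) z)) ∂spaceTime (μs (ι n))) atTop := by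
      refine (iInf₂_le v ⟨hv, hvi, rfl⟩).trans ?_
      rw [← lintegral_spaceTime hμ (hψm v hv)]
      exact hvψ D.ψ hD.controlCost.convex hD.controlCost.nonneg
    have h2 := hD.stateCost.lintegral_le_liminf hlim (fun n => hμs _) hμ
    have h3 := terminal_le_liminf (ε := ε) hD.target hk hk1 (fun n => hδ (ι n))
      (hδ0.comp hιm.tendsto_atTop) (hlim.tendsto_apply 1) hε
    show D.energy ε (μ, (spaceTime μ).withDensityᵥ v) ≤ D.energy ε q
    calc D.energy ε (μ, (spaceTime μ).withDensityᵥ v) ≤ _ :=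
          (add_le_add ((add_le_add h1 h2).trans (liminf_add_liminf_le _ _)) h3).trans
            (liminf_add_liminf_le _ _)
      -- Each term is at most the mollified energy of a minimizer plus the slack, and that energy is
      -- below E_ε(q) for the arbitrary competitor q.
      _ ≤ liminf (fun n => D.energy ε q + ((ι n : ℝ≥0∞) + 1)⁻¹) atTop := by
          refine liminf_le_liminf (Eventually.of_forall fun n => ?_)
          refine (add_le_add (add_le_add (hψst (ι n)) le_rfl) le_rfl).trans ?_
          refine le_trans (le_of_eq ?_) (add_le_add (hmin (ι n) q hq) le_rfl)
          simp only [Data.energyMollified, Data.G]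
          ring
      _ = D.energy ε q := by
          refine Tendsto.liminf_eq ?_
          have h0 : Tendsto (fun n : ℕ => ((ι n : ℝ≥0∞) + 1)⁻¹) atTop (𝓝 0) := by
            rw [← ENNReal.inv_top]
            refine tendsto_inv_iff.2 ?_
            exact tendsto_of_tendsto_of_tendsto_of_le_of_le
              (ENNReal.tendsto_nat_nhds_top.comp hιm.tendsto_atTop) tendsto_const_nhds
              (fun n => le_self_add) fun n => le_top
          simpa using tendsto_const_nhds.add h0
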